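/- Let $A=\bigoplus_{n\in\mathbb Z}A_n$ be a commutative $\mathbb Z$-graded ring which is Noetherian, let $I^+=A_{>0}\cdot A$ be the ideal generated by the homogeneous elements of positive degree, and let $f_1,\dots,f_r$ be any homogeneous elements generating $I^+$. Let $\mathrm{Gr}(A)$ be the abelian category of $\mathbb Z$-graded $A$-modules (with degree-preserving $A$-linear maps), $\mathrm{gr}(A)$ the finitely generated ones, and $\mathrm{Tor}^+\subset\mathrm{Gr}(A)$ the Serre subcategory of graded modules $M$ such that for all $x\in M$ and $f\in I^+$ there is $n>0$ with $f^nx=0$. Let $\phi^*:\mathrm{Gr}(A)\to \mathrm{Q}^+\mathrm{Gr}(A)=\mathrm{Gr}(A)/\mathrm{Tor}^+$ be the Serre quotient functor, $\mathrm{q}^+\mathrm{gr}(A)$ the essential image of $\mathrm{gr}(A)$ under $\phi^*$, and write again $\phi^*:\mathcal D(\mathrm{Gr}(A))\to\mathcal D(\mathrm{Q}^+\mathrm{Gr}(A))$ for the induced exact functor on (unbounded) derived categories. For $M\in\mathcal D(\mathrm{Gr}(A))$ let $\mathbf R\Gamma_{I^+}(M)$ be the total complex of $M\to\prod_i M_{f_i}\to\prod_{i<j}M_{f_if_j}\to\cdots\to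 M_{f_1\cdots f_r}$ (with $M$ in position $0$), and let $\check{\mathcal C}_{I^+}(M)$ be the total complex of $\prod_i M_{f_i}\to\prod_{i<j}M_{f_if_j}\to\cdots\to M_{f_1\cdots f_r}$ (with $\prod_iM_{f_i}$ in position $0$). For $\spadesuit\in\{-,b\}$, let $\mathcal D^{\spadesuit}(-)\subset\mathcal D(-)$ be the full subcategory of objects with bounded above (for $\spadesuit=-$), respectively bounded (for $\spadesuit=b$), cohomology, and put: * $\mathcal D^\spadesuit_{I^+\text{-triv}}(\mathrm{Gr}(A))$: the full subcategory of those $M\in\mathcal D^\spadesuit(\mathrm{Gr}(A))$ with $\mathbf R\Gamma_{I^+}(M)\simeq0$; * $\mathcal D^\spadesuit_{\mathrm{coh}}(\mathrm{Gr}(A))$, resp. $\mathcal D^\spadesuit_{\mathrm{coh}}(\mathrm{Q}^+\mathrm{Gr}(A))$: the full subcategory of objects of $\mathcal D^\spadesuit$ all of whose cohomologies lie in $\mathrm{gr}(A)$, resp. in $\mathrm{q}^+\mathrm{gr}(A)$; * $\mathcal D^\spadesuit_{\mathrm{coh}(I^+\text{-triv})}(\mathrm{Gr}(A))$: the essential image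 of $\mathcal D^\spadesuit_{\mathrm{coh}}(\mathrm{Gr}(A))$ under $\check{\mathcal C}_{I^+}$. Then $\phi^*:\mathcal D(\mathrm{Gr}(A))\to\mathcal D(\mathrm{Q}^+\mathrm{Gr}(A))$ has an exact right adjoint $\mathbf R\phi_*$, the counit $\phi^*\mathbf R\phi_*\to\mathrm{id}$ is an isomorphism, and for each $\spadesuit\in\{-,b\}$: 1. $\mathcal D^\spadesuit_{I^+\text{-triv}}(\mathrm{Gr}(A))$, $\mathcal D^\spadesuit_{\mathrm{coh}(I^+\text{-triv})}(\mathrm{Gr}(A))$ and $\mathcal D^\spadesuit_{\mathrm{coh}}(\mathrm{Q}^+\mathrm{Gr}(A))$ are triangulated subcategories, and $\mathcal D^\spadesuit_{\mathrm{coh}(I^+\text{-triv})}(\mathrm{Gr}(A))\subset\mathcal D^\spadesuit_{I^+\text{-triv}}(\mathrm{Gr}(A))$; 2. $\phi^*$ and $\mathbf R\phi_*$ restrict, with the unit and the counit, to mutually quasi-inverse exact equivalences $$\phi^*:\mathcal D^\spadesuit_{I^+\text{-triv}}(\mathrm{Gr}(A))\rightleftarrows\mathcal D^\spadesuit(\mathrm{Q}^+\mathrm{Gr}(A)):\mathbf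 R\phi_*;$$ 3. these restrict further to mutually quasi-inverse exact equivalences $$\phi^*:\mathcal D^\spadesuit_{\mathrm{coh}(I^+\text{-triv})}(\mathrm{Gr}(A))\rightleftarrows\mathcal D^\spadesuit_{\mathrm{coh}}(\mathrm{Q}^+\mathrm{Gr}(A)):\mathbf R\phi_*.$$ -/

import Mathlib

open CategoryTheory Limits

universe u

/-- A `ℤ`-graded module over the `ℤ`-graded commutative ring `A = ⨁ 𝒜 n`: an `A`-module `M`
with an internal direct sum decomposition `M = ⨁ deg n` such that `𝒜 i • deg j ⊆ deg (i + j)`. -/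
structure GrMod {A : Type u} [CommRing A] (𝒜 : ℤ → AddSubgroup A) where
  carrier : Type u
  [addCommGroup : AddCommGroup carrier]
  [module : Module A carrier]
  deg : ℤ → AddSubgroup carrier
  isInternal : DirectSum.IsInternal deg
  smul_mem : ∀ {i j : ℤ} {a : A} {x : carrier}, a ∈ 𝒜 i → x ∈ deg j → a • x ∈ deg (i + j)

namespace GrMod

variable {A : Type u} [CommRing A] {𝒜 : ℤ → AddSubgroup A}

instance : CoeSort (GrMod 𝒜) (Type u) := ⟨carrier⟩
instance (M : GrMod 𝒜) : AddCommGroup M := M.addCommGroup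
instance (M : GrMod 𝒜) : Module A M := M.module

/-! ### Homogeneous components -/

section Internal

variable {M : Type u} [AddCommGroup M]

/-- A finitely supported family, indexed by `ℤ`, of elements with the `n`-th one of degree `n`. -/
def IsHomFamily (deg : ℤ → AddSubgroup M) (y : ℤ →₀ M) : Prop := ∀ n, y n ∈ deg n

lemma isInternal_of {deg : ℤ → AddSubgroup M}
    (h₁ : ∀ x, ∃ y : ℤ →₀ M, IsHomFamily deg y ∧ (y.sum fun _ x => x) = x)
    (h₂ : ∀ y : ℤ →₀ M, IsHomFamily deg y → (y.sum fun _ x => x) = 0 → y = 0) :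
    DirectSum.IsInternal deg := by
  classical
  constructor
  · rw [injective_iff_map_eq_zero]
    intro d hd
    have := h₂ (Finsupp.onFinset d.support (fun i => (d i : M)) (by
      intro i hi
      rw [DFinsupp.mem_support_iff]
      intro h
      simp [h] at hi)) (fun n => by simp) (by
      rw [DirectSum.coeAddMonoidHom_eq_dfinsuppSum] at hd
      refine Eq.trans ?_ hd
      rw [Finsupp.onFinset_sum _ (by simp)]
      rfl)
    ext i
    exact DFunLike.congr_fun this i
  · intro x
    obtain ⟨y, hy, rfl⟩ := h₁ x
    refine ⟨∑ n ∈ y.support, DirectSum.of (fun i => deg i) n ⟨y n, hy n⟩, ?_⟩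
    rw [map_sum]
    simp [Finsupp.sum]

lemma exists_family {deg : ℤ → AddSubgroup M} (h : DirectSum.IsInternal deg) (x : M) :
    ∃ y : ℤ →₀ M, IsHomFamily deg y ∧ (y.sum fun _ x => x) = x := by
  classical
  obtain ⟨d, rfl⟩ := h.2 x
  refine ⟨Finsupp.onFinset d.support (fun i => (d i : M)) (by
      intro i hi
      rw [DFinsupp.mem_support_iff]
      intro h
      simp [h] at hi), fun n => by simp, ?_⟩
  rw [DirectSum.coeAddMonoidHom_eq_dfinsuppSum, Finsupp.onFinset_sum _ (by simp)]
  rfl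

lemma family_eq_zero {deg : ℤ → AddSubgroup M} (h : DirectSum.IsInternal deg) (y : ℤ →₀ M)
    (hy : IsHomFamily deg y) (hs : (y.sum fun _ x => x) = 0) : y = 0 := by
  classical
  have := h.1 (a₁ := ∑ n ∈ y.support, DirectSum.of (fun i => deg i) n ⟨y n, hy n⟩) (a₂ := 0) (by
    rw [map_sum]
    simpa [Finsupp.sum] using hs)
  ext n
  have h2 := congrArg (fun d => ((d n : deg n) : M)) this
  by_cases hn : n ∈ y.support
  · simp only [DirectSum.sum_apply] at h2
    rw [Finset.sum_eq_single n] at h2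
    · simpa using h2
    · intro m _ hm
      exact DirectSum.of_eq_of_ne _ _ _ (Ne.symm hm)
    · simp [hn]
  · simpa using hn

lemma IsHomFamily.single {deg : ℤ → AddSubgroup M} {n : ℤ} {x : M} (hx : x ∈ deg n) :
    IsHomFamily deg (Finsupp.single n x) := by
  intro m
  classical
  rw [Finsupp.single_apply]
  split_ifs with h
  · exact h ▸ hx
  · exact zero_mem _

lemma IsHomFamily.sub {deg : ℤ → AddSubgroup M} {y z : ℤ →₀ M} (hy : IsHomFamily deg y)
    (hz : IsHomFamily deg z) : IsHomFamily deg (y - z) :=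
  fun n => (deg n).sub_mem (hy n) (hz n)

lemma sum_sub (y z : ℤ →₀ M) :
    ((y - z).sum fun _ x => x) = (y.sum fun _ x => x) - (z.sum fun _ x => x) :=
  Finsupp.sum_sub_index (by simp)

lemma family_eq {deg : ℤ → AddSubgroup M} (h : DirectSum.IsInternal deg) {y z : ℤ →₀ M}
    (hy : IsHomFamily deg y) (hz : IsHomFamily deg z)
    (hs : (y.sum fun _ x => x) = (z.sum fun _ x => x)) : y = z :=
  sub_eq_zero.1 (family_eq_zero h _ (hy.sub hz) (by rw [sum_sub, hs, sub_self]))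

lemma sum_mapRange {N F : Type*} [AddCommGroup N] [FunLike F M N] [AddMonoidHomClass F M N] (f : F)
    (y : ℤ →₀ M) :
    ((y.mapRange f (map_zero f)).sum fun _ x => x) = f (y.sum fun _ x => x) := by
  rw [Finsupp.sum_mapRange_index (by simp), Finsupp.sum, Finsupp.sum, map_sum]

end Internal

/-! ### The category of graded modules -/

/-- Morphisms of graded modules: `A`-linear maps which are homogeneous of degree `0`. -/
@[ext]
structure Hom (M N : GrMod 𝒜) where
  lin : M →ₗ[A] N
  map_mem : ∀ (n : ℤ) (x : M), x ∈ M.deg n → lin x ∈ N.deg n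

instance : Category (GrMod 𝒜) where
  Hom M N := Hom M N
  id M := ⟨LinearMap.id, fun _ _ h => h⟩
  comp f g := ⟨g.lin.comp f.lin, fun n x h => g.map_mem n _ (f.map_mem n x h)⟩

variable {M N P : GrMod 𝒜}

@[ext]
lemma hom_ext {f g : M ⟶ N} (h : ∀ x, f.lin x = g.lin x) : f = g :=
  Hom.ext (LinearMap.ext h)

@[simp] lemma id_lin (M : GrMod 𝒜) : Hom.lin (𝟙 M) = LinearMap.id := rfl
@[simp] lemma comp_lin (f : M ⟶ N) (g : N ⟶ P) : (f ≫ g).lin = g.lin.comp f.lin := rfl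

lemma family_map (f : M ⟶ N) {y : ℤ →₀ M} (hy : IsHomFamily M.deg y) :
    IsHomFamily N.deg (y.mapRange f.lin (map_zero _)) :=
  fun n => by simpa using f.map_mem n _ (hy n)

/-- If `f x` is homogeneous of degree `n`, then `f x = f x'` with `x'` homogeneous of degree `n`. -/
lemma exists_homogeneous (f : M ⟶ N) (x : M) (n : ℤ) (h : f.lin x ∈ N.deg n) :
    ∃ x' ∈ M.deg n, f.lin x' = f.lin x := by
  obtain ⟨y, hy, rfl⟩ := exists_family M.isInternal x
  have := family_eq N.isInternal (family_map f hy) (IsHomFamily.single h) (by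
    rw [sum_mapRange]; simp)
  refine ⟨y n, hy n, ?_⟩
  simpa using DFunLike.congr_fun this n

instance : Zero (M ⟶ N) := ⟨⟨0, fun _ _ _ => zero_mem _⟩⟩
instance : Add (M ⟶ N) :=
  ⟨fun f g => ⟨f.lin + g.lin, fun n x h => add_mem (f.map_mem n x h) (g.map_mem n x h)⟩⟩
instance : Neg (M ⟶ N) := ⟨fun f => ⟨-f.lin, fun n x h => neg_mem (f.map_mem n x h)⟩⟩
instance : Sub (M ⟶ N) :=
  ⟨fun f g => ⟨f.lin - g.lin, fun n x h => sub_mem (f.map_mem n x h) (g.map_mem n x h)⟩⟩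
instance : SMul ℕ (M ⟶ N) :=
  ⟨fun k f => ⟨k • f.lin, fun n x h => nsmul_mem (f.map_mem n x h) k⟩⟩
instance : SMul ℤ (M ⟶ N) :=
  ⟨fun k f => ⟨k • f.lin, fun n x h => zsmul_mem (f.map_mem n x h) k⟩⟩

lemma lin_injective : Function.Injective (fun f : M ⟶ N => f.lin) := fun _ _ h => Hom.ext h

instance : AddCommGroup (M ⟶ N) :=
  lin_injective.addCommGroup _ rfl (fun _ _ => rfl) (fun _ => rfl) (fun _ _ => rfl)
    (fun _ _ => rfl) (fun _ _ => rfl)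

@[simp] lemma zero_lin : Hom.lin (0 : M ⟶ N) = 0 := rfl
@[simp] lemma add_lin (f g : M ⟶ N) : Hom.lin (f + g) = f.lin + g.lin := rfl

instance : Preadditive (GrMod 𝒜) where
  add_comp _ _ _ f h g := by ext x; simp
  comp_add _ _ _ f g h := by ext x; simp

/-- The zero graded module. -/
def zeroObj (𝒜 : ℤ → AddSubgroup A) : GrMod 𝒜 where
  carrier := PUnit
  deg _ := ⊤
  isInternal := isInternal_of (fun x => ⟨0, fun _ => trivial, rfl⟩) (fun y _ _ => by ext)
  smul_mem _ _ := trivial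

lemma isZero_zeroObj : IsZero (zeroObj 𝒜) := by
  rw [IsZero.iff_id_eq_zero]
  exact hom_ext fun _ => rfl

instance : HasZeroObject (GrMod 𝒜) := ⟨⟨_, isZero_zeroObj⟩⟩

/-- The direct sum of two graded modules. -/
def prodObj (M N : GrMod 𝒜) : GrMod 𝒜 where
  carrier := M × N
  deg n := (M.deg n).prod (N.deg n)
  isInternal := isInternal_of
    (fun x => by
      obtain ⟨y, hy, hy'⟩ := exists_family M.isInternal x.1
      obtain ⟨z, hz, hz'⟩ := exists_family N.isInternal x.2
      refine ⟨y.mapRange (AddMonoidHom.inl M N) (map_zero _) +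
        z.mapRange (AddMonoidHom.inr M N) (map_zero _), fun n => ?_, ?_⟩
      · simpa [AddSubgroup.mem_prod] using ⟨hy n, hz n⟩
      · rw [Finsupp.sum_add_index (by simp) (by simp), sum_mapRange, sum_mapRange, hy', hz']
        simp)
    (fun y hy hs => by
      have h₁ := family_eq_zero M.isInternal (y.mapRange (AddMonoidHom.fst M N) (map_zero _))
        (fun n => by simpa using (hy n).1) (by rw [sum_mapRange, hs]; simp)
      have h₂ := family_eq_zero N.isInternal (y.mapRange (AddMonoidHom.snd M N) (map_zero _))
        (fun n => by simpa using (hy n).2) (by rw [sum_mapRange, hs]; simp)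
      ext n
      · simpa using DFunLike.congr_fun h₁ n
      · simpa using DFunLike.congr_fun h₂ n)
  smul_mem ha hx := ⟨M.smul_mem ha hx.1, N.smul_mem ha hx.2⟩

/-- `prodObj M N` as a biproduct. -/
def prodBicone (M N : GrMod 𝒜) : BinaryBicone M N where
  pt := prodObj M N
  fst := ⟨LinearMap.fst A M N, fun _ _ h => h.1⟩
  snd := ⟨LinearMap.snd A M N, fun _ _ h => h.2⟩
  inl := ⟨LinearMap.inl A M N, fun _ _ h => ⟨h, zero_mem _⟩⟩
  inr := ⟨LinearMap.inr A M N, fun _ _ h => ⟨zero_mem _, h⟩⟩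
  inl_fst := hom_ext fun _ => rfl
  inl_snd := hom_ext fun _ => rfl
  inr_fst := hom_ext fun _ => rfl
  inr_snd := hom_ext fun _ => rfl

instance : HasBinaryBiproducts (GrMod 𝒜) where
  has_binary_biproduct M N :=
    hasBinaryBiproduct_of_total (prodBicone M N) (hom_ext fun x =>
      Prod.ext (add_zero (x : M × N).1) (zero_add (x : M × N).2))

instance : HasTerminal (GrMod 𝒜) := HasZeroObject.hasTerminal

instance : HasFiniteProducts (GrMod 𝒜) := hasFiniteProducts_of_has_binary_and_terminal

/-- The kernel of a morphism. -/
def kerObj (f : M ⟶ N) : GrMod 𝒜 where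
  carrier := LinearMap.ker f.lin
  deg n := (M.deg n).comap (LinearMap.ker f.lin).subtype.toAddMonoidHom
  isInternal := isInternal_of
    (fun x => by
      obtain ⟨y, hy, hy'⟩ := exists_family M.isInternal x.1
      have h0 := family_eq_zero N.isInternal _ (family_map f hy) (by
        rw [sum_mapRange, hy', x.2])
      let z : ℤ →₀ LinearMap.ker f.lin := Finsupp.onFinset y.support
        (fun n => ⟨y n, by simpa using DFunLike.congr_fun h0 n⟩) (by
          intro n hn
          simpa [Subtype.ext_iff] using hn)
      refine ⟨z, fun n => hy n, ?_⟩
      apply Subtype.ext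
      have h1 := sum_mapRange (LinearMap.ker f.lin).subtype z
      rw [Submodule.subtype_apply] at h1
      rw [← h1, ← hy']
      congr 1
      ext n
      rfl)
    (fun y hy hs => by
      have h₁ := family_eq_zero M.isInternal
        (y.mapRange (LinearMap.ker f.lin).subtype (map_zero _))
        (fun n => hy n) (by rw [sum_mapRange, hs]; simp)
      ext n
      simpa using DFunLike.congr_fun h₁ n)
  smul_mem ha hx := M.smul_mem ha hx

/-- The inclusion of the kernel. -/
def kerι (f : M ⟶ N) : kerObj f ⟶ M := ⟨(LinearMap.ker f.lin).subtype, fun _ _ h => h⟩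

lemma kerι_comp (f : M ⟶ N) : kerι f ≫ f = 0 := hom_ext fun x => x.2

/-- The cokernel of a morphism. -/
def cokerObj (f : M ⟶ N) : GrMod 𝒜 where
  carrier := N ⧸ LinearMap.range f.lin
  deg n := (N.deg n).map (LinearMap.range f.lin).mkQ.toAddMonoidHom
  isInternal := isInternal_of
    (fun x => by
      obtain ⟨x, rfl⟩ := Submodule.mkQ_surjective _ x
      obtain ⟨y, hy, hy'⟩ := exists_family N.isInternal x
      exact ⟨y.mapRange (LinearMap.range f.lin).mkQ (map_zero _),
        fun n => ⟨y n, hy n, rfl⟩, by rw [sum_mapRange, hy']⟩)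
    (fun y hy hs => by
      classical
      choose z hz hz' using hy
      let z' : ℤ →₀ N := Finsupp.onFinset y.support (fun n => if y n = 0 then 0 else z n)
        (fun n hn => by
          rw [Finsupp.mem_support_iff]
          intro h
          simp [h] at hn)
      have hz'' : IsHomFamily N.deg z' := fun n => by
        by_cases h : y n = 0
        · simp [z', h]
        · simpa [z', h] using hz n
      have hm : z'.mapRange (LinearMap.range f.lin).mkQ (map_zero _) = y := by
        ext n
        by_cases h : y n = 0
        · simp [z', h]
        · simpa [z', h] using hz' n
      have h1 := sum_mapRange (LinearMap.range f.lin).mkQ z'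
      rw [hm, hs, eq_comm, Submodule.mkQ_apply, Submodule.Quotient.mk_eq_zero] at h1
      obtain ⟨w, hw⟩ := h1
      obtain ⟨v, hv, rfl⟩ := exists_family M.isInternal w
      rw [← sum_mapRange] at hw
      have h2 := family_eq N.isInternal (family_map f hv) hz'' hw
      rw [← hm, ← h2]
      ext n
      simp)
  smul_mem := by
    rintro i j a _ ha ⟨x, hx, rfl⟩
    exact ⟨a • x, N.smul_mem ha hx, rfl⟩

/-- The projection to the cokernel. -/
def cokerπ (f : M ⟶ N) : N ⟶ cokerObj f :=
  ⟨(LinearMap.range f.lin).mkQ, fun _ x h => ⟨x, h, rfl⟩⟩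

lemma comp_cokerπ (f : M ⟶ N) : f ≫ cokerπ f = 0 :=
  hom_ext fun x => (Submodule.Quotient.mk_eq_zero _).2 ⟨x, rfl⟩

/-- Lifting along an injective morphism. -/
noncomputable def liftInj (f : M ⟶ N) (hf : Function.Injective f.lin) (g : P ⟶ N)
    (hg : ∀ x, g.lin x ∈ LinearMap.range f.lin) : P ⟶ M where
  lin := (LinearEquiv.ofInjective f.lin hf).symm.toLinearMap.comp (g.lin.codRestrict _ hg)
  map_mem n x hx := by
    set y := ((LinearEquiv.ofInjective f.lin hf).symm.toLinearMap.comp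
      (g.lin.codRestrict _ hg)) x with hy
    have h : f.lin y = g.lin x := by
      have := (LinearEquiv.ofInjective f.lin hf).apply_symm_apply (g.lin.codRestrict _ hg x)
      exact congrArg Subtype.val this
    obtain ⟨y', hy', h'⟩ := exists_homogeneous f y n (h ▸ g.map_mem n x hx)
    rwa [← hf h']

lemma liftInj_comp (f : M ⟶ N) (hf : Function.Injective f.lin) (g : P ⟶ N)
    (hg : ∀ x, g.lin x ∈ LinearMap.range f.lin) : liftInj f hf g hg ≫ f = g :=
  hom_ext fun x => by
    have := (LinearEquiv.ofInjective f.lin hf).apply_symm_apply (g.lin.codRestrict _ hg x)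
    exact congrArg Subtype.val this

/-- Descending along a surjective morphism. -/
noncomputable def descSurj (f : M ⟶ N) (hf : Function.Surjective f.lin) (g : M ⟶ P)
    (hg : LinearMap.ker f.lin ≤ LinearMap.ker g.lin) : N ⟶ P where
  lin := ((LinearMap.ker f.lin).liftQ g.lin hg).comp
    (f.lin.quotKerEquivOfSurjective hf).symm.toLinearMap
  map_mem n x hx := by
    obtain ⟨y, rfl⟩ := hf x
    obtain ⟨y', hy', h⟩ := exists_homogeneous f y n hx
    rw [← h]
    have : (f.lin.quotKerEquivOfSurjective hf).symm (f.lin y') = Submodule.Quotient.mk y' := by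
      rw [LinearEquiv.symm_apply_eq]; rfl
    simpa [this] using g.map_mem n y' hy'

lemma comp_descSurj (f : M ⟶ N) (hf : Function.Surjective f.lin) (g : M ⟶ P)
    (hg : LinearMap.ker f.lin ≤ LinearMap.ker g.lin) : f ≫ descSurj f hf g hg = g :=
  hom_ext fun x => by
    have : (f.lin.quotKerEquivOfSurjective hf).symm (f.lin x) = Submodule.Quotient.mk x := by
      rw [LinearEquiv.symm_apply_eq]; rfl
    simp [descSurj, this]

lemma mono_of_injective (f : M ⟶ N) (hf : Function.Injective f.lin) : Mono f where
  right_cancellation _ _ e := hom_ext fun x => hf (LinearMap.congr_fun (congrArg Hom.lin e) x)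

lemma epi_of_surjective (f : M ⟶ N) (hf : Function.Surjective f.lin) : Epi f where
  left_cancellation _ _ e := hom_ext fun x => by
    obtain ⟨y, rfl⟩ := hf x
    exact LinearMap.congr_fun (congrArg Hom.lin e) y

lemma injective_of_mono (f : M ⟶ N) [Mono f] : Function.Injective f.lin := by
  rw [← LinearMap.ker_eq_bot, LinearMap.ker_eq_bot']
  intro x hx
  have : kerι f = 0 := by rw [← cancel_mono f, kerι_comp, zero_comp]
  exact LinearMap.congr_fun (congrArg Hom.lin this) (⟨x, hx⟩ : LinearMap.ker f.lin)

lemma surjective_of_epi (f : M ⟶ N) [Epi f] : Function.Surjective f.lin := by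
  intro x
  have : cokerπ f = 0 := by rw [← cancel_epi f, comp_cokerπ, comp_zero]
  exact (Submodule.Quotient.mk_eq_zero _).1 (LinearMap.congr_fun (congrArg Hom.lin this) x)

/-- An injective morphism onto the kernel of `g` is a kernel of `g`. -/
noncomputable def isKernelOf (f : M ⟶ N) (g : N ⟶ P) (w : f ≫ g = 0)
    (hf : Function.Injective f.lin) (h : ∀ x, g.lin x = 0 → x ∈ LinearMap.range f.lin) :
    IsLimit (KernelFork.ofι f w) :=
  haveI := mono_of_injective f hf
  KernelFork.IsLimit.ofι' f w fun k hk =>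
    ⟨liftInj f hf k fun x => h _ (LinearMap.congr_fun (congrArg Hom.lin hk) x),
      liftInj_comp _ _ _ _⟩

/-- A surjective morphism with kernel the range of `f` is a cokernel of `f`. -/
noncomputable def isCokernelOf (f : M ⟶ N) (g : N ⟶ P) (w : f ≫ g = 0)
    (hg : Function.Surjective g.lin) (h : ∀ x, g.lin x = 0 → x ∈ LinearMap.range f.lin) :
    IsColimit (CokernelCofork.ofπ g w) :=
  haveI := epi_of_surjective g hg
  CokernelCofork.IsColimit.ofπ' g w fun k hk =>
    ⟨descSurj g hg k fun x hx => by
      obtain ⟨y, rfl⟩ := h x hx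
      exact LinearMap.congr_fun (congrArg Hom.lin hk) y, comp_descSurj _ _ _ _⟩

instance : HasKernels (GrMod 𝒜) where
  has_limit f := ⟨⟨_, isKernelOf (kerι f) f (kerι_comp f) Subtype.val_injective
    fun x hx => ⟨⟨x, hx⟩, rfl⟩⟩⟩

instance : HasCokernels (GrMod 𝒜) where
  has_colimit f := ⟨⟨_, isCokernelOf f (cokerπ f) (comp_cokerπ f) (Submodule.mkQ_surjective _)
    fun _ hx => (Submodule.Quotient.mk_eq_zero _).1 hx⟩⟩

noncomputable instance : Abelian (GrMod 𝒜) where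
  normalMonoOfMono f _ := ⟨⟨_, cokerπ f, comp_cokerπ f,
    isKernelOf f _ _ (injective_of_mono f) fun _ hx => (Submodule.Quotient.mk_eq_zero _).1 hx⟩⟩
  normalEpiOfEpi f _ := ⟨⟨_, kerι f, kerι_comp f,
    isCokernelOf _ f _ (surjective_of_epi f) fun x hx => ⟨⟨x, hx⟩, rfl⟩⟩⟩

lemma shortExact_iff (S : ShortComplex (GrMod 𝒜)) :
    S.ShortExact ↔ Function.Injective S.f.lin ∧ Function.Surjective S.g.lin ∧
      ∀ x, S.g.lin x = 0 → x ∈ LinearMap.range S.f.lin := by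
  constructor
  · intro hS
    have := hS.mono_f
    have := hS.epi_g
    refine ⟨injective_of_mono _, surjective_of_epi _, fun x hx => ?_⟩
    obtain ⟨l, hl⟩ := KernelFork.IsLimit.lift' hS.fIsKernel (kerι S.g) (kerι_comp S.g)
    exact ⟨l.lin (⟨x, hx⟩ : LinearMap.ker S.g.lin),
      LinearMap.congr_fun (congrArg Hom.lin hl) (⟨x, hx⟩ : LinearMap.ker S.g.lin)⟩
  · rintro ⟨h₁, h₂, h₃⟩
    have := mono_of_injective _ h₁
    have := epi_of_surjective _ h₂
    exact ⟨S.exact_of_f_is_kernel (isKernelOf _ _ _ h₁ h₃)⟩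

end GrMod

namespace GrMod

variable {A : Type u} [CommRing A] (𝒜 : ℤ → AddSubgroup A)

/-- The ideal `I⁺ = A_{>0} · A` generated by the homogeneous elements of positive degree. -/
def idealPos : Ideal A := Ideal.span {a | ∃ n : ℤ, 0 < n ∧ a ∈ 𝒜 n}

/-- The `I⁺`-torsion graded modules: each element is killed by some power of each `f ∈ I⁺`. -/
def isPosTorsion : ObjectProperty (GrMod 𝒜) :=
  fun M => ∀ (x : M), ∀ f ∈ idealPos 𝒜, ∃ n : ℕ, 0 < n ∧ f ^ n • x = 0

variable {𝒜} in
lemma isPosTorsion_of_injective {M N : GrMod 𝒜} (f : M ⟶ N) (hf : Function.Injective f.lin)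
    (hN : isPosTorsion 𝒜 N) : isPosTorsion 𝒜 M := fun x a ha => by
  obtain ⟨n, hn, h⟩ := hN (f.lin x) a ha
  exact ⟨n, hn, hf (by rw [map_smul, h, map_zero])⟩

variable {𝒜} in
lemma isPosTorsion_of_surjective {M N : GrMod 𝒜} (f : M ⟶ N) (hf : Function.Surjective f.lin)
    (hM : isPosTorsion 𝒜 M) : isPosTorsion 𝒜 N := fun y a ha => by
  obtain ⟨x, rfl⟩ := hf y
  obtain ⟨n, hn, h⟩ := hM x a ha
  exact ⟨n, hn, by rw [← map_smul, h, map_zero]⟩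

instance : (isPosTorsion 𝒜).IsSerreClass where
  exists_zero := ⟨zeroObj 𝒜, isZero_zeroObj, fun _ _ _ => ⟨1, one_pos, rfl⟩⟩
  prop_of_mono f _ hN := isPosTorsion_of_injective f (injective_of_mono f) hN
  prop_of_epi f _ hM := isPosTorsion_of_surjective f (surjective_of_epi f) hM
  prop_X₂_of_shortExact hS h₁ h₃ := fun x a ha => by
    obtain ⟨hf, -, h⟩ := (shortExact_iff _).1 hS
    obtain ⟨n, hn, hx⟩ := h₃ (Hom.lin _ x) a ha
    obtain ⟨y, hy⟩ := h _ (by rw [map_smul, hx])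
    obtain ⟨m, hm, hy'⟩ := h₁ y a ha
    exact ⟨m + n, by omega, by rw [pow_add, mul_smul, ← hy, ← map_smul, hy', map_zero]⟩

end GrMod

/-- The Serre quotient `Q⁺Gr A` of the category of graded modules by the torsion modules. -/
abbrev QGr {A : Type u} [CommRing A] (𝒜 : ℤ → AddSubgroup A) :=
  (GrMod.isPosTorsion 𝒜).isoModSerre.Localization

namespace QGr

variable {A : Type u} [CommRing A] (𝒜 : ℤ → AddSubgroup A)

/-- The quotient functor `Gr A ⥤ Q⁺Gr A`. -/
abbrev quot : GrMod 𝒜 ⥤ QGr 𝒜 := (GrMod.isPosTorsion 𝒜).isoModSerre.Q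

noncomputable instance : Abelian (QGr 𝒜) :=
  ObjectProperty.SerreClassLocalization.abelian (quot 𝒜) (GrMod.isPosTorsion 𝒜)

instance : PreservesFiniteLimits (quot 𝒜) :=
  ObjectProperty.SerreClassLocalization.preservesFiniteLimits _ (GrMod.isPosTorsion 𝒜)

instance : PreservesFiniteColimits (quot 𝒜) :=
  ObjectProperty.SerreClassLocalization.preservesFiniteColimits _ (GrMod.isPosTorsion 𝒜)

end QGr

namespace CechTotal

attribute [local instance] Abelian.hasFiniteBiproducts

variable {r : ℕ}

/-- `(-1)` to the number of pairs `(k, a)` with `k ∈ S`, `a ∈ T \ S` and `k < a`. For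
`T = S ∪ {a}` with `a` in position `j` (counting from `0`) in `T`, this is `(-1) ^ j`. -/
def sgn (S T : Finset (Fin r)) : ℤ :=
  (-1) ^ ((S ×ˢ (T \ S)).filter fun p => p.1 < p.2).card

lemma sgn_insert {S : Finset (Fin r)} {a : Fin r} (ha : a ∉ S) :
    sgn S (insert a S) = (-1) ^ (S.filter (· < a)).card := by
  have : insert a S \ S = {a} := by
    ext x; simp only [Finset.mem_sdiff, Finset.mem_insert, Finset.mem_singleton]; grind
  rw [sgn, this, Finset.product_singleton, Finset.filter_map, Finset.card_map]
  rfl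

lemma sgn_mul_add {S : Finset (Fin r)} {a b : Fin r} (ha : a ∉ S) (hb : b ∉ S) (hab : a < b) :
    sgn S (insert a S) * sgn (insert a S) (insert b (insert a S)) +
      sgn S (insert b S) * sgn (insert b S) (insert b (insert a S)) = 0 := by
  have h₁ : sgn (insert a S) (insert b (insert a S)) = - sgn S (insert b S) := by
    rw [sgn_insert hb, sgn_insert (by simp [hb, hab.ne']), Finset.filter_insert, if_pos hab,
      Finset.card_insert_of_notMem (by simp [ha]), pow_succ, mul_neg_one]
  have h₂ : sgn (insert b S) (insert b (insert a S)) = sgn S (insert a S) := by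
    rw [Finset.insert_comm, sgn_insert ha, sgn_insert (by simp [ha, hab.ne]),
      Finset.filter_insert, if_neg hab.not_gt]
  rw [h₁, h₂]
  ring

variable {C : Type*} [Category* C] [Abelian C]

section

variable (K L : CochainComplex C ℤ) (f : K ⟶ L)

/-- The part of the differential of the total complex from the summand indexed by `S` in degree
`i` to the summand indexed by `T` in degree `j` which does not involve the restriction maps. -/
noncomputable def coeff (i j : ℤ) (S T : Finset (Fin r)) :
    K.X (i - S.card) ⟶ K.X (j - T.card) :=
  if S = T then (-1 : ℤ) ^ S.card • K.d _ _
  else if S ⊆ T ∧ T.card = S.card + 1 ∧ i + 1 = j then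
    sgn S T • (if h : i - S.card = j - T.card then (K.XIsoOfEq h).hom else 0)
  else 0

variable {K}

lemma coeff_self (i j : ℤ) (S : Finset (Fin r)) :
    coeff K i j S S = (-1 : ℤ) ^ S.card • K.d _ _ := if_pos rfl

lemma coeff_insert (i j : ℤ) (hij : i + 1 = j) {S : Finset (Fin r)} {a : Fin r} (ha : a ∉ S) :
    coeff K i j S (insert a S) = sgn S (insert a S) •
      (K.XIsoOfEq (by rw [Finset.card_insert_of_notMem ha]; push_cast; lia)).hom := by
  rw [coeff, if_neg (by intro h; rw [h] at ha; simp at ha), if_pos ⟨by simp,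
    Finset.card_insert_of_notMem ha, hij⟩, dif_pos]

lemma coeff_eq_zero (i j : ℤ) {S T : Finset (Fin r)} (h₁ : S ≠ T)
    (h₂ : ∀ a ∉ S, T ≠ insert a S) : coeff K i j S T = 0 := by
  rw [coeff, if_neg h₁, if_neg]
  rintro ⟨h₃, h₄, -⟩
  obtain ⟨a, ha, h⟩ := (Finset.covBy_iff_exists_insert (s := S) (t := T)).1 (by
    rw [Finset.covBy_iff_card_sdiff_eq_one, Finset.card_sdiff_of_subset h₃]
    exact ⟨h₃, by omega⟩)
  exact h₂ a ha h.symm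

lemma coeff_shape (i j : ℤ) (hij : i + 1 ≠ j) (S T : Finset (Fin r)) : coeff K i j S T = 0 := by
  unfold coeff
  split_ifs with h₁ h₂ h₃
  · subst h₁
    rw [K.shape _ _ (by simp; lia), smul_zero]
  all_goals simp_all

variable {L} in
lemma coeff_naturality (i j : ℤ) (S T : Finset (Fin r)) :
    coeff K i j S T ≫ f.f _ = f.f _ ≫ coeff L i j S T := by
  unfold coeff
  split_ifs <;> simp [HomologicalComplex.XIsoOfEq_hom_naturality]

/-- The key relation for `d ≫ d = 0`. -/
lemma sum_coeff (𝒰 : Finset (Finset (Fin r))) (h𝒰 : (𝒰 : Set (Finset (Fin r))).OrdConnected)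
    (i j k : ℤ) (hij : i + 1 = j) (hjk : j + 1 = k)
    {S U : Finset (Fin r)} (hS : S ∈ 𝒰) (hU : U ∈ 𝒰) :
    ∑ T ∈ 𝒰, coeff K i j S T ≫ coeff K j k T U = 0 := by
  classical
  by_cases h₀ : S = U
  · subst h₀
    refine Finset.sum_eq_zero fun T _ => ?_
    by_cases h₁ : S = T
    · subst h₁; simp [coeff_self]
    · by_cases h₂ : S ⊆ T
      · rw [coeff_eq_zero (S := T) (T := S), comp_zero]
        · exact Ne.symm h₁
        · intro a _ h
          apply h₁
          apply h₂.antisymm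
          rw [h]
          simp
      · rw [coeff_eq_zero (S := S) (T := T) i j h₁, zero_comp]
        rintro a _ rfl
        simp at h₂
  have key : ∀ T, coeff K i j S T ≫ coeff K j k T U ≠ 0 →
      (S = T ∨ ∃ a ∉ S, T = insert a S) ∧ (T = U ∨ ∃ a ∉ T, U = insert a T) := by
    intro T hT
    constructor
    · by_contra! h
      exact hT (by rw [coeff_eq_zero _ _ h.1 h.2, zero_comp])
    · by_contra! h
      exact hT (by rw [coeff_eq_zero (S := T) _ _ h.1 h.2, comp_zero])
  by_cases h₁ : ∃ a ∉ S, U = insert a S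
  · obtain ⟨a, ha, rfl⟩ := h₁
    rw [Finset.sum_eq_add S (insert a S) h₀ ?_ (fun h => (h hS).elim) (fun h => (h hU).elim)]
    · rw [coeff_self, coeff_self, coeff_insert _ _ hij ha, coeff_insert _ _ hjk ha]
      have : (-1 : ℤ) ^ (insert a S).card = - (-1) ^ S.card := by
        rw [Finset.card_insert_of_notMem ha, pow_succ, mul_neg_one]
      simp [this, smul_smul, mul_comm]
    · rintro T - ⟨hT₁, hT₂⟩
      by_contra h
      obtain ⟨rfl | ⟨b, hb, rfl⟩, h₂ | ⟨c, hc, h₂⟩⟩ := key T h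
      · exact hT₁ rfl
      · exact hT₁ rfl
      · exact hT₂ h₂
      · have := congrArg Finset.card h₂
        rw [Finset.card_insert_of_notMem hc, Finset.card_insert_of_notMem hb,
          Finset.card_insert_of_notMem ha] at this
        omega
  by_cases h₂ : ∃ a b, a ∉ S ∧ b ∉ S ∧ a < b ∧ U = insert b (insert a S)
  · obtain ⟨a, b, ha, hb, hab, rfl⟩ := h₂
    have hne : insert a S ≠ insert b S := fun h => by
      have : a ∈ insert b S := h ▸ Finset.mem_insert_self a S
      simp [ha, hab.ne] at this
    have ha' : a ∉ insert b S := by simp [ha, hab.ne]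
    have hb' : b ∉ insert a S := by simp [hb, hab.ne']
    have hab' : insert b (insert a S) = insert a (insert b S) := Finset.insert_comm _ _ _
    rw [Finset.sum_eq_add (insert a S) (insert b S) hne ?_ ?_ ?_]
    · have e₂ := coeff_insert (K := K) j k hjk ha'
      have e₁ := coeff_insert (K := K) j k hjk hb'
      rw [e₁, coeff_insert _ _ hij ha, coeff_insert _ _ hij hb]
      have e₃ : coeff K j k (insert b S) (insert b (insert a S)) =
          sgn (insert b S) (insert b (insert a S)) •
          (K.XIsoOfEq (by simp [ha, hb, hb']; lia)).hom := by
        have : ∀ U', U' = insert a (insert b S) → ∀ h : _, coeff K j k (insert b S) U' =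
          sgn (insert b S) U' • (K.XIsoOfEq h).hom := by
          rintro _ rfl h
          exact e₂
        exact this _ hab' _
      rw [e₃]
      simp only [Preadditive.zsmul_comp, Preadditive.comp_zsmul, smul_smul,
        HomologicalComplex.XIsoOfEq_hom_comp_XIsoOfEq_hom, ← add_smul]
      rw [mul_comm, mul_comm (sgn (insert b S) _), sgn_mul_add ha hb hab, zero_smul]
    · rintro T - ⟨hT₁, hT₂⟩
      by_contra h
      obtain ⟨rfl | ⟨c, hc, rfl⟩, h₂ | ⟨d, hd, h₂⟩⟩ := key T h
      · exact h₀ h₂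
      · exact h₁ ⟨d, hd, h₂⟩
      · exact h₁ ⟨c, hc, h₂.symm⟩
      · have : c ∈ insert b (insert a S) := h₂ ▸ by simp
        simp only [Finset.mem_insert, hc, or_false] at this
        grind
    · intro h
      exact (h (h𝒰.out hS hU ⟨Finset.subset_insert _ _,
        Finset.subset_insert _ _⟩)).elim
    · intro h
      refine (h (h𝒰.out hS hU ⟨Finset.subset_insert _ _, ?_⟩)).elim
      rw [hab']
      exact Finset.subset_insert _ _
  refine Finset.sum_eq_zero fun T _ => ?_
  by_contra h
  obtain ⟨rfl | ⟨a, ha, rfl⟩, h₃ | ⟨b, hb, h₃⟩⟩ := key T h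
  · exact h₀ h₃
  · exact h₁ ⟨b, hb, h₃⟩
  · exact h₁ ⟨a, ha, h₃.symm⟩
  · have hb₁ : b ∉ S := fun h => hb (Finset.mem_insert_of_mem h)
    have hb₂ : b ≠ a := fun h => hb (by simp [h])
    rcases hb₂.lt_or_gt with hlt | hlt
    · exact h₂ ⟨b, a, hb₁, ha, hlt, by rw [h₃, Finset.insert_comm]⟩
    · exact h₂ ⟨a, b, ha, hb₁, hlt, h₃⟩

end

variable (G : Finset (Fin r) ⥤ (C ⥤ C))

section

/-- The morphism `G_S(X) ⟶ G_T(Y)` induced by `α : X ⟶ Y` and the restriction map `G_S ⟶ G_T`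
if `S ⊆ T`, and zero otherwise. -/
noncomputable def entry (S T : Finset (Fin r)) {X Y : C} (α : X ⟶ Y) :
    (G.obj S).obj X ⟶ (G.obj T).obj Y :=
  open Classical in
  if h : S ≤ T then (G.obj S).map α ≫ (G.map (homOfLE h)).app Y else 0

lemma entry_of_le {S T : Finset (Fin r)} (h : S ≤ T) {X Y : C} (α : X ⟶ Y) :
    entry G S T α = (G.obj S).map α ≫ (G.map (homOfLE h)).app Y := dif_pos h

lemma entry_self (S : Finset (Fin r)) {X Y : C} (α : X ⟶ Y) :
    entry G S S α = (G.obj S).map α := by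
  rw [entry_of_le G le_rfl]
  have : homOfLE (le_refl S) = 𝟙 S := rfl
  rw [this, G.map_id, NatTrans.id_app, Category.comp_id]

lemma entry_comp_map (S T : Finset (Fin r)) {X Y Z : C} (α : X ⟶ Y) (β : Y ⟶ Z) :
    entry G S T α ≫ (G.obj T).map β = entry G S T (α ≫ β) := by
  unfold entry
  split_ifs <;> simp

lemma map_comp_entry (S T : Finset (Fin r)) {X Y Z : C} (α : X ⟶ Y) (β : Y ⟶ Z) :
    (G.obj S).map α ≫ entry G S T β = entry G S T (α ≫ β) := by
  unfold entry
  split_ifs <;> simp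

lemma entry_eq_zero {S T : Finset (Fin r)} (h : ¬ S ≤ T) {X Y : C} (α : X ⟶ Y) :
    entry G S T α = 0 := dif_neg h

lemma coeff_of_not_le {K : CochainComplex C ℤ} (i j : ℤ) {S T : Finset (Fin r)} (h : ¬ S ≤ T) :
    coeff K i j S T = 0 :=
  coeff_eq_zero i j (by rintro rfl; exact h le_rfl) (by
    rintro a _ rfl; exact h (Finset.subset_insert _ _))

variable (𝒰 : Finset (Finset (Fin r)))

/-- The direct sum of the `G_S (K^{n - |S|})` for `S ∈ 𝒰`. -/
noncomputable abbrev term (K : CochainComplex C ℤ) (n : ℤ) : C :=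
  ⨁ fun S : 𝒰 => (G.obj S.1).obj (K.X (n - S.1.card))

/-- The map induced by a morphism of complexes on the terms of the total complexes. -/
noncomputable def termMap {K L : CochainComplex C ℤ} (f : K ⟶ L) (n : ℤ) :
    term G 𝒰 K n ⟶ term G 𝒰 L n :=
  biproduct.map fun S => (G.obj S.1).map (f.f (n - S.1.card))

lemma termMap_id (K : CochainComplex C ℤ) (n : ℤ) : termMap G 𝒰 (𝟙 K) n = 𝟙 _ :=
  biproduct.hom_ext _ _ fun T => by simp [termMap]

lemma termMap_comp {K L M : CochainComplex C ℤ} (f : K ⟶ L) (g : L ⟶ M) (n : ℤ) :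
    termMap G 𝒰 (f ≫ g) n = termMap G 𝒰 f n ≫ termMap G 𝒰 g n :=
  biproduct.hom_ext _ _ fun T => by simp [termMap]

variable [∀ S, (G.obj S).Additive]

lemma entry_zero (S T : Finset (Fin r)) (X Y : C) : entry G S T (0 : X ⟶ Y) = 0 := by
  unfold entry
  split_ifs <;> simp

lemma entry_comp {S T U : Finset (Fin r)} {X Y Z : C} (α : X ⟶ Y) (β : Y ⟶ Z)
    (h₁ : ¬ S ≤ T → α = 0) (h₂ : ¬ T ≤ U → β = 0) :
    entry G S T α ≫ entry G T U β = entry G S U (α ≫ β) := by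
  by_cases hST : S ≤ T
  · by_cases hTU : T ≤ U
    · rw [entry_of_le G hST, entry_of_le G hTU, entry_of_le G (hST.trans hTU),
        ← homOfLE_comp hST hTU, G.map_comp]
      simp
    · rw [h₂ hTU, comp_zero, entry_zero, comp_zero, entry_zero]
  · rw [h₁ hST, zero_comp, entry_zero, zero_comp, entry_zero]

lemma entry_sum (S T : Finset (Fin r)) {X Y : C} {ι : Type*} (s : Finset ι) (α : ι → (X ⟶ Y)) :
    entry G S T (∑ i ∈ s, α i) = ∑ i ∈ s, entry G S T (α i) := by
  unfold entry
  split_ifs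
  · rw [Functor.map_sum, Preadditive.sum_comp]
  · simp

variable (h𝒰 : (𝒰 : Set (Finset (Fin r))).OrdConnected)

/-- The differential of the total complex, a matrix of morphisms. -/
noncomputable def dTerm (K : CochainComplex C ℤ) (i j : ℤ) : term G 𝒰 K i ⟶ term G 𝒰 K j :=
  biproduct.matrix fun S T => entry G S.1 T.1 (coeff K i j S.1 T.1)

lemma ι_dTerm_π (K : CochainComplex C ℤ) (i j : ℤ) (S T : 𝒰) :
    biproduct.ι (fun S : 𝒰 => (G.obj S.1).obj (K.X (i - S.1.card))) S ≫ dTerm G 𝒰 K i j ≫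
      biproduct.π (fun S : 𝒰 => (G.obj S.1).obj (K.X (j - S.1.card))) T =
    entry G S.1 T.1 (coeff K i j S.1 T.1) := by
  rw [dTerm, biproduct.matrix_π, biproduct.ι_desc]

/-- The total complex with `⨁_{S ∈ 𝒰} G_S (K^{n - |S|})` in degree `n`. -/
noncomputable def cplx (K : CochainComplex C ℤ) : CochainComplex C ℤ where
  X := term G 𝒰 K
  d := dTerm G 𝒰 K
  shape i j hij := by
    refine biproduct.hom_ext _ _ fun T => biproduct.hom_ext' _ _ fun S => ?_
    simp [ι_dTerm_π, coeff_shape i j hij, entry_zero]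
  d_comp_d' i j k hij hjk := by
    refine biproduct.hom_ext _ _ fun U => biproduct.hom_ext' _ _ fun S => ?_
    rw [Category.assoc, dTerm, dTerm, biproduct.matrix_π, biproduct.ι_matrix_assoc, biproduct.lift_desc,
      zero_comp, comp_zero]
    by_cases hSU : S.1 ≤ U.1
    · rw [Finset.sum_coe_sort 𝒰 fun T =>
        entry G S.1 T (coeff K i j S.1 T) ≫ entry G T U.1 (coeff K j k T U.1)]
      rw [Finset.sum_congr rfl fun T _ => entry_comp G (coeff K i j S.1 T)
        (coeff K j k T U.1) (coeff_of_not_le i j) (coeff_of_not_le j k), ← entry_sum,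
        sum_coeff 𝒰 h𝒰 i j k hij hjk S.2 U.2, entry_zero]
    · refine Finset.sum_eq_zero fun T _ => ?_
      by_cases hST : S.1 ≤ T.1
      · rw [entry_eq_zero G (S := T.1) (T := U.1) (fun h => hSU (hST.trans h)), comp_zero]
      · rw [entry_eq_zero G hST, zero_comp]

/-- The total complex as a functor. -/
noncomputable def functor : CochainComplex C ℤ ⥤ CochainComplex C ℤ where
  obj := cplx G 𝒰 h𝒰
  map {K L} f :=
    { f n := termMap G 𝒰 f n
      comm' i j _ := by
        refine biproduct.hom_ext _ _ fun T => biproduct.hom_ext' _ _ fun S => ?_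
        simp [termMap, cplx, dTerm, entry_comp_map, map_comp_entry, coeff_naturality] }
  map_id K := by
    ext n : 1
    exact termMap_id G 𝒰 K n
  map_comp f g := by
    ext n : 1
    exact termMap_comp G 𝒰 f g n

end

lemma ordConnected_erase {𝒰 : Finset (Finset (Fin r))}
    (h𝒰 : (𝒰 : Set (Finset (Fin r))).OrdConnected) {S₀ : Finset (Fin r)}
    (hS₀ : ∀ S ∈ 𝒰, S ≤ S₀ → S = S₀) :
    ((𝒰.erase S₀ : Finset (Finset (Fin r))) : Set (Finset (Fin r))).OrdConnected where
  out' S hS U hU T hT := by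
    simp only [Finset.coe_erase, Set.mem_sdiff, Finset.mem_coe, Set.mem_singleton_iff] at hS hU ⊢
    exact ⟨h𝒰.out hS.1 hU.1 hT, by rintro rfl; exact hS.2 (hS₀ _ hS.1 hT.1)⟩

section

variable {𝒰 : Finset (Finset (Fin r))} {S₀ : Finset (Fin r)} (h₀ : S₀ ∈ 𝒰)
  (K : CochainComplex C ℤ) (n : ℤ)

variable (𝒰 S₀) in
/-- The inclusion of the part of `term` with the index `S₀` omitted. -/
noncomputable def tι : term G (𝒰.erase S₀) K n ⟶ term G 𝒰 K n :=
  biproduct.desc fun S => biproduct.ι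
    (fun S : 𝒰 => (G.obj S.1).obj (K.X (n - S.1.card))) ⟨S.1, Finset.mem_of_mem_erase S.2⟩

lemma ι_tι (S : 𝒰.erase S₀) : biproduct.ι _ S ≫ tι G 𝒰 S₀ K n = biproduct.ι
    (fun S : 𝒰 => (G.obj S.1).obj (K.X (n - S.1.card))) ⟨S.1, Finset.mem_of_mem_erase S.2⟩ :=
  biproduct.ι_desc _ _

lemma tι_π (T : 𝒰) (hT : T.1 ≠ S₀) : tι G 𝒰 S₀ K n ≫ biproduct.π _ T =
    biproduct.π (fun S : (𝒰.erase S₀ : Finset _) => (G.obj S.1).obj (K.X (n - S.1.card)))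
      ⟨T.1, Finset.mem_erase.2 ⟨hT, T.2⟩⟩ := by
  refine biproduct.hom_ext' _ _ fun S => ?_
  rw [← Category.assoc, ι_tι]
  by_cases h : S.1 = T.1
  · obtain ⟨S, hS⟩ := S
    obtain ⟨T, hT⟩ := T
    obtain rfl : S = T := h
    rw [biproduct.ι_π_self, biproduct.ι_π_self]
  · rw [biproduct.ι_π_ne, biproduct.ι_π_ne]
    · intro h'; exact h (congrArg Subtype.val h')
    · intro h'; exact h (congrArg Subtype.val h')

lemma tι_π_self : tι G 𝒰 S₀ K n ≫ biproduct.π _ ⟨S₀, h₀⟩ = 0 := by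
  refine biproduct.hom_ext' _ _ fun S => ?_
  rw [← Category.assoc, ι_tι, comp_zero, biproduct.ι_π_ne]
  intro h'
  exact (Finset.mem_erase.1 S.2).1 (congrArg Subtype.val h')

variable (𝒰 S₀) in
/-- The projection omitting the index `S₀`. -/
noncomputable def tρ : term G 𝒰 K n ⟶ term G (𝒰.erase S₀) K n :=
  biproduct.lift fun S => biproduct.π
    (fun S : 𝒰 => (G.obj S.1).obj (K.X (n - S.1.card))) ⟨S.1, Finset.mem_of_mem_erase S.2⟩

lemma tι_tρ : tι G 𝒰 S₀ K n ≫ tρ G 𝒰 S₀ K n = 𝟙 _ := by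
  refine biproduct.hom_ext _ _ fun T => ?_
  rw [Category.assoc, tρ, biproduct.lift_π, tι_π G K n ⟨T.1, Finset.mem_of_mem_erase T.2⟩
    (Finset.ne_of_mem_erase T.2),
    Category.id_comp]

lemma tρ_tι : tρ G 𝒰 S₀ K n ≫ tι G 𝒰 S₀ K n +
    biproduct.π (fun S : 𝒰 => (G.obj S.1).obj (K.X (n - S.1.card))) ⟨S₀, h₀⟩ ≫
    biproduct.ι (fun S : 𝒰 => (G.obj S.1).obj (K.X (n - S.1.card))) ⟨S₀, h₀⟩ = 𝟙 _ := by
  refine biproduct.hom_ext _ _ fun T => ?_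
  rw [Preadditive.add_comp, Category.assoc, Category.assoc, Category.id_comp]
  by_cases hT : T.1 = S₀
  · obtain ⟨T, hT'⟩ := T
    obtain rfl : T = S₀ := hT
    rw [tι_π_self, comp_zero, zero_add, biproduct.ι_π_self, Category.comp_id]
  · rw [tι_π G K n T hT, tρ, biproduct.lift_π, biproduct.ι_π_ne, comp_zero, add_zero]
    intro h
    exact hT (congrArg Subtype.val h).symm

variable [∀ S, (G.obj S).Additive] (h𝒰 : (𝒰 : Set (Finset (Fin r))).OrdConnected)

lemma tι_comm (hS₀ : ∀ S ∈ 𝒰, S ≤ S₀ → S = S₀) (i j : ℤ) : tι G 𝒰 S₀ K i ≫ dTerm G 𝒰 K i j =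
    dTerm G (𝒰.erase S₀) K i j ≫ tι G 𝒰 S₀ K j := by
  refine biproduct.hom_ext _ _ fun T => biproduct.hom_ext' _ _ fun S => ?_
  rw [Category.assoc, ← Category.assoc (biproduct.ι _ S), ι_tι, ι_dTerm_π, Category.assoc]
  by_cases hT : T.1 = S₀
  · obtain ⟨T, hT'⟩ := T
    obtain rfl : T = S₀ := hT
    rw [tι_π_self, comp_zero, comp_zero, entry_eq_zero]
    intro h
    exact (Finset.mem_erase.1 S.2).1 (hS₀ _ (Finset.mem_of_mem_erase S.2) h)
  · rw [tι_π G K j T hT, ι_dTerm_π]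

lemma π_comm (hS₀ : ∀ S ∈ 𝒰, S ≤ S₀ → S = S₀) (i j : ℤ) :
    biproduct.π (fun S : 𝒰 => (G.obj S.1).obj (K.X (i - S.1.card))) ⟨S₀, h₀⟩ ≫
      (G.obj S₀).map ((-1 : ℤ) ^ S₀.card • K.d _ _) = dTerm G 𝒰 K i j ≫
    biproduct.π (fun S : 𝒰 => (G.obj S.1).obj (K.X (j - S.1.card))) ⟨S₀, h₀⟩ := by
  refine biproduct.hom_ext' _ _ fun S => ?_
  rw [ι_dTerm_π]
  by_cases hS : S.1 = S₀
  · obtain ⟨S, hS'⟩ := S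
    obtain rfl : S = S₀ := hS
    rw [biproduct.ι_π_self_assoc, entry_self, coeff_self]
  · rw [biproduct.ι_π_ne_assoc, zero_comp, entry_eq_zero]
    · exact fun h => hS (hS₀ _ S.2 h)
    · exact fun h => hS (congrArg Subtype.val h)

variable (hS₀ : ∀ S ∈ 𝒰, S ≤ S₀ → S = S₀)

/-- The short complex of complexes obtained by splitting off the minimal index `S₀`. -/
noncomputable def ses (K : CochainComplex C ℤ) : ShortComplex (CochainComplex C ℤ) :=
  ShortComplex.mk (X₁ := cplx G (𝒰.erase S₀) (ordConnected_erase h𝒰 hS₀) K) (X₂ := cplx G 𝒰 h𝒰 K)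
    (X₃ := (((G.obj S₀).mapHomologicalComplex (ComplexShape.up ℤ)).obj K)⟦-(S₀.card : ℤ)⟧)
    { f := tι G 𝒰 S₀ K
      comm' i j _ := tι_comm G K hS₀ i j }
    { f n := biproduct.π (fun S : 𝒰 => (G.obj S.1).obj (K.X (n - S.1.card))) ⟨S₀, h₀⟩
      comm' i j _ := by
        refine Eq.trans ?_ (π_comm G h₀ K hS₀ i j)
        congr 1
        have : (-(S₀.card : ℤ)).negOnePow = (((-1 : ℤˣ) ^ S₀.card : ℤˣ)) := by
          rw [Int.negOnePow_neg, Int.negOnePow_def, zpow_natCast]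
        rw [CochainComplex.shiftFunctor_obj_d', this, Functor.map_zsmul, Units.smul_def]
        push_cast
        rfl }
    (by
      ext n : 1
      exact tι_π_self G h₀ K n)

lemma ses_shortExact : (ses G h₀ h𝒰 hS₀ K).ShortExact := by
  refine HomologicalComplex.shortExact_of_degreewise_shortExact _ fun n => ?_
  exact ShortComplex.Splitting.shortExact
    { r := tρ G 𝒰 S₀ K n
      s := biproduct.ι (fun S : 𝒰 => (G.obj S.1).obj (K.X (n - S.1.card))) ⟨S₀, h₀⟩
      f_r := tι_tρ G K n
      s_g := biproduct.ι_π_self _ _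
      id := tρ_tι G h₀ K n }

variable {K} {L : CochainComplex C ℤ}

lemma tι_termMap (f : K ⟶ L) : tι G 𝒰 S₀ K n ≫ termMap G 𝒰 f n =
    termMap G (𝒰.erase S₀) f n ≫ tι G 𝒰 S₀ L n := by
  refine biproduct.hom_ext' _ _ fun S => ?_
  rw [← Category.assoc, ι_tι]
  simp only [termMap, biproduct.ι_map, biproduct.ι_map_assoc]
  rw [ι_tι]

/-- The morphism of short complexes induced by a morphism of complexes. -/
noncomputable def sesMap (f : K ⟶ L) : ses G h₀ h𝒰 hS₀ K ⟶ ses G h₀ h𝒰 hS₀ L where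
  τ₁ := (functor G _ (ordConnected_erase h𝒰 hS₀)).map f
  τ₂ := (functor G 𝒰 h𝒰).map f
  τ₃ := (((G.obj S₀).mapHomologicalComplex (ComplexShape.up ℤ)).map f)⟦-(S₀.card : ℤ)⟧'
  comm₁₂ := by
    ext n : 1
    exact (tι_termMap G n f).symm
  comm₂₃ := by
    ext n : 1
    exact biproduct.map_π (fun S : 𝒰 => (G.obj S.1).map (f.f (n - S.1.card))) ⟨S₀, h₀⟩

end

open HomologicalComplex DerivedCategory Pretriangulated in
lemma isIso_Q_map [HasDerivedCategory C]
    [∀ S, (G.obj S).Additive] [∀ S, (G.obj S).PreservesHomology]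
    (N : ℕ) (𝒰 : Finset (Finset (Fin r))) (hN : 𝒰.card = N)
    (h𝒰 : (𝒰 : Set (Finset (Fin r))).OrdConnected)
    {K L : CochainComplex C ℤ} (f : K ⟶ L) [QuasiIso f] :
    IsIso (Q.map ((functor G 𝒰 h𝒰).map f)) := by
  induction N generalizing 𝒰 with
  | zero =>
    obtain rfl : 𝒰 = ∅ := Finset.card_eq_zero.1 hN
    have h : ∀ (K : CochainComplex C ℤ), IsZero ((functor G ∅ h𝒰).obj K) := fun K => by
      rw [IsZero.iff_id_eq_zero]
      ext n : 1
      exact biproduct.hom_ext (f := fun S : (∅ : Finset (Finset (Fin r))) =>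
        (G.obj S.1).obj (K.X (n - S.1.card))) _ _ fun S => absurd S.2 (Finset.notMem_empty _)
    have : IsIso ((functor G ∅ h𝒰).map f) :=
      (h K).isIso (h L) _
    infer_instance
  | succ N ih =>
    obtain ⟨S₀, h₀, hS₀⟩ := 𝒰.exists_minimal (Finset.card_pos.1 (by omega))
    have hS₀' : ∀ S ∈ 𝒰, S ≤ S₀ → S = S₀ := fun S hS h => le_antisymm h (hS₀ hS h)
    have h₁ := ih (𝒰.erase S₀) (by rw [Finset.card_erase_of_mem h₀]; omega)
      (ordConnected_erase h𝒰 hS₀')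
    have h₃ : IsIso (Q.map (sesMap G h₀ h𝒰 hS₀' f).τ₃) := by
      rw [isIso_Q_map_iff_quasiIso]
      change QuasiIso ((((G.obj S₀).mapHomologicalComplex
        (ComplexShape.up ℤ)).map f)⟦-(S₀.card : ℤ)⟧')
      rw [CochainComplex.quasiIso_shift_iff]
      infer_instance
    have hK := triangleOfSES_distinguished (ses_shortExact G h₀ K h𝒰 hS₀')
    have hL := triangleOfSES_distinguished (ses_shortExact G h₀ L h𝒰 hS₀')
    let φ : triangleOfSES (ses_shortExact G h₀ K h𝒰 hS₀') ⟶
        triangleOfSES (ses_shortExact G h₀ L h𝒰 hS₀') :=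
      { hom₁ := Q.map (sesMap G h₀ h𝒰 hS₀' f).τ₁
        hom₂ := Q.map (sesMap G h₀ h𝒰 hS₀' f).τ₂
        hom₃ := Q.map (sesMap G h₀ h𝒰 hS₀' f).τ₃
        comm₁ := by
          have := (sesMap G h₀ h𝒰 hS₀' f).comm₁₂
          exact ((Q.map_comp _ _).symm.trans (congrArg Q.map this.symm)).trans (Q.map_comp _ _)
        comm₂ := by
          have := (sesMap G h₀ h𝒰 hS₀' f).comm₂₃
          exact ((Q.map_comp _ _).symm.trans (congrArg Q.map this.symm)).trans (Q.map_comp _ _)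
        comm₃ := triangleOfSESδ_naturality (ses_shortExact G h₀ K h𝒰 hS₀')
          (ses_shortExact G h₀ L h𝒰 hS₀') (sesMap G h₀ h𝒰 hS₀' f) }
    exact isIso₂_of_isIso₁₃ φ hK hL h₁ h₃

/-- The functor induced by `functor G 𝒰 h𝒰` on derived categories, for exact functors `G_S`. -/
noncomputable def derived [HasDerivedCategory C]
    [∀ S, (G.obj S).Additive] [∀ S, (G.obj S).PreservesHomology]
    (𝒰 : Finset (Finset (Fin r))) (h𝒰 : (𝒰 : Set (Finset (Fin r))).OrdConnected) :
    DerivedCategory C ⥤ DerivedCategory C :=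
  Localization.lift (W := HomologicalComplex.quasiIso C (ComplexShape.up ℤ))
    (functor G 𝒰 h𝒰 ⋙ DerivedCategory.Q)
    (fun _ _ f hf => by
      have : QuasiIso f := hf
      exact isIso_Q_map G _ 𝒰 rfl h𝒰 f) DerivedCategory.Q

lemma ordConnected_univ :
    ((Finset.univ : Finset (Finset (Fin r))) : Set (Finset (Fin r))).OrdConnected := by
  rw [Finset.coe_univ]
  exact Set.ordConnected_univ

lemma ordConnected_nonempty :
    (((Finset.univ : Finset (Finset (Fin r))).filter Finset.Nonempty :
      Finset (Finset (Fin r))) : Set (Finset (Fin r))).OrdConnected where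
  out' _ hS _ _ _ hT := by
    simp only [Finset.coe_filter, Finset.mem_univ, true_and, Set.mem_ofPred_eq] at hS ⊢
    exact hS.mono hT.1

end CechTotal

namespace GrMod

variable {A : Type u} [CommRing A]

section Frac

variable (a : A) {M : Type u} [AddCommGroup M] [Module A M]

/-- The fraction `x / a ^ k` in the localization of `M` at the powers of `a`. -/
noncomputable def frac (x : M) (k : ℕ) : LocalizedModule (Submonoid.powers a) M :=
  LocalizedModule.mk x ⟨a ^ k, k, rfl⟩

lemma exists_frac (z : LocalizedModule (Submonoid.powers a) M) : ∃ (x : M) (k : ℕ), frac a x k = z := by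
  induction z using LocalizedModule.induction_on with
  | h m s =>
    obtain ⟨_, k, rfl⟩ := s
    exact ⟨m, k, rfl⟩

lemma frac_eq_zero_iff (x : M) (k : ℕ) : frac a x k = 0 ↔ ∃ m : ℕ, a ^ m • x = 0 := by
  rw [frac, ← LocalizedModule.zero_mk (1 : Submonoid.powers a), LocalizedModule.mk_eq]
  constructor
  · rintro ⟨⟨_, m, rfl⟩, h⟩
    exact ⟨m, by simpa [Submonoid.smul_def] using h⟩
  · rintro ⟨m, h⟩
    exact ⟨⟨_, m, rfl⟩, by simpa [Submonoid.smul_def] using h⟩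

lemma frac_scale (x : M) (k j : ℕ) : frac a (a ^ j • x) (k + j) = frac a x k := by
  rw [frac, frac, LocalizedModule.mk_eq]
  exact ⟨1, by simp [Submonoid.smul_def, smul_smul, pow_add]⟩

lemma frac_add (x y : M) (k : ℕ) : frac a (x + y) k = frac a x k + frac a y k := by
  rw [frac, frac, frac, LocalizedModule.mk_add_mk, LocalizedModule.mk_eq]
  exact ⟨1, by simp [Submonoid.smul_def, smul_smul, smul_add]⟩

lemma smul_frac (b : A) (x : M) (k : ℕ) : b • frac a x k = frac a (b • x) k :=
  LocalizedModule.smul'_mk _ _ _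

lemma frac_zero (k : ℕ) : frac a (0 : M) k = 0 := LocalizedModule.zero_mk _

lemma frac_neg (x : M) (k : ℕ) : frac a (-x) k = - frac a x k := by
  rw [eq_neg_iff_add_eq_zero, ← frac_add, neg_add_cancel, frac_zero]

/-- Division by `a ^ k` is additive. -/
noncomputable def fracHom (M : Type u) [AddCommGroup M] [Module A M] (k : ℕ) :
    M →+ LocalizedModule (Submonoid.powers a) M where
  toFun x := frac a x k
  map_zero' := frac_zero a k
  map_add' x y := frac_add a x y k

end Frac

variable {𝒜 : ℤ → AddSubgroup A} [GradedRing 𝒜]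

lemma pow_mem {a : A} {e : ℤ} (ha : a ∈ 𝒜 e) (k : ℕ) : a ^ k ∈ 𝒜 (k * e) := by
  simpa using SetLike.pow_mem_graded k ha

/-- The degree `n` part of the localization `M_a`, for `a` homogeneous of degree `e`: the
fractions `x / a ^ k` with `x ∈ M` homogeneous of degree `n + k * e`. -/
def locDeg {a : A} {e : ℤ} (ha : a ∈ 𝒜 e) (M : GrMod 𝒜) (n : ℤ) :
    AddSubgroup (LocalizedModule (Submonoid.powers a) M) where
  carrier := {z | ∃ (x : M) (k : ℕ), x ∈ M.deg (n + k * e) ∧ frac a x k = z}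
  zero_mem' := ⟨0, 0, zero_mem _, frac_zero a 0⟩
  add_mem' := by
    rintro _ _ ⟨x, k, hx, rfl⟩ ⟨y, l, hy, rfl⟩
    refine ⟨a ^ l • x + a ^ k • y, k + l, add_mem ?_ ?_, ?_⟩
    · convert M.smul_mem (pow_mem ha l) hx using 2; push_cast; ring
    · convert M.smul_mem (pow_mem ha k) hy using 2; push_cast; ring
    · rw [frac_add, frac_scale, add_comm k l, frac_scale]
  neg_mem' := by
    rintro _ ⟨x, k, hx, rfl⟩
    exact ⟨-x, k, neg_mem hx, frac_neg a x k⟩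

/-- The localization `M_a` of a graded module at a homogeneous element `a`. -/
noncomputable def locObj {a : A} {e : ℤ} (ha : a ∈ 𝒜 e) (M : GrMod 𝒜) : GrMod 𝒜 where
  carrier := LocalizedModule (Submonoid.powers a) M
  deg := locDeg ha M
  isInternal := isInternal_of
    (fun z => by
      obtain ⟨x, k, rfl⟩ := exists_frac a z
      obtain ⟨y, hy, rfl⟩ := exists_family M.isInternal x
      refine ⟨Finsupp.embDomain (Equiv.subRight (k * e : ℤ)).toEmbedding
        (y.mapRange (fracHom a M k) (map_zero _)), fun n => ?_, ?_⟩
      · obtain ⟨m, rfl⟩ := (Equiv.subRight (k * e : ℤ)).surjective n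
        rw [← Equiv.coe_toEmbedding, Finsupp.embDomain_apply_self]
        refine ⟨y m, k, ?_, rfl⟩
        simpa using hy m
      · rw [Finsupp.sum_embDomain, sum_mapRange]
        rfl)
    (fun y hy hs => by
      have h : ∃ (k : ℕ) (x : ℤ →₀ M), (∀ n, x n ∈ M.deg (n + k * e)) ∧
          x.mapRange (fracHom a M k) (map_zero _) = y := by
        classical
        choose x k hx hxy using hy
        let l : ℕ := y.support.sup k
        refine ⟨l, Finsupp.onFinset y.support (fun n => if y n = 0 then 0 else
          a ^ (l - k n) • x n) (fun n hn => ?_), fun n => ?_, ?_⟩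
        · rw [Finsupp.mem_support_iff]
          intro h
          simp [h] at hn
        · rw [Finsupp.onFinset_apply]
          split_ifs with h
          · exact zero_mem _
          · have hl : k n ≤ l := Finset.le_sup (f := k) (by simpa using h)
            convert M.smul_mem (pow_mem ha (l - k n)) (hx n) using 2
            rw [Nat.cast_sub hl]
            ring
        · ext n
          rw [Finsupp.mapRange_apply, Finsupp.onFinset_apply]
          split_ifs with h
          · rw [map_zero, h]
          · have hl : k n ≤ l := Finset.le_sup (f := k) (by simpa using h)
            conv_rhs => rw [← hxy n, ← frac_scale a _ _ (l - k n), Nat.add_sub_cancel' hl]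
            rfl
      obtain ⟨k, x, hx, rfl⟩ := h
      rw [sum_mapRange] at hs
      obtain ⟨m, hm⟩ := (frac_eq_zero_iff a _ k).1 hs
      have hx' := family_eq_zero M.isInternal
        (Finsupp.embDomain (Equiv.addRight ((m : ℤ) * e + k * e)).toEmbedding
          (x.mapRange (DistribSMul.toAddMonoidHom M (a ^ m)) (map_zero _)))
        (fun n => by
          obtain ⟨n, rfl⟩ := (Equiv.addRight ((m : ℤ) * e + k * e)).surjective n
          rw [← Equiv.coe_toEmbedding, Finsupp.embDomain_apply_self]
          change a ^ m • x n ∈ _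
          convert M.smul_mem (pow_mem ha m) (hx n) using 2
          simp
          ring)
        (by
          rw [Finsupp.sum_embDomain, sum_mapRange]
          exact hm)
      ext n
      rw [Finsupp.mapRange_apply, Finsupp.zero_apply]
      refine (frac_eq_zero_iff a _ k).2 ⟨m, ?_⟩
      rw [Finsupp.embDomain_eq_zero] at hx'
      exact DFunLike.congr_fun hx' n)
  smul_mem := by
    rintro i j b _ hb ⟨x, k, hx, rfl⟩
    refine ⟨b • x, k, ?_, (smul_frac a b x k).symm⟩
    convert M.smul_mem hb hx using 2
    ring

/-- The map induced on localizations. -/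
noncomputable def locMap {a : A} {e : ℤ} (ha : a ∈ 𝒜 e) {M N : GrMod 𝒜} (f : M ⟶ N) :
    locObj ha M ⟶ locObj ha N where
  lin := (LocalizedModule.map (Submonoid.powers a) f.lin).restrictScalars A
  map_mem := by
    rintro n _ ⟨x, k, hx, rfl⟩
    exact ⟨f.lin x, k, f.map_mem _ _ hx, (LocalizedModule.map_mk _ _ _ _).symm⟩

lemma locMap_frac {a : A} {e : ℤ} (ha : a ∈ 𝒜 e) {M N : GrMod 𝒜} (f : M ⟶ N) (x : M) (k : ℕ) :
    (locMap ha f).lin (frac a x k) = frac a (f.lin x) k :=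
  LocalizedModule.map_mk _ _ _ _

lemma loc_hom_ext {a : A} {e : ℤ} (ha : a ∈ 𝒜 e) {M N : GrMod 𝒜} {f g : locObj ha M ⟶ N}
    (h : ∀ (x : M) (k : ℕ), f.lin (frac a x k) = g.lin (frac a x k)) : f = g :=
  hom_ext fun z => by
    obtain ⟨x, k, rfl⟩ := exists_frac a z
    exact h x k

/-- Localization at a homogeneous element, as a functor. -/
noncomputable def loc {a : A} {e : ℤ} (ha : a ∈ 𝒜 e) : GrMod 𝒜 ⥤ GrMod 𝒜 where
  obj := locObj ha
  map := locMap ha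
  map_id M := loc_hom_ext ha fun x k => locMap_frac ha (𝟙 M) x k
  map_comp f g := loc_hom_ext ha fun x k => by
    refine (locMap_frac ha (f ≫ g) x k).trans (Eq.symm ?_)
    exact (congrArg _ (locMap_frac ha f x k)).trans (locMap_frac ha g _ k)

instance {a : A} {e : ℤ} (ha : a ∈ 𝒜 e) : (loc ha).Additive where
  map_add {M N f g} := loc_hom_ext ha fun x k => by
    refine (locMap_frac ha (f + g) x k).trans ((frac_add a _ _ k).trans ?_)
    exact congrArg₂ (· + ·) (locMap_frac ha f x k).symm (locMap_frac ha g x k).symm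

lemma loc_shortExact {a : A} {e : ℤ} (ha : a ∈ 𝒜 e) (S : ShortComplex (GrMod 𝒜))
    (hS : S.ShortExact) : (S.map (loc ha)).ShortExact := by
  obtain ⟨h₁, h₂, h₃⟩ := (shortExact_iff S).1 hS
  refine (shortExact_iff _).2 ⟨?_, ?_, ?_⟩
  · rw [injective_iff_map_eq_zero]
    intro z hz
    obtain ⟨x, k, rfl⟩ := exists_frac a z
    obtain ⟨m, hm⟩ := (frac_eq_zero_iff a _ k).1 ((locMap_frac ha S.f x k).symm.trans hz)
    exact (frac_eq_zero_iff a _ k).2 ⟨m, h₁ (by rw [map_smul, hm, map_zero])⟩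
  · intro z
    obtain ⟨x, k, rfl⟩ := exists_frac a z
    obtain ⟨y, rfl⟩ := h₂ x
    exact ⟨frac a y k, locMap_frac ha S.g y k⟩
  · intro z hz
    obtain ⟨x, k, rfl⟩ := exists_frac a z
    obtain ⟨m, hm⟩ := (frac_eq_zero_iff a _ k).1 ((locMap_frac ha S.g x k).symm.trans hz)
    obtain ⟨y, hy⟩ := h₃ (a ^ m • x) (by rw [map_smul, hm])
    exact ⟨frac a y (k + m), (locMap_frac ha S.f y _).trans (by rw [hy, frac_scale])⟩

instance {a : A} {e : ℤ} (ha : a ∈ 𝒜 e) : (loc ha).PreservesHomology := by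
  exact ((loc ha).exact_tfae.out 0 2 rfl rfl).1 (loc_shortExact ha)

section Res

variable {a b c : A} (h : b = a * c)

lemma isUnit_res (M : Type u) [AddCommGroup M] [Module A M] (h : b = a * c)
    (s : Submonoid.powers a) :
    IsUnit (algebraMap A (Module.End A (LocalizedModule (Submonoid.powers b) M)) s) := by
  obtain ⟨_, k, rfl⟩ := s
  have := IsLocalizedModule.map_units (S := Submonoid.powers b)
    (LocalizedModule.mkLinearMap (Submonoid.powers b) M) ⟨b, Submonoid.mem_powers b⟩
  have e : algebraMap A (Module.End A (LocalizedModule (Submonoid.powers b) M)) b =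
      algebraMap A _ a * algebraMap A _ c := by
    rw [← map_mul]
    exact congrArg _ h
  dsimp only at this
  rw [e, ((Commute.all a c).map (algebraMap A _)).isUnit_mul_iff] at this
  rw [map_pow]
  exact this.1.pow k

/-- The canonical map `M_a ⟶ M_b` for `b = a * c`. -/
noncomputable def resLin (M : Type u) [AddCommGroup M] [Module A M] :
    LocalizedModule (Submonoid.powers a) M →ₗ[A] LocalizedModule (Submonoid.powers b) M :=
  LocalizedModule.lift _ (LocalizedModule.mkLinearMap _ _) (isUnit_res M h)

lemma resLin_frac {M : Type u} [AddCommGroup M] [Module A M] (x : M) (k : ℕ) :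
    resLin h M (frac a x k) = frac b (c ^ k • x) k := by
  have hk := isUnit_res M h ⟨a ^ k, k, rfl⟩
  rw [Module.End.isUnit_iff] at hk
  apply hk.1
  change a ^ k • (resLin h M (frac a x k)) =
    a ^ k • (frac b (c ^ k • x) k : LocalizedModule (Submonoid.powers b) M)
  rw [← map_smul, smul_frac, smul_frac, smul_smul, ← mul_pow, ← h]
  have h₁ := frac_scale a x 0 k
  have h₂ := frac_scale b x 0 k
  rw [zero_add] at h₁ h₂
  rw [h₁, h₂]
  have : ∀ a : A, frac a x 0 = LocalizedModule.mk x 1 := fun a => by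
    simp only [frac, pow_zero]
    rfl
  rw [this, this]
  exact LocalizedModule.lift_mk_one _ _ _ _

end Res

/-- The canonical map `M_a ⟶ M_b`, `x / a ^ k ↦ (c ^ k • x) / b ^ k`, for `b = a * c`. -/
noncomputable def res {a b c : A} {e e' e'' : ℤ} (ha : a ∈ 𝒜 e) (hb : b ∈ 𝒜 e') (hc : c ∈ 𝒜 e'')
    (h : b = a * c) (he : e' = e + e'') : loc ha ⟶ loc hb where
  app M :=
    { lin := resLin h M
      map_mem := by
        rintro n _ ⟨x, k, hx, rfl⟩
        refine ⟨c ^ k • x, k, ?_, (resLin_frac h x k).symm⟩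
        convert M.smul_mem (pow_mem hc k) hx using 2
        rw [he]
        ring }
  naturality M N f := loc_hom_ext ha fun x k => by
    refine (congrArg _ (locMap_frac ha f x k)).trans ((resLin_frac h _ k).trans (Eq.symm ?_))
    refine (congrArg _ (resLin_frac h x k)).trans ((locMap_frac hb f _ k).trans ?_)
    rw [map_smul]

lemma res_frac {a b c : A} {e e' e'' : ℤ} (ha : a ∈ 𝒜 e) (hb : b ∈ 𝒜 e') (hc : c ∈ 𝒜 e'')
    (h : b = a * c) (he : e' = e + e'') (M : GrMod 𝒜) (x : M) (k : ℕ) :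
    ((res ha hb hc h he).app M).lin (frac a x k) = frac b (c ^ k • x) k :=
  resLin_frac h x k

section Koszul

variable {r : ℕ} {f : Fin r → A} {d : Fin r → ℤ} (hf : ∀ i, f i ∈ 𝒜 (d i))

lemma prod_mem (hf : ∀ i, f i ∈ 𝒜 (d i)) (S : Finset (Fin r)) :
    ∏ i ∈ S, f i ∈ 𝒜 (∑ i ∈ S, d i) :=
  SetLike.prod_mem_graded (A := 𝒜) d f fun i _ => hf i

/-- The canonical map `M_{f_S} ⟶ M_{f_T}` for `S ⊆ T`, where `f_S = ∏_{i ∈ S} f_i`. -/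
noncomputable def prodRes {S T : Finset (Fin r)} (h : S ≤ T) :
    loc (prod_mem hf S) ⟶ loc (prod_mem hf T) :=
  res (prod_mem hf S) (prod_mem hf T) (prod_mem hf (T \ S))
    (by rw [mul_comm, Finset.prod_sdiff h]) (by rw [add_comm, Finset.sum_sdiff h])

lemma prodRes_frac {S T : Finset (Fin r)} (h : S ≤ T) (M : GrMod 𝒜) (x : M) (k : ℕ) :
    ((prodRes hf h).app M).lin (frac (∏ i ∈ S, f i) x k) =
      frac (∏ i ∈ T, f i) ((∏ i ∈ T \ S, f i) ^ k • x) k :=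
  res_frac _ _ _ _ _ M x k

/-- The functor sending `S ⊆ {1, …, r}` to the localization functor `M ↦ M_{f_S}`, with the
canonical maps `M_{f_S} ⟶ M_{f_T}` for `S ⊆ T`. -/
noncomputable def locSystem : Finset (Fin r) ⥤ (GrMod 𝒜 ⥤ GrMod 𝒜) where
  obj S := loc (prod_mem hf S)
  map h := prodRes hf (leOfHom h)
  map_id S := by
    ext M : 2
    refine loc_hom_ext _ fun x k => ?_
    refine (prodRes_frac hf le_rfl M x k).trans ?_
    rw [Finset.sdiff_self, Finset.prod_empty, one_pow, one_smul]
    rfl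
  map_comp {S T U} h h' := by
    ext M : 2
    refine loc_hom_ext _ fun x k => ?_
    refine (prodRes_frac hf (leOfHom (h ≫ h')) M x k).trans (Eq.symm ?_)
    refine (congrArg ((prodRes hf (leOfHom h')).app M).lin
      (prodRes_frac hf (leOfHom h) M x k)).trans
      ((prodRes_frac hf (leOfHom h') M _ k).trans ?_)
    have hST : S ⊆ T := leOfHom h
    have hTU : T ⊆ U := leOfHom h'
    have : U \ S = (U \ T) ∪ (T \ S) := by
      ext i
      have h₁ := @hST i
      have h₂ := @hTU i
      simp only [Finset.mem_sdiff, Finset.mem_union]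
      tauto
    rw [smul_smul, ← mul_pow, this, Finset.prod_union]
    exact Finset.disjoint_of_subset_right Finset.sdiff_subset Finset.sdiff_disjoint

instance (S : Finset (Fin r)) : ((locSystem hf).obj S).Additive :=
  inferInstanceAs (loc (prod_mem hf S)).Additive

instance (S : Finset (Fin r)) : ((locSystem hf).obj S).PreservesHomology :=
  inferInstanceAs (loc (prod_mem hf S)).PreservesHomology

end Koszul

end GrMod

/-- The two boundedness conditions, bounded above (`D⁻`) and bounded (`Dᵇ`). -/
inductive Boundedness
  | minus
  | bounded

/-- `D⁻(C)` resp. `Dᵇ(C)`, as a full subcategory of `D(C)`. -/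
def Boundedness.subcat (s : Boundedness) (C : Type*) [Category* C] [Abelian C]
    [HasDerivedCategory C] : ObjectProperty (DerivedCategory C) :=
  match s with
  | minus => DerivedCategory.TStructure.t.minus
  | bounded => DerivedCategory.TStructure.t.bounded

/-- The objects of `D⁻(C)` resp. `Dᵇ(C)` all of whose cohomologies satisfy `P`. -/
def Boundedness.subcatOf (s : Boundedness) {C : Type*} [Category* C] [Abelian C]
    [HasDerivedCategory C] (P : ObjectProperty C) : ObjectProperty (DerivedCategory C) :=
  s.subcat C ⊓ fun X => ∀ n : ℤ, P ((DerivedCategory.homologyFunctor C n).obj X)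

section

variable {A : Type u} [CommRing A] (𝒜 : ℤ → AddSubgroup A)

/-- `gr A`: the finitely generated graded modules. -/
def GrMod.isFG : ObjectProperty (GrMod 𝒜) := fun M => Module.Finite A M

/-- `q⁺gr A`: the essential image of `gr A` in `Q⁺Gr A`. -/
def QGr.isFG : ObjectProperty (QGr 𝒜) := (GrMod.isFG 𝒜).map (QGr.quot 𝒜)

/-- The functor `φ^* : D(Gr A) ⥤ D(Q⁺Gr A)` induced by the exact quotient functor. -/
noncomputable abbrev phiStar [HasDerivedCategory (GrMod 𝒜)] [HasDerivedCategory (QGr 𝒜)] :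
    DerivedCategory (GrMod 𝒜) ⥤ DerivedCategory (QGr 𝒜) :=
  (QGr.quot 𝒜).mapDerivedCategory

variable {𝒜} [GradedRing 𝒜] [HasDerivedCategory (GrMod 𝒜)]
  {r : ℕ} {f : Fin r → A} {d : Fin r → ℤ} (hf : ∀ i, f i ∈ 𝒜 (d i))

/-- The functor `RΓ_{(f_1, …, f_r)}` sending `M` to the total complex of
`M ⟶ ∏_i M_{f_i} ⟶ ∏_{i < j} M_{f_i f_j} ⟶ ⋯ ⟶ M_{f_1 ⋯ f_r}`. -/
noncomputable def RGamma : DerivedCategory (GrMod 𝒜) ⥤ DerivedCategory (GrMod 𝒜) :=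
  CechTotal.derived (GrMod.locSystem hf) Finset.univ CechTotal.ordConnected_univ

/-- The Čech functor sending `M` to the total complex of
`∏_i M_{f_i} ⟶ ∏_{i < j} M_{f_i f_j} ⟶ ⋯ ⟶ M_{f_1 ⋯ f_r}`, the first term of which is in
degree `0`. It is the shift by `1` of the part of `RΓ_{(f_1, …, f_r)}(M)` given by the nonempty
subsets of `{1, …, r}`. -/
noncomputable def cech : DerivedCategory (GrMod 𝒜) ⥤ DerivedCategory (GrMod 𝒜) :=
  CechTotal.derived (GrMod.locSystem hf) (Finset.univ.filter Finset.Nonempty)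
    CechTotal.ordConnected_nonempty ⋙ shiftFunctor _ (1 : ℤ)

/-- The objects `M` of `D⁻(Gr A)` resp. `Dᵇ(Gr A)` with `RΓ_{(f_1, …, f_r)}(M) ≃ 0`. -/
def Boundedness.trivialSubcat (s : Boundedness) : ObjectProperty (DerivedCategory (GrMod 𝒜)) :=
  s.subcat (GrMod 𝒜) ⊓ fun M => IsZero ((RGamma hf).obj M)

/-- The essential image of `D⁻_coh(Gr A)` resp. `Dᵇ_coh(Gr A)` under the Čech functor. -/
def Boundedness.cohTrivialSubcat (s : Boundedness) : ObjectProperty (DerivedCategory (GrMod 𝒜)) :=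
  (s.subcatOf (GrMod.isFG 𝒜)).map (cech hf)

end

/-- For an adjunction `F ⊣ R` and full subcategories `P` and `P'`: `F` and `R` restrict to mutually
quasi-inverse equivalences between `P` and `P'`, by means of the unit and the counit. -/
structure RestrictsToEquivalence {D D' : Type*} [Category* D] [Category* D'] {F : D ⥤ D'}
    {R : D' ⥤ D} (adj : F ⊣ R) (P : ObjectProperty D) (P' : ObjectProperty D') : Prop where
  map_left : ∀ X, P X → P' (F.obj X)
  map_right : ∀ Y, P' Y → P (R.obj Y)
  isIso_unit : ∀ X, P X → IsIso (adj.unit.app X)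
  isIso_counit : ∀ Y, P' Y → IsIso (adj.counit.app Y)
  isEquivalence_left :
    (P'.lift (P.ι ⋙ F) fun X => map_left X.1 X.2 :
      P.FullSubcategory ⥤ P'.FullSubcategory).IsEquivalence
  isEquivalence_right :
    (P.lift (P'.ι ⋙ R) fun Y => map_right Y.1 Y.2 :
      P'.FullSubcategory ⥤ P.FullSubcategory).IsEquivalence

/-! Let N be the kernel of φ^* on D(Gr A). By exactness of the quotient functor, N consists of the
complexes with I⁺-torsion cohomology. The heart of the proof is that RΓ(M) → M → Č(M) → is the
localization triangle of M with respect to N. First, RΓ(M) lies in N. A module is torsion exactly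
when its localizations at all f_i vanish. After inverting f_i, the maps from M_{f_S} to M_{f_{S ∪
{i}}} become invertible, and their inverses contract the full total complex (`homotopyIdZero`,
`isZero_phiStar_cplx_univ`). Second, Č(M) is right orthogonal to N. It is a finite iterated
extension of shifts of the M_{f_S} with S nonempty (`prop_Q_cplx`), and a map from X in N to a
complex on which f_S acts invertibly factors through X_{f_S} = 0 (`rightOrthogonal_Q_obj_loc`).
Hence RΓ(M) = 0 if and only if M is right orthogonal to N (`isZero_RGamma_obj_iff`,
`isIso_cechUnit_app_iff`), and Č inverts every map inverted by φ^* (`isIso_cech_map`).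

The adjoint is built without injective resolutions. The functor H⁰(Č(-)) descends to φ_* on the
Serre quotient, and Č(φ_* K), with φ_* applied termwise, descends to Rφ_* on the derived category.
Its values are orthogonal to N and φ^* Rφ_* ≅ 1, which by `exists_adjunction` is enough. An
adjunction with invertible counit then restricts to an equivalence over any isomorphism-closed full
subcategory of the target (`restrictsToEquivalence_inverseImage`).

It remains to identify the two subcategories of D(Gr A) as those orthogonal objects whose image
under φ^* lies in the given target (`trivialSubcat_eq`, `cohTrivialSubcat_eq`). If φ^* X is bounded,
cohomological truncation of X changes it only by torsion, so X ≅ Č(X) is also Č of a bounded object.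
For coherence, a module lands in q⁺gr A exactly when it is finitely generated up to torsion
(`isFG_quot_obj_iff`). A bounded above complex with such cohomology contains a subcomplex of
finitely generated graded modules, built by descending recursion, with the same image under φ^*
(`exists_isFG_subcomplex`). -/

/-! ### Adjoints and equivalences from orthogonality to the kernel of an exact functor. -/

section Acyclic

open Pretriangulated ObjectProperty ZeroObject

variable {D D' : Type*} [Category* D] [Category* D'] [HasZeroObject D] [HasShift D ℤ]
  [Preadditive D] [∀ n : ℤ, (shiftFunctor D n).Additive] [Pretriangulated D]
  [HasZeroObject D'] [HasShift D' ℤ] [Preadditive D'] [∀ n : ℤ, (shiftFunctor D' n).Additive]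
  [Pretriangulated D']

variable (D) in
lemma isTriangulated_isZero : ObjectProperty.IsTriangulated (IsZero (C := D)) where
  exists_zero := ⟨0, isZero_zero D, isZero_zero D⟩
  isStableUnderShiftBy n := ⟨fun _ hX => (shiftFunctor D n).map_isZero hX⟩
  toIsTriangulatedClosed₂ := .mk' fun _ hT h₁ h₃ =>
    (Triangle.isZero₂_iff _ hT).2 ⟨h₁.eq_of_src _ _, h₃.eq_of_tgt _ _⟩

variable (F : D ⥤ D') [F.CommShift ℤ] [F.IsTriangulated]

/-- The objects killed by a functor. -/
def kerProp : ObjectProperty D := ObjectProperty.inverseImage (IsZero (C := D')) F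

instance : (kerProp F).IsTriangulated :=
  have := isTriangulated_isZero D'
  inferInstanceAs (ObjectProperty.inverseImage (IsZero (C := D')) F).IsTriangulated

instance : (kerProp F).IsClosedUnderIsomorphisms :=
  ⟨fun e h => IsZero.of_iso h (F.mapIso e.symm)⟩

/-- A triangulated functor carries a cone of `f` to a cone of `F.map f`, and a morphism is
invertible exactly when its cone vanishes. -/
lemma trW_kerProp_iff {X Y : D} (f : X ⟶ Y) : (kerProp F).trW f ↔ IsIso (F.map f) := by
  obtain ⟨Z, g, h, hT⟩ := distinguished_cocone_triangle f
  refine (trW_iff_of_distinguished _ _ hT).trans ?_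
  exact Triangle.isZero₃_iff_isIso₁ _ (F.map_distinguished _ hT)

variable {F}

lemma precomp_bijective {L : D} (hL : (kerProp F).rightOrthogonal L) {X Y : D} (f : X ⟶ Y)
    (hf : IsIso (F.map f)) : Function.Bijective fun g : Y ⟶ L => f ≫ g := by
  rw [← isLocal_trW] at hL
  exact hL f ((trW_kerProp_iff F f).2 hf)

/-- Right orthogonal objects are local for the maps inverted by `F`, so locality of `L` produces a
retraction and locality of `L'` makes it a two-sided inverse. This conservativity of `F` on the
orthogonal is used throughout. -/
lemma isIso_of_rightOrthogonal {L L' : D} (hL : (kerProp F).rightOrthogonal L)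
    (hL' : (kerProp F).rightOrthogonal L') (f : L ⟶ L') (hf : IsIso (F.map f)) : IsIso f := by
  obtain ⟨g, hg⟩ := (precomp_bijective hL f hf).2 (𝟙 L)
  exact ⟨g, hg, (precomp_bijective hL' f hf).1 (by
    dsimp only at hg ⊢
    rw [reassoc_of% hg, Category.comp_id])⟩

/-- A functor `F` has right adjoint `R` as soon as there are natural transformations
`u : 1 ⟶ F ⋙ R` and `e : R ⋙ F ≅ 1` such that `F` inverts `u`, and `R` takes values in the right
orthogonal of the kernel of `F`. -/
lemma exists_adjunction (R : D' ⥤ D) (u : 𝟭 D ⟶ F ⋙ R) (hu : ∀ X, IsIso (F.map (u.app X)))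
    (e : R ⋙ F ≅ 𝟭 D') (hR : ∀ Y, (kerProp F).rightOrthogonal (R.obj Y)) :
    ∃ adj : F ⊣ R, IsIso adj.counit := by
  have hu' (Y : D') : IsIso (u.app (R.obj Y)) :=
    isIso_of_rightOrthogonal (hR _) (hR _) _ (hu _)
  have hbij (X : D) (Y : D') :
      Function.Bijective fun g : X ⟶ R.obj Y => F.map g ≫ e.hom.app Y := by
    constructor
    · intro g g' h
      have h' : F.map g = F.map g' := (cancel_mono (e.hom.app Y)).1 h
      -- Naturality of `u` recovers `g` from `F.map g`, because `u` is invertible at `R.obj Y`.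
      have h₁ := u.naturality g
      have h₂ := u.naturality g'
      simp only [Functor.id_obj, Functor.id_map, Functor.comp_obj, Functor.comp_map] at h₁ h₂
      rw [h', ← h₂] at h₁
      exact (cancel_mono (u.app (R.obj Y))).1 h₁
    · intro k
      have := hu X
      -- No triangle identity is assumed, so `F.map (u.app X) ≫ e.hom.app (F.obj X)` is merely an
      -- automorphism of `F.obj X`; its inverse corrects the usual candidate `u.app X ≫ R.map k`.
      refine ⟨u.app X ≫ R.map (inv (F.map (u.app X) ≫ e.hom.app (F.obj X)) ≫ k), ?_⟩
      have := e.hom.naturality (inv (F.map (u.app X) ≫ e.hom.app (F.obj X)) ≫ k)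
      simp only [Functor.comp_obj, Functor.comp_map, Functor.id_obj, Functor.id_map] at this
      dsimp only
      rw [Functor.map_comp, Category.assoc, this, ← Category.assoc]
      exact IsIso.hom_inv_id_assoc _ _
  let adj : F ⊣ R := Adjunction.mkOfHomEquiv
    { homEquiv := fun X Y => (Equiv.ofBijective _ (hbij X Y)).symm
      homEquiv_naturality_left_symm := fun f g => by simp
      homEquiv_naturality_right := fun {X Y Y'} f g => by
        rw [Equiv.symm_apply_eq]
        have h := (Equiv.ofBijective _ (hbij X Y)).apply_symm_apply f
        simp only [Equiv.ofBijective_apply] at h ⊢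
        have := e.hom.naturality g
        simp only [Functor.comp_obj, Functor.comp_map, Functor.id_obj, Functor.id_map] at this
        rw [Functor.map_comp, Category.assoc, this, reassoc_of% h] }
  refine ⟨adj, ?_⟩
  have : ∀ Y, IsIso (adj.counit.app Y) := fun Y => by
    have : adj.counit.app Y = e.hom.app Y := by
      simp [adj, Adjunction.mkOfHomEquiv]
    rw [this]
    infer_instance
  exact NatIso.isIso_of_isIso_app _

/-- Maps from `X` to `R.obj Y` correspond to maps out of `F.obj X`, which is zero for `X` in the
kernel. -/
lemma rightOrthogonal_of_adjunction {R : D' ⥤ D} (adj : F ⊣ R) (Y : D') :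
    (kerProp F).rightOrthogonal (R.obj Y) := fun X f hX => by
  rw [← (adj.homEquiv X Y).symm.injective.eq_iff]
  exact IsZero.eq_of_src hX _ _

lemma isIso_map_unit {R : D' ⥤ D} (adj : F ⊣ R) [IsIso adj.counit] (X : D) :
    IsIso (F.map (adj.unit.app X)) :=
  have h := adj.left_triangle_components X
  have : IsIso (F.map (adj.unit.app X) ≫ adj.counit.app (F.obj X)) := by
    rw [h]
    exact IsIso.id _
  IsIso.of_isIso_comp_right _ (adj.counit.app (F.obj X))

/-- An adjunction `F ⊣ R` with invertible counit restricts to an equivalence on the part of the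
right orthogonal of the kernel of `F` lying over a full subcategory. -/
lemma restrictsToEquivalence_inverseImage {R : D' ⥤ D} (adj : F ⊣ R) [IsIso adj.counit]
    (P' : ObjectProperty D') [P'.IsClosedUnderIsomorphisms] :
    RestrictsToEquivalence adj ((kerProp F).rightOrthogonal ⊓ P'.inverseImage F) P' := by
  have h₁ : ∀ X, ((kerProp F).rightOrthogonal ⊓ P'.inverseImage F) X → P' (F.obj X) :=
    fun X hX => hX.2
  have h₂ : ∀ Y, P' Y → ((kerProp F).rightOrthogonal ⊓ P'.inverseImage F) (R.obj Y) :=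
    fun Y hY => ⟨rightOrthogonal_of_adjunction adj Y,
      P'.prop_of_iso (asIso (adj.counit.app Y)).symm hY⟩
  -- The unit at `X` is a map between right orthogonal objects, and `F` inverts it by the triangle
  -- identity.
  have h₃ : ∀ X, ((kerProp F).rightOrthogonal ⊓ P'.inverseImage F) X →
      IsIso (adj.unit.app X) := fun X hX =>
    isIso_of_rightOrthogonal hX.1 (rightOrthogonal_of_adjunction adj _) _ (isIso_map_unit adj X)
  let G₁ := P'.lift (((kerProp F).rightOrthogonal ⊓ P'.inverseImage F).ι ⋙ F)
    fun X => h₁ X.1 X.2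
  let G₂ := ((kerProp F).rightOrthogonal ⊓ P'.inverseImage F).lift (P'.ι ⋙ R)
    fun Y => h₂ Y.1 Y.2
  let E : _ ≌ _ := CategoryTheory.Equivalence.mk G₁ G₂
    (NatIso.ofComponents (fun X => ((kerProp F).rightOrthogonal ⊓ P'.inverseImage F).isoMk
      (haveI := h₃ X.1 X.2; asIso (adj.unit.app X.1))) (fun {X Y} f => by
        ext
        exact adj.unit.naturality f.hom))
    (NatIso.ofComponents (fun Y => P'.isoMk (asIso (adj.counit.app Y.1))) (fun {X Y} f => by
        ext
        exact adj.counit.naturality f.hom))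
  exact
    { map_left := h₁
      map_right := h₂
      isIso_unit := h₃
      isIso_counit := fun Y _ => inferInstance
      isEquivalence_left := E.isEquivalence_functor
      isEquivalence_right := E.isEquivalence_inverse }

end Acyclic

/-! ### The contracting homotopy of the full total complex after inverting one element. -/

namespace CechTotal

attribute [local instance] Abelian.hasFiniteBiproducts

variable {r : ℕ} {C : Type*} [Category* C] [Abelian C] (G : Finset (Fin r) ⥤ (C ⥤ C))

section Contraction

variable {G} in
lemma entry_comp_res {S U T : Finset (Fin r)} (hSU : S ≤ U) (hUT : U ≤ T) {X Y : C} (α : X ⟶ Y) :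
    entry G S U α ≫ (G.map (homOfLE hUT)).app Y = entry G S T α := by
  rw [entry_of_le G hSU, entry_of_le G (hSU.trans hUT), ← homOfLE_comp hSU hUT, G.map_comp]
  simp

variable {G} in
lemma res_comp_entry {S U T : Finset (Fin r)} (hSU : S ≤ U) (hUT : U ≤ T) {X Y : C} (α : X ⟶ Y) :
    (G.map (homOfLE hSU)).app X ≫ entry G U T α = entry G S T α := by
  rw [entry_of_le G hUT, entry_of_le G (hSU.trans hUT), ← homOfLE_comp hSU hUT, G.map_comp]
  simp

variable {E : Type*} [Category* E] [Preadditive E] (Φ : C ⥤ E)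

/-- An additive functor preserves the relation expressing the identity of a biproduct as a sum of
projections followed by inclusions, so matrix entries can be compared without rewriting `Φ.obj (⨁
X)` as a biproduct. -/
lemma map_biproduct_hom_ext [Φ.Additive] {ι κ : Type} [Fintype ι] [Fintype κ] {X : ι → C} {Y : κ → C}
    {a b : Φ.obj (⨁ X) ⟶ Φ.obj (⨁ Y)}
    (h : ∀ s t, Φ.map (biproduct.ι X s) ≫ a ≫ Φ.map (biproduct.π Y t) =
      Φ.map (biproduct.ι X s) ≫ b ≫ Φ.map (biproduct.π Y t)) : a = b := by
  have hX : ∑ s, Φ.map (biproduct.π X s) ≫ Φ.map (biproduct.ι X s) = 𝟙 _ := by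
    have := congrArg Φ.map (biproduct.total (f := X))
    rw [Φ.map_sum, Φ.map_id] at this
    simpa using this
  have hY : ∑ s, Φ.map (biproduct.π Y s) ≫ Φ.map (biproduct.ι Y s) = 𝟙 _ := by
    have := congrArg Φ.map (biproduct.total (f := Y))
    rw [Φ.map_sum, Φ.map_id] at this
    simpa using this
  rw [← Category.id_comp a, ← Category.id_comp b, ← hX, ← Category.comp_id a,
    ← Category.comp_id b, ← hY]
  simp only [Preadditive.sum_comp, Preadditive.comp_sum, Category.assoc]
  refine Finset.sum_congr rfl fun t _ => Finset.sum_congr rfl fun s _ => ?_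
  have := h s t
  simp only [← Category.assoc] at this
  simp only [← Category.assoc, this]

variable (i : Fin r)
  (hΦ : ∀ S, i ∉ S → ∀ X, IsIso (Φ.map ((G.map (homOfLE (Finset.subset_insert i S))).app X)))
  (K : CochainComplex C ℤ)

/-- The entries of a contracting homotopy of the image of the total complex under a functor `Φ`
which inverts the maps `G_S ⟶ G_{S ∪ {i}}`. -/
noncomputable def homotopyEntry (n m : ℤ) (S T : Finset (Fin r)) :
    Φ.obj ((G.obj S).obj (K.X (n - S.card))) ⟶ Φ.obj ((G.obj T).obj (K.X (m - T.card))) :=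
  if h : i ∉ T ∧ S = insert i T ∧ m + 1 = n then
    haveI : IsIso (Φ.map ((G.map (homOfLE (h.2.1 ▸ Finset.subset_insert i T : T ≤ S))).app
      (K.X (m - T.card)))) := by
        obtain ⟨h₁, rfl, -⟩ := h
        exact hΦ T h₁ _
    -- The sign is that of the differential from `T` to `S`, so on the diagonal it is squared to
    -- `1`.
    sgn T S • (Φ.map ((G.obj S).map (K.XIsoOfEq (by
      rw [h.2.1, Finset.card_insert_of_notMem h.1]; push_cast; lia)).hom) ≫
      inv (Φ.map ((G.map (homOfLE (h.2.1 ▸ Finset.subset_insert i T : T ≤ S))).app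
        (K.X (m - T.card)))))
  else 0

lemma homotopyEntry_eq_zero (n m : ℤ) {S T : Finset (Fin r)} (h : ¬ (i ∉ T ∧ S = insert i T)) :
    homotopyEntry G Φ i hΦ K n m S T = 0 :=
  dif_neg fun h' => h ⟨h'.1, h'.2.1⟩

/-- The restriction from `S` to `insert i T` factors through `T`, and the homotopy cancels its last
step. -/
lemma map_entry_comp_homotopyEntry [Φ.Additive] (n m : ℤ) (hmn : m + 1 = n)
    {S T : Finset (Fin r)} (hST : S ≤ T) (hT : i ∉ T) {X : C} (α : X ⟶ _) :
    Φ.map (entry G S (insert i T) α) ≫ homotopyEntry G Φ i hΦ K n m (insert i T) T =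
      sgn T (insert i T) • Φ.map (entry G S T (α ≫ (K.XIsoOfEq (by
        rw [Finset.card_insert_of_notMem hT]; push_cast; lia)).hom)) := by
  have := hΦ T hT (K.X (m - T.card))
  rw [homotopyEntry, dif_pos ⟨hT, rfl, hmn⟩, Preadditive.comp_zsmul, ← Category.assoc]
  congr 1
  rw [IsIso.comp_inv_eq, ← Φ.map_comp, ← Φ.map_comp, entry_comp_map,
    entry_comp_res hST (Finset.subset_insert i T)]

/-- Dually, the restriction from `S` to `T` factors through `insert i S`, and the homotopy cancels
its first step. -/
lemma homotopyEntry_comp_map_entry [Φ.Additive] (n m : ℤ) (hmn : m + 1 = n)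
    {S T : Finset (Fin r)} (hS : i ∉ S) (hST : insert i S ≤ T) {Y : C} (α : _ ⟶ Y) :
    homotopyEntry G Φ i hΦ K n m (insert i S) S ≫ Φ.map (entry G S T α) =
      sgn S (insert i S) • Φ.map (entry G (insert i S) T ((K.XIsoOfEq (by
        rw [Finset.card_insert_of_notMem hS]; push_cast; lia)).hom ≫ α)) := by
  have := hΦ S hS (K.X (m - S.card))
  rw [homotopyEntry, dif_pos ⟨hS, rfl, hmn⟩, Preadditive.zsmul_comp, Category.assoc]
  congr 1
  rw [← res_comp_entry (Finset.subset_insert i S) hST, Φ.map_comp, IsIso.inv_hom_id_assoc,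
    ← Φ.map_comp, map_comp_entry]

lemma sgn_mul_self (S T : Finset (Fin r)) : sgn S T * sgn S T = 1 := by
  rw [sgn, ← mul_pow]
  simp

lemma sgn_mul_add' {S : Finset (Fin r)} {a b : Fin r} (ha : a ∉ S) (hb : b ∉ S) (hab : a ≠ b) :
    sgn (insert a S) (insert b (insert a S)) * sgn (insert b S) (insert a (insert b S)) +
      sgn S (insert b S) * sgn S (insert a S) = 0 := by
  have key : sgn S (insert a S) * sgn (insert a S) (insert b (insert a S)) +
      sgn S (insert b S) * sgn (insert b S) (insert a (insert b S)) = 0 := by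
    rcases hab.lt_or_gt with h | h
    · have := sgn_mul_add ha hb h
      rwa [Finset.insert_comm b a S] at this ⊢
    · have := sgn_mul_add hb ha h
      rw [Finset.insert_comm b a S, add_comm]
      exact this
  have h₁ := sgn_mul_self S (insert b S)
  have h₂ := sgn_mul_self (insert a S) (insert b (insert a S))
  -- The anticommutation relation is multiplied by two of its four signs, whose squares are `1`.
  linear_combination sgn S (insert b S) * sgn (insert a S) (insert b (insert a S)) * key -
    sgn S (insert b S) * sgn S (insert a S) * h₂ -
    sgn (insert a S) (insert b (insert a S)) * sgn (insert b S) (insert a (insert b S)) * h₁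

/-- This is the cancellation, at the level of coefficients, in the entry of `dh + hd` from `insert i
S` to `U`. For `S = U` it holds because inserting `i` changes the sign of the internal differential;
for `U = insert a S` it is anticommutativity of the square obtained by adding `i` and `a`; otherwise
both coefficients vanish. -/
lemma sgn_coeff_add (n : ℤ) {S U : Finset (Fin r)} (hS : i ∉ S) (hU : i ∉ U) :
    sgn U (insert i U) • (coeff K n (n + 1) (insert i S) (insert i U) ≫ (K.XIsoOfEq (by
        rw [Finset.card_insert_of_notMem hU]; push_cast; lia :
          n + 1 - ((insert i U).card : ℤ) = n - U.card)).hom) +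
      sgn S (insert i S) • ((K.XIsoOfEq (by
        rw [Finset.card_insert_of_notMem hS]; push_cast; lia :
          n - ((insert i S).card : ℤ) = n - 1 - S.card)).hom ≫ coeff K (n - 1) n S U) = 0 := by
  by_cases hSU : S = U
  · subst hSU
    have h : (-1 : ℤ) ^ (insert i S).card = -(-1) ^ S.card := by
      rw [Finset.card_insert_of_notMem hS, pow_succ, mul_neg_one]
    rw [coeff_self, coeff_self, h]
    simp
  by_cases h : ∃ a ∉ S, U = insert a S
  · obtain ⟨a, ha, rfl⟩ := h
    have hia : i ≠ a := fun h => hU (by simp [h])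
    have ha' : a ∉ insert i S := by simp [ha, hia.symm]
    rw [coeff_insert _ _ (by lia) ha]
    -- The target is generalized because the two orders of insertion give sets that are only
    -- propositionally equal, and the type of `coeff` depends on the set.
    have : ∀ U', U' = insert a (insert i S) → ∀ h : _, coeff K n (n + 1) (insert i S) U' =
        sgn (insert i S) U' • (K.XIsoOfEq h).hom := by
      rintro _ rfl h
      exact coeff_insert _ _ rfl ha'
    have hn : n - ((insert i S).card : ℤ) = n + 1 - ((insert i (insert a S)).card : ℤ) := by
      have h₁ := Finset.card_insert_of_notMem hU
      have h₂ := Finset.card_insert_of_notMem hS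
      have h₃ := Finset.card_insert_of_notMem ha
      rw [h₁, h₂, h₃]
      push_cast
      ring
    rw [this _ (Finset.insert_comm i a S) hn]
    simp only [Preadditive.zsmul_comp, Preadditive.comp_zsmul, smul_smul,
      HomologicalComplex.XIsoOfEq_hom_comp_XIsoOfEq_hom, ← add_smul]
    have h := sgn_mul_add' ha hS hia.symm
    rw [Finset.insert_comm a i S] at h
    rw [h, zero_smul]
  · rw [coeff_eq_zero (n - 1) n hSU (fun a ha h' => h ⟨a, ha, h'⟩), coeff_eq_zero n (n + 1)]
    · simp
    · intro h'
      exact hSU (by rw [← Finset.erase_insert hS, h', Finset.erase_insert hU])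
    · intro a ha h'
      have hai : a ≠ i := by rintro rfl; simp at ha
      refine h ⟨a, fun h => ha (by simp [h]), ?_⟩
      rw [← Finset.erase_insert hU, h', Finset.erase_insert_of_ne hai, Finset.erase_insert hS]

/-- The components of a contracting homotopy of the image of the total complex. -/
noncomputable def homotopyMap (n m : ℤ) :
    Φ.obj (term G Finset.univ K n) ⟶ Φ.obj (term G Finset.univ K m) :=
  ∑ S : (Finset.univ : Finset (Finset (Fin r))), ∑ T : (Finset.univ : Finset (Finset (Fin r))),
    Φ.map (biproduct.π _ S) ≫ homotopyEntry G Φ i hΦ K n m S.1 T.1 ≫ Φ.map (biproduct.ι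
      (fun T : (Finset.univ : Finset (Finset (Fin r))) => (G.obj T.1).obj (K.X (m - T.1.card))) T)

variable [Φ.Additive] [∀ S, (G.obj S).Additive]

lemma map_biproduct_ι_π {ι : Type} [Fintype ι] [DecidableEq ι] (X : ι → C) (s t : ι) :
    Φ.map (biproduct.ι X s) ≫ Φ.map (biproduct.π X t) =
      if h : s = t then eqToHom (by rw [h]) else 0 := by
  rw [← Φ.map_comp, biproduct.ι_π]
  split_ifs with h
  · subst h; simp
  · simp

lemma map_dTerm_comp_homotopyMap (n m k : ℤ) (S U : (Finset.univ : Finset (Finset (Fin r)))) :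
    Φ.map (biproduct.ι _ S) ≫ (Φ.map (dTerm G Finset.univ K n m) ≫ homotopyMap G Φ i hΦ K m k) ≫
      Φ.map (biproduct.π _ U) =
    ∑ T : Finset (Fin r), Φ.map (entry G S.1 T (coeff K n m S.1 T)) ≫
      homotopyEntry G Φ i hΦ K m k T U.1 := by
  rw [← Finset.sum_coe_sort Finset.univ]
  simp only [homotopyMap, Preadditive.sum_comp, Preadditive.comp_sum, Category.assoc]
  refine Finset.sum_congr rfl fun T _ => ?_
  rw [Finset.sum_eq_single U]
  · rw [← Φ.map_comp (biproduct.ι _ U), biproduct.ι_π_self, Φ.map_id, Category.comp_id,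
      ← ι_dTerm_π G Finset.univ K n m S T, Φ.map_comp, Φ.map_comp]
    simp
  · intro V _ hV
    rw [← Φ.map_comp (biproduct.ι _ V), biproduct.ι_π_ne _ hV]
    simp
  · simp

lemma homotopyMap_comp_map_dTerm (n m k : ℤ) (S U : (Finset.univ : Finset (Finset (Fin r)))) :
    Φ.map (biproduct.ι _ S) ≫ (homotopyMap G Φ i hΦ K n m ≫ Φ.map (dTerm G Finset.univ K m k)) ≫
      Φ.map (biproduct.π _ U) =
    ∑ T : Finset (Fin r), homotopyEntry G Φ i hΦ K n m S.1 T ≫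
      Φ.map (entry G T U.1 (coeff K m k T U.1)) := by
  rw [← Finset.sum_coe_sort Finset.univ]
  simp only [homotopyMap, Preadditive.sum_comp, Preadditive.comp_sum, Category.assoc]
  rw [Finset.sum_comm]
  refine Finset.sum_congr rfl fun T _ => ?_
  rw [Finset.sum_eq_single S]
  · rw [← Category.assoc (Φ.map (biproduct.ι _ S)), ← Φ.map_comp, biproduct.ι_π_self, Φ.map_id, Category.id_comp,
      ← ι_dTerm_π G Finset.univ K m k T U, Φ.map_comp, Φ.map_comp]
  · intro V _ hV
    rw [← Category.assoc (Φ.map (biproduct.ι _ S)), ← Φ.map_comp, biproduct.ι_π_ne _ hV.symm]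
    simp
  · simp

/-- The sum of the two composites of the differential and the contracting homotopy, in terms of
matrix entries. -/
lemma sum_homotopyEntry (n : ℤ) (S U : Finset (Fin r)) :
    ∑ T : Finset (Fin r), Φ.map (entry G S T (coeff K n (n + 1) S T)) ≫
      homotopyEntry G Φ i hΦ K (n + 1) n T U +
    ∑ T : Finset (Fin r), homotopyEntry G Φ i hΦ K n (n - 1) S T ≫
      Φ.map (entry G T U (coeff K (n - 1) n T U)) =
    if h : S = U then eqToHom (by rw [h]) else 0 := by
  have h₁ : i ∉ U → ∑ T : Finset (Fin r), Φ.map (entry G S T (coeff K n (n + 1) S T)) ≫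
      homotopyEntry G Φ i hΦ K (n + 1) n T U =
      Φ.map (entry G S (insert i U) (coeff K n (n + 1) S (insert i U))) ≫
      homotopyEntry G Φ i hΦ K (n + 1) n (insert i U) U := fun hU => by
    refine Finset.sum_eq_single _ (fun T _ hT => ?_) (by simp)
    rw [homotopyEntry_eq_zero _ _ _ _ _ _ _ (fun h => hT h.2), comp_zero]
  have h₂ : i ∈ U → ∑ T : Finset (Fin r), Φ.map (entry G S T (coeff K n (n + 1) S T)) ≫
      homotopyEntry G Φ i hΦ K (n + 1) n T U = 0 := fun hU => by
    refine Finset.sum_eq_zero fun T _ => ?_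
    rw [homotopyEntry_eq_zero _ _ _ _ _ _ _ (fun h => h.1 hU), comp_zero]
  have h₃ : i ∉ S → ∑ T : Finset (Fin r), homotopyEntry G Φ i hΦ K n (n - 1) S T ≫
      Φ.map (entry G T U (coeff K (n - 1) n T U)) = 0 := fun hS => by
    refine Finset.sum_eq_zero fun T _ => ?_
    rw [homotopyEntry_eq_zero _ _ _ _ _ _ _ (fun h => hS (by rw [h.2]; simp)), zero_comp]
  have h₄ : ∀ S', i ∉ S' → S = insert i S' →
      ∑ T : Finset (Fin r), homotopyEntry G Φ i hΦ K n (n - 1) S T ≫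
      Φ.map (entry G T U (coeff K (n - 1) n T U)) =
      homotopyEntry G Φ i hΦ K n (n - 1) S S' ≫
      Φ.map (entry G S' U (coeff K (n - 1) n S' U)) := fun S' hS' hS => by
    refine Finset.sum_eq_single _ (fun T _ hT => ?_) (by simp)
    rw [homotopyEntry_eq_zero _ _ _ _ _ _ _ (fun h => hT ?_), zero_comp]
    have := h.2
    rw [hS] at this
    have := congrArg (fun A => A.erase i) this
    simpa [Finset.erase_insert hS', Finset.erase_insert h.1] using this.symm
  -- The first sum needs `i ∉ U` and the second needs `i ∈ S`. If `i` lies in both or in neither of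
  -- `S` and `U`, a single sum survives and yields the identity matrix. If `i ∈ S` and `i ∉ U`, the
  -- two sums cancel. In the remaining case both are zero.
  by_cases hS : i ∈ S
  · obtain ⟨S, hS', rfl⟩ : ∃ S', i ∉ S' ∧ S = insert i S' :=
      ⟨S.erase i, by simp, (Finset.insert_erase hS).symm⟩
    rw [h₄ S hS' rfl]
    by_cases hU : i ∈ U
    · rw [h₂ hU, zero_add]
      split_ifs with hSU
      · subst hSU
        rw [homotopyEntry_comp_map_entry G Φ i hΦ K _ _ (by lia) hS' le_rfl, entry_self,
          coeff_insert _ _ (by lia) hS', Preadditive.comp_zsmul, Functor.map_zsmul,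
          Functor.map_zsmul, smul_smul, sgn_mul_self]
        simp
      · rw [coeff_eq_zero, entry_zero, Φ.map_zero, comp_zero]
        · rintro rfl
          exact hS' hU
        · rintro a ha rfl
          obtain rfl : i = a := by simpa [hS'] using hU
          exact hSU rfl
    · rw [h₁ hU, dif_neg (by rintro rfl; exact hU hS)]
      have := hΦ S hS' (K.X (n - (insert i S).card))
      -- Precomposition with the inverted restriction from `S` to `insert i S` removes the inverse
      -- from the homotopy. Both composites then become entries from `S` to `U`, and `sgn_coeff_add`
      -- applies.
      rw [← cancel_epi (Φ.map ((G.map (homOfLE (Finset.subset_insert i S))).app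
        (K.X (n - (insert i S).card)))), comp_zero, Preadditive.comp_add, ← Category.assoc,
        ← Category.assoc, ← Φ.map_comp]
      by_cases hSU : S ≤ U
      · have h₅ := map_entry_comp_homotopyEntry G Φ i hΦ K n (n - 1) (by lia) le_rfl hS' (𝟙 _)
        rw [entry_of_le G (Finset.subset_insert i S), CategoryTheory.Functor.map_id,
          Category.id_comp, Category.id_comp, entry_self] at h₅
        rw [h₅, res_comp_entry (Finset.subset_insert i S) (Finset.insert_subset_insert i hSU),
          map_entry_comp_homotopyEntry G Φ i hΦ K _ _ rfl hSU hU, Preadditive.zsmul_comp,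
          ← Φ.map_comp, map_comp_entry, entry_of_le G hSU, entry_of_le G hSU,
          ← Functor.map_zsmul, ← Functor.map_zsmul, ← Functor.map_add,
          ← Preadditive.zsmul_comp, ← Preadditive.zsmul_comp, ← Preadditive.add_comp,
          ← Functor.map_zsmul, ← Functor.map_zsmul, ← Functor.map_add,
          sgn_coeff_add i K n hS' hU]
        simp
      · rw [coeff_of_not_le _ _ hSU, coeff_of_not_le, entry_zero, entry_zero]
        · simp
        · intro h
          refine hSU fun j hj => ?_
          have := h (Finset.mem_insert_of_mem hj)
          rw [Finset.mem_insert] at this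
          exact this.resolve_left (by rintro rfl; exact hS' hj)
  · rw [h₃ hS, add_zero]
    by_cases hU : i ∈ U
    · rw [h₂ hU, dif_neg (by rintro rfl; exact hS hU)]
    · rw [h₁ hU]
      split_ifs with hSU
      · subst hSU
        rw [map_entry_comp_homotopyEntry G Φ i hΦ K _ _ rfl le_rfl hS, coeff_insert _ _ rfl hS,
          Preadditive.zsmul_comp, entry_self, Functor.map_zsmul, Functor.map_zsmul, smul_smul,
          sgn_mul_self]
        simp
      · rw [coeff_eq_zero, entry_zero, Φ.map_zero, zero_comp]
        · rintro rfl
          simp at hS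
        · intro a ha h
          obtain rfl : i = a := by
            have : i ∈ insert a S := h ▸ Finset.mem_insert_self i U
            simpa [hS] using this
          exact hSU (by rw [← Finset.erase_insert hU, h, Finset.erase_insert hS])

lemma map_dTerm_comp_homotopyMap_add (n : ℤ) :
    Φ.map (dTerm G Finset.univ K n (n + 1)) ≫ homotopyMap G Φ i hΦ K (n + 1) n +
      homotopyMap G Φ i hΦ K n (n - 1) ≫ Φ.map (dTerm G Finset.univ K (n - 1) n) = 𝟙 _ := by
  refine map_biproduct_hom_ext Φ fun S U => ?_
  have h₁ := map_dTerm_comp_homotopyMap G Φ i hΦ K n (n + 1) n S U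
  have h₂ := homotopyMap_comp_map_dTerm G Φ i hΦ K n (n - 1) n S U
  have h₃ := sum_homotopyEntry G Φ i hΦ K n S.1 U.1
  rw [← h₁, ← h₂] at h₃
  rw [Preadditive.add_comp, Preadditive.comp_add, h₃, Category.id_comp, map_biproduct_ι_π]
  simp only [Subtype.ext_iff]

lemma homotopyMap_eq_zero (n m : ℤ) (h : m + 1 ≠ n) : homotopyMap G Φ i hΦ K n m = 0 :=
  Finset.sum_eq_zero fun S _ => Finset.sum_eq_zero fun T _ => by
    rw [homotopyEntry, dif_neg (fun h' => h h'.2.2), zero_comp, comp_zero]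

/-- If `Φ` inverts the maps `G_S ⟶ G_{S ∪ {i}}`, then the image under `Φ` of the total complex
over all subsets is contractible. -/
noncomputable def homotopyIdZero (h𝒰) : Homotopy
    (𝟙 ((Φ.mapHomologicalComplex (ComplexShape.up ℤ)).obj (cplx G Finset.univ h𝒰 K))) 0 where
  hom n m := homotopyMap G Φ i hΦ K n m
  zero n m hnm := homotopyMap_eq_zero G Φ i hΦ K n m hnm
  comm n := by
    refine ((map_dTerm_comp_homotopyMap_add G Φ i hΦ K n).symm.trans ?_).trans (add_zero _).symm
    let L := (Φ.mapHomologicalComplex (ComplexShape.up ℤ)).obj (cplx G Finset.univ h𝒰 K)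
    exact congrArg₂ (· + ·) (dNext_eq (C := L) (D := L) (i' := n + 1) _ rfl).symm
      (prevD_eq (C := L) (D := L) (j' := n - 1) (j := n) _ (sub_add_cancel n 1)).symm

end Contraction

/-! ### Dévissage of total complexes and the triangle obtained by splitting off the empty index. -/

section Devissage

open DerivedCategory Pretriangulated

variable [HasDerivedCategory C] [∀ S, (G.obj S).Additive]

lemma isZero_cplx_empty (h𝒰) (K : CochainComplex C ℤ) : IsZero (cplx G ∅ h𝒰 K) := by
  rw [IsZero.iff_id_eq_zero]
  ext n : 1
  exact biproduct.hom_ext (f := fun S : (∅ : Finset (Finset (Fin r))) =>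
    (G.obj S.1).obj (K.X (n - S.1.card))) _ _ fun S => absurd S.2 (Finset.notMem_empty _)

/-- A triangulated subcategory which contains `G_S(K)` for all `S ∈ 𝒰` contains their total
complex. -/
lemma prop_Q_cplx (P : ObjectProperty (DerivedCategory C)) [P.IsTriangulated]
    [P.IsClosedUnderIsomorphisms] (K : CochainComplex C ℤ) (𝒰 : Finset (Finset (Fin r)))
    (h𝒰 : (𝒰 : Set (Finset (Fin r))).OrdConnected)
    (h : ∀ S ∈ 𝒰, P (Q.obj (((G.obj S).mapHomologicalComplex (ComplexShape.up ℤ)).obj K))) :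
    P (Q.obj (cplx G 𝒰 h𝒰 K)) := by
  induction hN : 𝒰.card generalizing 𝒰 with
  | zero =>
    obtain rfl : 𝒰 = ∅ := Finset.card_eq_zero.1 hN
    exact P.prop_of_isZero (Q.map_isZero (isZero_cplx_empty G h𝒰 K))
  | succ N ih =>
    -- The summand of a minimal index is a quotient complex, since no differential enters it from
    -- other summands; removing it keeps the index set convex.
    obtain ⟨S₀, h₀, hS₀⟩ := 𝒰.exists_minimal (Finset.card_pos.1 (by omega))
    have hS₀' : ∀ S ∈ 𝒰, S ≤ S₀ → S = S₀ := fun S hS h => le_antisymm h (hS₀ hS h)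
    refine P.ext_of_isTriangulatedClosed₂ _
      (triangleOfSES_distinguished (ses_shortExact G h₀ K h𝒰 hS₀')) ?_ ?_
    · exact ih _ (ordConnected_erase h𝒰 hS₀') (fun S hS => h S (Finset.mem_of_mem_erase hS))
        (by rw [Finset.card_erase_of_mem h₀]; omega)
    · exact P.prop_of_iso ((Q.commShiftIso _).app _).symm
        (P.le_shift (-(S₀.card : ℤ)) _ (h S₀ h₀))

lemma erase_empty_eq : (Finset.univ : Finset (Finset (Fin r))).erase ∅ =
    Finset.univ.filter Finset.Nonempty := by
  ext S
  simp [Finset.nonempty_iff_ne_empty]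

lemma eq_empty_of_le : ∀ S ∈ (Finset.univ : Finset (Finset (Fin r))), S ≤ ∅ → S = ∅ :=
  fun _ _ h => Finset.subset_empty.1 h

/-- Replacing the set of indices by an equal one. -/
noncomputable def functorCongr {𝒰 𝒱 : Finset (Finset (Fin r))} (h : 𝒰 = 𝒱)
    (h𝒰 : (𝒰 : Set (Finset (Fin r))).OrdConnected) (h𝒱 : (𝒱 : Set (Finset (Fin r))).OrdConnected) :
    functor G 𝒰 h𝒰 ≅ functor G 𝒱 h𝒱 :=
  eqToIso (by subst h; rfl)

variable {G} (ρ : 𝟭 C ≅ G.obj ∅)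

/-- The part of the total complex with index `∅`, if `G_∅` is isomorphic to the identity. -/
noncomputable def baseIso : 𝟭 (CochainComplex C ℤ) ≅
    (G.obj ∅).mapHomologicalComplex (ComplexShape.up ℤ) ⋙
      shiftFunctor (CochainComplex C ℤ) (-((∅ : Finset (Fin r)).card : ℤ)) :=
  (Functor.mapHomologicalComplexIdIso C (ComplexShape.up ℤ)).symm ≪≫
    NatIso.mapHomologicalComplex ρ _ ≪≫ (Functor.rightUnitor _).symm ≪≫
    Functor.isoWhiskerLeft _ (shiftFunctorZero' (CochainComplex C ℤ) _ (by simp)).symm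

variable (G) in
/-- The connecting morphism of the short exact sequence given by the index `∅`. -/
noncomputable def connecting : ((G.obj ∅).mapHomologicalComplex (ComplexShape.up ℤ) ⋙
      shiftFunctor (CochainComplex C ℤ) (-((∅ : Finset (Fin r)).card : ℤ))) ⋙ Q ⟶
    functor G _ (ordConnected_erase ordConnected_univ eq_empty_of_le) ⋙ Q ⋙
      shiftFunctor _ (1 : ℤ) where
  app K := triangleOfSESδ (ses_shortExact G (Finset.mem_univ ∅) K ordConnected_univ eq_empty_of_le)
  naturality K L f := (triangleOfSESδ_naturality
      (ses_shortExact G (Finset.mem_univ ∅) K ordConnected_univ eq_empty_of_le)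
      (ses_shortExact G (Finset.mem_univ ∅) L ordConnected_univ eq_empty_of_le)
      (sesMap G (Finset.mem_univ ∅) ordConnected_univ eq_empty_of_le f)).symm

/-- The connecting morphism from a complex to the total complex over the nonempty subsets. -/
noncomputable def toTail : Q ⟶ functor G _ ordConnected_nonempty ⋙ Q ⋙ shiftFunctor _ (1 : ℤ) :=
  Functor.whiskerRight (baseIso ρ).hom Q ≫ connecting G ≫
    Functor.whiskerRight (functorCongr G erase_empty_eq _ _).hom (Q ⋙ shiftFunctor _ (1 : ℤ))

/-- Transport along isomorphisms keeps the middle morphism explicit, which is the one that has to be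
recognized as a natural transformation; the other two remain existential. -/
lemma distinguished_of_iso₂₃ (T : Triangle (DerivedCategory C)) (hT : T ∈ distTriang _)
    {X Y : DerivedCategory C} (e₂ : X ≅ T.obj₂) (e₃ : T.obj₃ ≅ Y) :
    ∃ (a : T.obj₁ ⟶ X) (c : _ ⟶ _),
      Triangle.mk a (e₂.hom ≫ T.mor₂ ≫ e₃.hom) c ∈ distTriang (DerivedCategory C) :=
  ⟨T.mor₁ ≫ e₂.inv, e₃.inv ≫ T.mor₃, isomorphic_distinguished _ hT _
    (Triangle.isoMk _ _ (Iso.refl _) e₂ e₃.symm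
      ((Category.assoc ..).trans ((congrArg (T.mor₁ ≫ ·) e₂.inv_hom_id).trans
        ((Category.comp_id _).trans (Category.id_comp _).symm)))
      (by
        change (e₂.hom ≫ T.mor₂ ≫ e₃.hom) ≫ e₃.inv = e₂.hom ≫ T.mor₂
        rw [Category.assoc, Category.assoc, e₃.hom_inv_id]
        exact congrArg (e₂.hom ≫ ·) (Category.comp_id _))
      ((congrArg ((e₃.inv ≫ T.mor₃) ≫ ·)
        ((shiftFunctor (DerivedCategory C) (1 : ℤ)).map_id _)).trans (Category.comp_id _)))⟩

/-- The index `∅` contributes `K` itself as a quotient of the full total complex, with the total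
complex over nonempty subsets as kernel. Rotating the triangle of this short exact sequence makes
the connecting morphism the middle map. -/
lemma exists_triangle_toTail (K : CochainComplex C ℤ) :
    ∃ (a : Q.obj (cplx G Finset.univ ordConnected_univ K) ⟶ Q.obj K) (c : _ ⟶ _),
      Triangle.mk a ((toTail ρ).app K) c ∈ distTriang (DerivedCategory C) :=
  distinguished_of_iso₂₃ _ (rot_of_distTriang _ (triangleOfSES_distinguished
    (ses_shortExact G (Finset.mem_univ ∅) K ordConnected_univ eq_empty_of_le)))
    (Q.mapIso ((baseIso ρ).app K)) ((shiftFunctor _ (1 : ℤ)).mapIso (Q.mapIso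
      ((functorCongr G erase_empty_eq
    (ordConnected_erase ordConnected_univ eq_empty_of_le) ordConnected_nonempty).app K)))

end Devissage

end CechTotal

/-! ### Exact functors and natural transformations on derived categories. -/

section Homology

open DerivedCategory ZeroObject

variable {C C' : Type*} [Category* C] [Abelian C] [HasDerivedCategory C]
  [Category* C'] [Abelian C'] [HasDerivedCategory C']

lemma isZero_iff_isZero_homology (X : DerivedCategory C) :
    IsZero X ↔ ∀ n, IsZero ((homologyFunctor C n).obj X) := by
  refine ⟨fun h n => (homologyFunctor C n).map_isZero h, fun h => ?_⟩
  have h0 := isZero_zero (DerivedCategory C)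
  have : IsIso (0 : X ⟶ 0) := by
    rw [isIso_iff]
    exact fun n => (h n).isIso ((homologyFunctor C n).map_isZero h0) _
  exact h0.of_iso (asIso (0 : X ⟶ 0))

/-- Exact functors commute with the cohomology of complexes. -/
noncomputable def mapHomologicalComplexCompHomologyIso (Φ : C ⥤ C') [Φ.Additive]
    [Φ.PreservesHomology] (n : ℤ) :
    Φ.mapHomologicalComplex (ComplexShape.up ℤ) ⋙ HomologicalComplex.homologyFunctor C' _ n ≅
      HomologicalComplex.homologyFunctor C _ n ⋙ Φ :=
  NatIso.ofComponents (fun K => (K.sc n).mapHomologyIso Φ) fun f =>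
    ShortComplex.mapHomologyIso_hom_naturality
      ((HomologicalComplex.shortComplexFunctor C (ComplexShape.up ℤ) n).map f) Φ

/-- Exact functors commute with cohomology on derived categories. -/
noncomputable def mapDerivedCategoryCompHomologyIso (Φ : C ⥤ C') [Φ.Additive]
    [PreservesFiniteLimits Φ] [PreservesFiniteColimits Φ] (n : ℤ) :
    Φ.mapDerivedCategory ⋙ homologyFunctor C' n ≅ homologyFunctor C n ⋙ Φ :=
  letI : Localization.Lifting Q (HomologicalComplex.quasiIso C (ComplexShape.up ℤ))
      (Φ.mapHomologicalComplex _ ⋙ HomologicalComplex.homologyFunctor C' _ n)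
      (Φ.mapDerivedCategory ⋙ homologyFunctor C' n) :=
    ⟨(Functor.associator _ _ _).symm ≪≫ Functor.isoWhiskerRight Φ.mapDerivedCategoryFactors _ ≪≫
      Functor.associator _ _ _ ≪≫ Functor.isoWhiskerLeft _ (homologyFunctorFactors C' n)⟩
  letI : Localization.Lifting Q (HomologicalComplex.quasiIso C (ComplexShape.up ℤ))
      (HomologicalComplex.homologyFunctor C _ n ⋙ Φ) (homologyFunctor C n ⋙ Φ) :=
    ⟨(Functor.associator _ _ _).symm ≪≫ Functor.isoWhiskerRight (homologyFunctorFactors C n) _⟩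
  Localization.liftNatIso Q (HomologicalComplex.quasiIso C (ComplexShape.up ℤ)) _ _ _ _
    (mapHomologicalComplexCompHomologyIso Φ n)

lemma isZero_mapDerivedCategory_obj_iff (Φ : C ⥤ C') [Φ.Additive] [PreservesFiniteLimits Φ]
    [PreservesFiniteColimits Φ] (X : DerivedCategory C) :
    IsZero (Φ.mapDerivedCategory.obj X) ↔
      ∀ n, IsZero (Φ.obj ((homologyFunctor C n).obj X)) := by
  rw [isZero_iff_isZero_homology]
  exact forall_congr' fun n =>
    ((mapDerivedCategoryCompHomologyIso Φ n).app X).isZero_iff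

/-- The natural transformation of functors on derived categories induced by a natural
transformation from the identity to an exact functor. -/
noncomputable def mapDerivedCategoryUnit (Φ : C ⥤ C) [Φ.Additive] [PreservesFiniteLimits Φ]
    [PreservesFiniteColimits Φ] (τ : 𝟭 C ⟶ Φ) : 𝟭 (DerivedCategory C) ⟶ Φ.mapDerivedCategory :=
  letI : Localization.Lifting Q (HomologicalComplex.quasiIso C (ComplexShape.up ℤ))
    ((𝟭 C).mapHomologicalComplex (ComplexShape.up ℤ) ⋙ Q) (𝟭 (DerivedCategory C)) :=
    ⟨Functor.rightUnitor _ ≪≫ (Functor.leftUnitor _).symm ≪≫ Functor.isoWhiskerRight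
      (Functor.mapHomologicalComplexIdIso C (ComplexShape.up ℤ)).symm Q⟩
  Localization.liftNatTrans Q (HomologicalComplex.quasiIso C (ComplexShape.up ℤ))
    ((𝟭 C).mapHomologicalComplex (ComplexShape.up ℤ) ⋙ Q) (Φ.mapHomologicalComplex _ ⋙ Q) _ _
    (Functor.whiskerRight (NatTrans.mapHomologicalComplex τ _) Q)

/-- On the image of a complex the transformation is, up to the canonical isomorphisms, `τ` applied
termwise. -/
lemma isIso_mapDerivedCategoryUnit_app_Q_obj (Φ : C ⥤ C) [Φ.Additive] [PreservesFiniteLimits Φ]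
    [PreservesFiniteColimits Φ] (τ : 𝟭 C ⟶ Φ) (K : CochainComplex C ℤ)
    (h : ∀ n, IsIso (τ.app (K.X n))) : IsIso ((mapDerivedCategoryUnit Φ τ).app (Q.obj K)) := by
  have : IsIso ((NatTrans.mapHomologicalComplex τ (ComplexShape.up ℤ)).app K) := by
    have : ∀ n, IsIso (((NatTrans.mapHomologicalComplex τ (ComplexShape.up ℤ)).app K).f n) := h
    exact HomologicalComplex.Hom.isIso_of_components _
  rw [mapDerivedCategoryUnit, Localization.liftNatTrans_app]
  have : IsIso ((Functor.whiskerRight (NatTrans.mapHomologicalComplex τ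
    (ComplexShape.up ℤ)) Q).app K) :=
    inferInstanceAs (IsIso (Q.map _))
  infer_instance

/-- An object on which a natural transformation `1 ⟶ Λ` is invertible is right orthogonal to the
objects killed by `Λ`. -/
lemma eq_zero_of_isIso_unit {D : Type*} [Category* D] [HasZeroMorphisms D] {Λ : D ⥤ D}
    (τ : 𝟭 D ⟶ Λ) {X L : D} (hX : IsZero (Λ.obj X)) (hL : IsIso (τ.app L)) (g : X ⟶ L) : g = 0 := by
  have h₁ := τ.naturality g
  have h₂ := τ.naturality (0 : X ⟶ L)
  have : Λ.map g = Λ.map 0 := hX.eq_of_src _ _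
  rw [this, ← h₂] at h₁
  exact (cancel_mono (τ.app L)).1 h₁

end Homology

/-! ### Localizations of graded modules at homogeneous elements. -/

namespace GrMod

variable {A : Type u} [CommRing A] {𝒜 : ℤ → AddSubgroup A}

lemma isIso_of_bijective {M N : GrMod 𝒜} (f : M ⟶ N) (hf : Function.Bijective f.lin) : IsIso f :=
  have := mono_of_injective f hf.1
  have := epi_of_surjective f hf.2
  isIso_of_mono_of_epi f

lemma bijective_of_isIso {M N : GrMod 𝒜} (f : M ⟶ N) [IsIso f] : Function.Bijective f.lin :=
  ⟨injective_of_mono f, surjective_of_epi f⟩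

lemma isZero_iff (M : GrMod 𝒜) : IsZero M ↔ ∀ x : M, x = 0 := by
  rw [IsZero.iff_id_eq_zero]
  exact ⟨fun h x => LinearMap.congr_fun (congrArg Hom.lin h) x, fun h => hom_ext h⟩

variable [GradedRing 𝒜]

section

variable {a : A} {e : ℤ} (ha : a ∈ 𝒜 e)

instance : PreservesFiniteLimits (loc ha) :=
  (((loc ha).exact_tfae.out 0 3 rfl rfl).1 (loc_shortExact ha)).1

instance : PreservesFiniteColimits (loc ha) :=
  (((loc ha).exact_tfae.out 0 3 rfl rfl).1 (loc_shortExact ha)).2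

lemma isZero_loc_obj_iff (M : GrMod 𝒜) :
    IsZero ((loc ha).obj M) ↔ ∀ x : M, ∃ m : ℕ, a ^ m • x = 0 := by
  rw [isZero_iff]
  constructor
  · exact fun h x => (frac_eq_zero_iff a x 0).1 (h _)
  · intro h z
    obtain ⟨x, k, rfl⟩ := exists_frac a z
    exact (frac_eq_zero_iff a x k).2 (h x)

/-- The canonical map `M ⟶ M_a`. -/
noncomputable def toLoc : 𝟭 (GrMod 𝒜) ⟶ loc ha where
  app M :=
    { lin :=
        { toFun x := frac a x 0
          map_add' x y := frac_add a x y 0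
          map_smul' b x := (smul_frac a b x 0).symm }
      map_mem n x hx := ⟨x, 0, by simpa using hx, rfl⟩ }
  naturality M N f := hom_ext fun x => (locMap_frac ha f x 0).symm

lemma isIso_toLoc_app (M : GrMod 𝒜) (h : Function.Bijective fun x : M => a • x) :
    IsIso ((toLoc ha).app M) := by
  have hk (k : ℕ) : Function.Bijective fun x : M => a ^ k • x := by
    induction k with
    | zero => exact (funext fun x => by simp : (fun x : M => a ^ 0 • x) = id) ▸ Function.bijective_id
    | succ k ih =>
      have : (fun x : M => a ^ (k + 1) • x) = (fun x => a ^ k • x) ∘ fun x => a • x :=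
        funext fun x => by rw [pow_succ, mul_smul]; rfl
      exact this ▸ ih.comp h
  refine isIso_of_bijective _ ⟨?_, fun z => ?_⟩
  · rw [injective_iff_map_eq_zero]
    intro x hx
    obtain ⟨m, hm⟩ := (frac_eq_zero_iff a x 0).1 hx
    exact (hk m).1 (by simpa using hm)
  · obtain ⟨x, k, rfl⟩ := exists_frac a z
    obtain ⟨y, rfl⟩ := (hk k).2 x
    refine ⟨y, (frac_scale a y 0 k).symm.trans ?_⟩
    rw [zero_add]

lemma bijective_smul_loc (M : GrMod 𝒜) : Function.Bijective fun x : (loc ha).obj M => a • x := by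
  constructor
  · intro x y h
    obtain ⟨z, k, hz⟩ := exists_frac a (x - y : LocalizedModule (Submonoid.powers a) M)
    have h' : a • (frac a z k : LocalizedModule (Submonoid.powers a) M) = 0 := by
      rw [hz]
      exact (smul_sub a x y).trans (sub_eq_zero.2 h)
    rw [smul_frac, frac_eq_zero_iff] at h'
    obtain ⟨m, hm⟩ := h'
    have : (frac a z k : LocalizedModule (Submonoid.powers a) M) = 0 :=
      (frac_eq_zero_iff a z k).2 ⟨m + 1, by rw [pow_succ, mul_smul, hm]⟩
    exact sub_eq_zero.1 (hz.symm.trans this)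
  · intro z
    obtain ⟨x, k, rfl⟩ := exists_frac a z
    refine ⟨frac a x (k + 1), (smul_frac a a x _).trans ?_⟩
    simpa using frac_scale a x k 1

end

section Koszul

variable {r : ℕ} {f : Fin r → A} {d : Fin r → ℤ} (hf : ∀ i, f i ∈ 𝒜 (d i))

/-- Passing from M_{f_S} to M_{f_{S ∪ {i}}} only inverts `f i`, which is already invertible after
localizing at `f i`. This is the hypothesis needed for the contraction. -/
lemma isIso_loc_map_prodRes {S : Finset (Fin r)} {i : Fin r} (hi : i ∉ S) (M : GrMod 𝒜) :
    IsIso ((loc (hf i)).map (((locSystem hf).map (homOfLE (Finset.subset_insert i S))).app M)) := by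
  have hsd : insert i S \ S = {i} := by
    ext x; simp only [Finset.mem_sdiff, Finset.mem_insert, Finset.mem_singleton]; grind
  have key (x : M) (k l : ℕ) : ((loc (hf i)).map (((locSystem hf).map
      (homOfLE (Finset.subset_insert i S))).app M)).lin
        (frac (f i) (frac (∏ i ∈ S, f i) x k : (loc (prod_mem hf S)).obj M) l) =
      frac (f i) (frac (∏ i ∈ insert i S, f i) (f i ^ k • x) k :
        (loc (prod_mem hf (insert i S))).obj M) l := by
    refine (locMap_frac (hf i) _ _ l).trans (congrArg (fun z => frac (f i) z l) ?_)
    refine (prodRes_frac hf (Finset.subset_insert i S) M x k).trans ?_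
    rw [hsd, Finset.prod_singleton]
  refine isIso_of_bijective _ ⟨?_, fun z => ?_⟩
  · rw [injective_iff_map_eq_zero]
    intro z hz
    obtain ⟨y, l, rfl⟩ := exists_frac (f i) z
    obtain ⟨x, k, rfl⟩ := exists_frac (∏ i ∈ S, f i) y
    have hz' := (key x k l).symm.trans hz
    obtain ⟨m, hm⟩ := (frac_eq_zero_iff (f i) _ l).1 hz'
    have hm' := (smul_frac (∏ i ∈ insert i S, f i) (f i ^ m) (f i ^ k • x) k).symm.trans hm
    obtain ⟨p, hp⟩ := (frac_eq_zero_iff _ _ _).1 hm'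
    refine (frac_eq_zero_iff (f i) _ l).2 ⟨p + m + k, ?_⟩
    refine (smul_frac (∏ i ∈ S, f i) _ x k).trans ((frac_eq_zero_iff _ _ _).2 ⟨p, ?_⟩)
    rw [Finset.prod_insert hi] at hp
    rw [← hp]
    simp only [smul_smul]
    congr 1
    ring
  · obtain ⟨y, l, rfl⟩ := exists_frac (f i) z
    obtain ⟨x, k, rfl⟩ := exists_frac (∏ i ∈ insert i S, f i) y
    -- Restriction multiplies the numerator by `f i ^ k`, so the outer denominator is raised by `k`.
    refine ⟨frac (f i) (frac (∏ i ∈ S, f i) x k : (loc (prod_mem hf S)).obj M) (l + k),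
      (key x k (l + k)).trans ?_⟩
    refine (congrArg (fun z => frac (f i) z (l + k)) (smul_frac _ _ x k).symm).trans ?_
    exact frac_scale (f i) _ l k

/-- The module `M_{f_∅}` is `M`. -/
noncomputable def locEmptyIso : 𝟭 (GrMod 𝒜) ≅ (locSystem hf).obj ∅ :=
  haveI : ∀ M, IsIso ((toLoc (prod_mem hf ∅)).app M) := fun M =>
    isIso_toLoc_app _ M ((funext fun x => by simp :
      (fun x : M => (∏ i ∈ (∅ : Finset (Fin r)), f i) • x) = id) ▸ Function.bijective_id)
  haveI := NatIso.isIso_of_isIso_app (toLoc (prod_mem hf ∅))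
  (asIso (toLoc (prod_mem hf ∅)) : 𝟭 _ ≅ loc (prod_mem hf ∅))

variable (hspan : Ideal.span (Set.range f) = idealPos 𝒜)

include hspan in
-- The elements having a power that kills `x` form the radical of the annihilator of `x`. This is an
-- ideal, so generators suffice.
lemma isPosTorsion_iff (M : GrMod 𝒜) :
    isPosTorsion 𝒜 M ↔ ∀ i, ∀ x : M, ∃ m : ℕ, f i ^ m • x = 0 := by
  constructor
  · intro h i x
    obtain ⟨n, -, hn⟩ := h x (f i) (hspan ▸ Ideal.subset_span ⟨i, rfl⟩)
    exact ⟨n, hn⟩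
  · intro h x a ha
    have : idealPos 𝒜 ≤ Ideal.radical (LinearMap.ker (LinearMap.toSpanSingleton A M x)) := by
      rw [← hspan, Ideal.span_le]
      rintro _ ⟨i, rfl⟩
      obtain ⟨m, hm⟩ := h i x
      exact ⟨m, hm⟩
    obtain ⟨n, hn⟩ := this ha
    -- Membership in the radical allows exponent `0`, whereas torsion asks for a positive one.
    refine ⟨n + 1, by omega, ?_⟩
    rw [pow_succ', mul_smul]
    exact (congrArg (a • ·) hn).trans (smul_zero a)

end Koszul

end GrMod

/-! ### The kernel of φ^*, its right orthogonal, and the triangle RΓ(M) → M → Č(M) →. -/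

section

open GrMod DerivedCategory

variable {A : Type u} [CommRing A] (𝒜 : ℤ → AddSubgroup A)
   [HasDerivedCategory (GrMod 𝒜)] [HasDerivedCategory (QGr 𝒜)]

lemma isZero_quot_obj_iff (M : GrMod 𝒜) : IsZero ((QGr.quot 𝒜).obj M) ↔ isPosTorsion 𝒜 M :=
  ObjectProperty.SerreClassLocalization.isZero_obj_iff _ _ _

lemma isZero_phiStar_obj_iff (X : DerivedCategory (GrMod 𝒜)) :
    IsZero ((phiStar 𝒜).obj X) ↔ ∀ n, isPosTorsion 𝒜 ((homologyFunctor _ n).obj X) := by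
  rw [isZero_mapDerivedCategory_obj_iff]
  exact forall_congr' fun n => isZero_quot_obj_iff 𝒜 _

variable {𝒜} [GradedRing 𝒜] {r : ℕ} {f : Fin r → A} {d : Fin r → ℤ} (hf : ∀ i, f i ∈ 𝒜 (d i))
  (hspan : Ideal.span (Set.range f) = idealPos 𝒜)

include hspan in
lemma isZero_phiStar_obj_of_loc (X : DerivedCategory (GrMod 𝒜))
    (h : ∀ i, IsZero ((loc (hf i)).mapDerivedCategory.obj X)) : IsZero ((phiStar 𝒜).obj X) := by
  rw [isZero_phiStar_obj_iff]
  intro n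
  rw [isPosTorsion_iff hspan]
  intro i
  exact (isZero_loc_obj_iff (hf i) _).1 ((isZero_mapDerivedCategory_obj_iff _ _).1 (h i) n)

include hspan in
-- For each `i`, localization at `f i` makes the full total complex contractible, so its cohomology
-- is torsion with respect to every generator.
lemma isZero_phiStar_cplx_univ (K : CochainComplex (GrMod 𝒜) ℤ) (h𝒰) :
    IsZero ((phiStar 𝒜).obj (Q.obj (CechTotal.cplx (locSystem hf) Finset.univ h𝒰 K))) := by
  refine isZero_phiStar_obj_of_loc hf hspan _ fun i => ?_
  refine IsZero.of_iso ?_ ((loc (hf i)).mapDerivedCategoryFactors.app _)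
  have := Q_map_eq_of_homotopy _ (CechTotal.homotopyIdZero (locSystem hf) (loc (hf i)) i
    (fun S hS M => isIso_loc_map_prodRes hf hS M) K h𝒰)
  rw [CategoryTheory.Functor.map_id, CategoryTheory.Functor.map_zero] at this
  exact (IsZero.iff_id_eq_zero _).2 this

include hspan in
-- The product f_S acts invertibly on the target, so a map into it is determined by its localization
-- at f_S. The localization of a source with torsion cohomology is zero.
lemma rightOrthogonal_Q_obj_loc {S : Finset (Fin r)} (hS : S.Nonempty)
    (K : CochainComplex (GrMod 𝒜) ℤ) : (kerProp (phiStar 𝒜)).rightOrthogonal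
      (Q.obj ((((locSystem hf).obj S).mapHomologicalComplex (ComplexShape.up ℤ)).obj K)) := by
  intro X g hX
  have hS' := prod_mem hf S
  refine eq_zero_of_isIso_unit (mapDerivedCategoryUnit (loc hS') (toLoc hS')) ?_
    (isIso_mapDerivedCategoryUnit_app_Q_obj _ _ _ fun n =>
      isIso_toLoc_app _ _ (bijective_smul_loc hS' _)) g
  rw [isZero_mapDerivedCategory_obj_iff]
  intro n
  rw [isZero_loc_obj_iff]
  intro x
  obtain ⟨i, hi⟩ := hS
  -- Nonemptiness of `S` is what puts the product in I⁺.
  obtain ⟨m, -, hm⟩ := (isZero_phiStar_obj_iff 𝒜 X).1 hX n x (∏ i ∈ S, f i) (by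
    rw [← Finset.mul_prod_erase _ _ hi]
    exact Ideal.mul_mem_right _ _ (hspan ▸ Ideal.subset_span ⟨i, rfl⟩))
  exact ⟨m, hm⟩

include hspan in
-- The right orthogonal of a triangulated subcategory is triangulated, so dévissage reduces to the
-- individual localizations.
lemma rightOrthogonal_cplx_nonempty (K : CochainComplex (GrMod 𝒜) ℤ) (h𝒰) :
    (kerProp (phiStar 𝒜)).rightOrthogonal
      (Q.obj (CechTotal.cplx (locSystem hf) (Finset.univ.filter Finset.Nonempty) h𝒰 K)) :=
  CechTotal.prop_Q_cplx _ _ K _ _ fun _ hS =>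
    rightOrthogonal_Q_obj_loc hf hspan (Finset.mem_filter.1 hS).2 K

/-- The isomorphism expressing the Čech functor in terms of complexes. -/
noncomputable def cechFac : Q ⋙ cech hf ≅ CechTotal.functor (locSystem hf)
      (Finset.univ.filter Finset.Nonempty) CechTotal.ordConnected_nonempty ⋙ Q ⋙
      shiftFunctor _ (1 : ℤ) :=
  (Functor.associator _ _ _).symm ≪≫ Functor.isoWhiskerRight (Localization.fac _ _ _) _ ≪≫
    Functor.associator _ _ _

noncomputable instance : Localization.Lifting Q
    (HomologicalComplex.quasiIso (GrMod 𝒜) (ComplexShape.up ℤ))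
    (CechTotal.functor (locSystem hf)
      (Finset.univ.filter Finset.Nonempty) CechTotal.ordConnected_nonempty ⋙ Q ⋙
      shiftFunctor _ (1 : ℤ)) (cech hf) := ⟨cechFac hf⟩

include hspan in
lemma rightOrthogonal_cech_obj (X : DerivedCategory (GrMod 𝒜)) :
    (kerProp (phiStar 𝒜)).rightOrthogonal ((cech hf).obj X) :=
  ObjectProperty.prop_of_iso _ (((cechFac hf).app _).symm ≪≫
    (cech hf).mapIso (Q.objObjPreimageIso X))
    (ObjectProperty.le_shift _ (1 : ℤ) _ (rightOrthogonal_cplx_nonempty hf hspan _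
      CechTotal.ordConnected_nonempty))

/-- The natural transformation `M ⟶ Č(M)`. -/
noncomputable def cechUnit : 𝟭 (DerivedCategory (GrMod 𝒜)) ⟶ cech hf :=
  Localization.liftNatTrans Q (HomologicalComplex.quasiIso (GrMod 𝒜) (ComplexShape.up ℤ))
    Q (CechTotal.functor (locSystem hf)
      (Finset.univ.filter Finset.Nonempty) CechTotal.ordConnected_nonempty ⋙ Q ⋙
      shiftFunctor _ (1 : ℤ)) _ _ (CechTotal.toTail (locEmptyIso hf))

open Pretriangulated in
/-- The triangle `RΓ(M) ⟶ M ⟶ Č(M) ⟶`. -/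
lemma exists_triangle_cechUnit (X : DerivedCategory (GrMod 𝒜)) :
    ∃ (K : CochainComplex (GrMod 𝒜) ℤ)
      (_ : (RGamma hf).obj X ≅ Q.obj ((CechTotal.functor (locSystem hf) Finset.univ
        CechTotal.ordConnected_univ).obj K))
      (a : Q.obj ((CechTotal.functor (locSystem hf) Finset.univ
        CechTotal.ordConnected_univ).obj K) ⟶ X) (c : _ ⟶ _),
      Triangle.mk a ((cechUnit hf).app X) c ∈ distTriang (DerivedCategory (GrMod 𝒜)) := by
  let K := Q.objPreimage X
  let e := Q.objObjPreimageIso X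
  obtain ⟨a, c, h⟩ := CechTotal.exists_triangle_toTail (locEmptyIso hf) K
  -- The unit is known explicitly only on images of complexes; naturality along `e` transports it to
  -- `X`.
  have h₁ : (cechUnit hf).app X = e.inv ≫ (CechTotal.toTail (locEmptyIso hf)).app K ≫
      ((cechFac hf).inv.app K ≫ (cech hf).map e.hom) := by
    have h₂ := (cechUnit hf).naturality e.hom
    have h₃ := Localization.liftNatTrans_app Q
      (HomologicalComplex.quasiIso (GrMod 𝒜) (ComplexShape.up ℤ)) Q (CechTotal.functor
        (locSystem hf) (Finset.univ.filter Finset.Nonempty) CechTotal.ordConnected_nonempty ⋙ Q ⋙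
      shiftFunctor _ (1 : ℤ)) (𝟭 _) (cech hf) (CechTotal.toTail (locEmptyIso hf)) K
    refine (Iso.eq_inv_comp e).2 (h₂.trans ((congrArg (· ≫ (cech hf).map e.hom) h₃).trans ?_))
    exact (congrArg (· ≫ (cech hf).map e.hom) (Category.id_comp _)).trans (Category.assoc ..)
  obtain ⟨a', c', h'⟩ := CechTotal.distinguished_of_iso₂₃ _ h e.symm
    ((cechFac hf).symm.app K ≪≫ (cech hf).mapIso e)
  refine ⟨K, (RGamma hf).mapIso e.symm ≪≫ (Localization.fac _ _ _).app K, a', c', ?_⟩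
  rw [h₁]
  exact h'

end

section Homology

open DerivedCategory

variable {C C' : Type*} [Category* C] [Abelian C] [HasDerivedCategory C]
  [Category* C'] [Abelian C'] [HasDerivedCategory C']

lemma isIso_map_homologyFunctor_map (Φ : C ⥤ C') [Φ.Additive]
    [PreservesFiniteLimits Φ] [PreservesFiniteColimits Φ] (n : ℤ) {X Y : DerivedCategory C}
    (f : X ⟶ Y) (hf : IsIso (Φ.mapDerivedCategory.map f)) :
    IsIso (Φ.map ((homologyFunctor C n).map f)) :=
  (NatIso.isIso_map_iff (mapDerivedCategoryCompHomologyIso Φ n) f).1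
    (inferInstanceAs (IsIso ((homologyFunctor C' n).map (Φ.mapDerivedCategory.map f))))

lemma isIso_mapDerivedCategory_map_Q_map_iff (Φ : C ⥤ C') [Φ.Additive]
    [PreservesFiniteLimits Φ] [PreservesFiniteColimits Φ] {K L : CochainComplex C ℤ}
    (f : K ⟶ L) : IsIso (Φ.mapDerivedCategory.map (Q.map f)) ↔
      QuasiIso ((Φ.mapHomologicalComplex (ComplexShape.up ℤ)).map f) :=
  (NatIso.isIso_map_iff Φ.mapDerivedCategoryFactors f).trans (isIso_Q_map_iff_quasiIso _ _)

end Homology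

/-! ### Čech localization and the construction of Rφ_*. -/

section

open GrMod DerivedCategory ZeroObject

variable {A : Type u} [CommRing A] {𝒜 : ℤ → AddSubgroup A}
  [HasDerivedCategory (GrMod 𝒜)] [HasDerivedCategory (QGr 𝒜)]
  [GradedRing 𝒜] {r : ℕ} {f : Fin r → A} {d : Fin r → ℤ} (hf : ∀ i, f i ∈ 𝒜 (d i))
  (hspan : Ideal.span (Set.range f) = idealPos 𝒜)

open Pretriangulated in
include hspan in
-- The remaining vertex of the triangle is RΓ, which φ^* kills.
lemma isIso_phiStar_map_cechUnit (X : DerivedCategory (GrMod 𝒜)) :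
    IsIso ((phiStar 𝒜).map ((cechUnit hf).app X)) := by
  obtain ⟨K, -, a, c, hT⟩ := exists_triangle_cechUnit hf X
  exact (Triangle.isZero₁_iff_isIso₂ _ ((phiStar 𝒜).map_distinguished _ hT)).1
    (isZero_phiStar_cplx_univ hf hspan K CechTotal.ordConnected_univ)

open Pretriangulated in
lemma isZero_RGamma_obj_iff (X : DerivedCategory (GrMod 𝒜)) :
    IsZero ((RGamma hf).obj X) ↔ IsIso ((cechUnit hf).app X) := by
  obtain ⟨K, e, a, c, hT⟩ := exists_triangle_cechUnit hf X
  exact e.isZero_iff.trans (Triangle.isZero₁_iff_isIso₂ _ hT)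

include hspan in
-- Čech objects are orthogonal, which gives one direction. Conversely the unit is a map inverted by
-- φ^*, hence invertible between orthogonal objects.
lemma isIso_cechUnit_app_iff (X : DerivedCategory (GrMod 𝒜)) :
    IsIso ((cechUnit hf).app X) ↔ (kerProp (phiStar 𝒜)).rightOrthogonal X :=
  ⟨fun _ => ObjectProperty.prop_of_iso _ (asIso ((cechUnit hf).app X)).symm
    (rightOrthogonal_cech_obj hf hspan X),
  fun h => isIso_of_rightOrthogonal h (rightOrthogonal_cech_obj hf hspan X) _
    (isIso_phiStar_map_cechUnit hf hspan X)⟩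

include hspan in
-- By naturality of the unit, φ^* also inverts the map between Čech objects, and these are
-- orthogonal. Thus Č depends only on the image under φ^*.
lemma isIso_cech_map {X Y : DerivedCategory (GrMod 𝒜)} (g : X ⟶ Y)
    (hg : IsIso ((phiStar 𝒜).map g)) : IsIso ((cech hf).map g) := by
  refine isIso_of_rightOrthogonal (rightOrthogonal_cech_obj hf hspan X)
    (rightOrthogonal_cech_obj hf hspan Y) _ ?_
  have := isIso_phiStar_map_cechUnit hf hspan X
  have := isIso_phiStar_map_cechUnit hf hspan Y
  have h := congrArg (phiStar 𝒜).map ((cechUnit hf).naturality g)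
  rw [Functor.map_comp, Functor.map_comp] at h
  have : IsIso ((phiStar 𝒜).map ((𝟭 (DerivedCategory (GrMod 𝒜))).map g)) := hg
  have : IsIso ((phiStar 𝒜).map ((cechUnit hf).app X) ≫ (phiStar 𝒜).map ((cech hf).map g)) := by
    rw [← h]
    infer_instance
  exact IsIso.of_isIso_comp_left ((phiStar 𝒜).map ((cechUnit hf).app X)) _

include hspan in
-- Here Č(X) lies both in the kernel and in its orthogonal, so its identity is zero.
lemma isZero_cech_obj (X : DerivedCategory (GrMod 𝒜)) (hX : IsZero ((phiStar 𝒜).obj X)) :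
    IsZero ((cech hf).obj X) := by
  have := isIso_phiStar_map_cechUnit hf hspan X
  have h : kerProp (phiStar 𝒜) ((cech hf).obj X) :=
    hX.of_iso (asIso ((phiStar 𝒜).map ((cechUnit hf).app X))).symm
  exact (IsZero.iff_id_eq_zero _).2 (rightOrthogonal_cech_obj hf hspan X (𝟙 _) h)

/-- The functor `M ↦ H⁰(Č(M))`. -/
noncomputable def cechZero : GrMod 𝒜 ⥤ GrMod 𝒜 :=
  singleFunctor _ 0 ⋙ cech hf ⋙ homologyFunctor _ 0

/-- The natural map `M ⟶ H⁰(Č(M))`. -/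
noncomputable def toCechZero : 𝟭 (GrMod 𝒜) ⟶ cechZero hf :=
  (singleFunctorCompHomologyFunctorIso _ 0).inv ≫
    Functor.whiskerLeft (singleFunctor _ 0) (Functor.whiskerRight (cechUnit hf) (homologyFunctor _ 0))

include hspan in
lemma isIso_quot_map_toCechZero (M : GrMod 𝒜) :
    IsIso ((QGr.quot 𝒜).map ((toCechZero hf).app M)) := by
  have h := isIso_map_homologyFunctor_map (QGr.quot 𝒜) 0 _
    (isIso_phiStar_map_cechUnit hf hspan ((singleFunctor _ 0).obj M))
  have h' : IsIso ((QGr.quot 𝒜).map ((singleFunctorCompHomologyFunctorIso (GrMod 𝒜) 0).inv.app M)) :=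
    inferInstance
  have e : (QGr.quot 𝒜).map ((toCechZero hf).app M) =
      (QGr.quot 𝒜).map ((singleFunctorCompHomologyFunctorIso (GrMod 𝒜) 0).inv.app M) ≫
      (QGr.quot 𝒜).map ((homologyFunctor _ 0).map
        ((cechUnit hf).app ((singleFunctor _ 0).obj M))) := Functor.map_comp _ _ _
  rw [e]
  exact IsIso.comp_isIso' h' h

include hspan in
-- Viewed in degree `0`, an isomorphism modulo torsion is a map inverted by φ^*, hence by Č. So
-- H⁰(Č(-)) factors through the Serre quotient.
lemma isoModSerre_isInvertedBy_cechZero :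
    (isPosTorsion 𝒜).isoModSerre.IsInvertedBy (cechZero hf) := by
  intro M N g hg
  have h₁ : IsIso ((QGr.quot 𝒜).map g) := Localization.inverts _ _ g hg
  have h₂ : IsIso ((phiStar 𝒜).map ((singleFunctor _ 0).map g)) :=
    (NatIso.isIso_map_iff ((QGr.quot 𝒜).mapDerivedCategorySingleFunctor 0) g).2
      (inferInstanceAs (IsIso ((singleFunctor _ 0).map ((QGr.quot 𝒜).map g))))
  have := isIso_cech_map hf hspan _ h₂
  exact inferInstanceAs (IsIso ((homologyFunctor _ 0).map ((cech hf).map ((singleFunctor _ 0).map g))))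

/-- The right adjoint `φ_*` of the quotient functor, induced by `M ↦ H⁰(Č(M))`. -/
noncomputable def pushforward : QGr 𝒜 ⥤ GrMod 𝒜 :=
  Localization.lift (cechZero hf) (isoModSerre_isInvertedBy_cechZero hf hspan) (QGr.quot 𝒜)

/-- `φ_*` composed with the quotient functor is `M ↦ H⁰(Č(M))`. -/
noncomputable def pushforwardFac : QGr.quot 𝒜 ⋙ pushforward hf hspan ≅ cechZero hf :=
  Localization.fac _ _ _

/-- The unit `1 ⟶ φ_* φ^*`. -/
noncomputable def pushforwardUnit : 𝟭 (GrMod 𝒜) ⟶ QGr.quot 𝒜 ⋙ pushforward hf hspan :=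
  toCechZero hf ≫ (pushforwardFac hf hspan).inv

lemma isIso_quot_map_pushforwardUnit (M : GrMod 𝒜) :
    IsIso ((QGr.quot 𝒜).map ((pushforwardUnit hf hspan).app M)) := by
  have := isIso_quot_map_toCechZero hf hspan M
  rw [pushforwardUnit, NatTrans.comp_app, Functor.map_comp]
  infer_instance

/-- The counit `φ^* φ_* ≅ 1`. -/
noncomputable def pushforwardCounit : pushforward hf hspan ⋙ QGr.quot 𝒜 ≅ 𝟭 (QGr 𝒜) :=
  letI : Localization.Lifting (QGr.quot 𝒜) (isPosTorsion 𝒜).isoModSerre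
    ((QGr.quot 𝒜 ⋙ pushforward hf hspan) ⋙ QGr.quot 𝒜) (pushforward hf hspan ⋙ QGr.quot 𝒜) :=
    ⟨(Functor.associator _ _ _).symm⟩
  haveI : ∀ M, IsIso ((Functor.whiskerRight (pushforwardUnit hf hspan) (QGr.quot 𝒜)).app M) :=
    isIso_quot_map_pushforwardUnit hf hspan
  haveI := NatIso.isIso_of_isIso_app
    (Functor.whiskerRight (pushforwardUnit hf hspan) (QGr.quot 𝒜))
  Localization.liftNatIso (QGr.quot 𝒜) (isPosTorsion 𝒜).isoModSerre _ (QGr.quot 𝒜) _ _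
    ((asIso (Functor.whiskerRight (pushforwardUnit hf hspan) (QGr.quot 𝒜))).symm ≪≫
      Functor.leftUnitor _)

/-- This is all that is required to apply φ_* termwise to complexes; it follows from preservation of
the zero object. -/
instance : (pushforward hf hspan).PreservesZeroMorphisms := by
  refine Functor.preservesZeroMorphisms_of_map_zero_object ?_
  have h₀ : IsZero ((cechZero hf).obj 0) :=
    (homologyFunctor _ 0).map_isZero (isZero_cech_obj hf hspan _ ((phiStar 𝒜).map_isZero
      ((singleFunctor _ 0).map_isZero (isZero_zero _))))
  exact ((pushforward hf hspan).mapIso ((QGr.quot 𝒜).map_isZero (isZero_zero _)).isoZero.symm ≪≫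
    (pushforwardFac hf hspan).app 0 ≪≫ h₀.isoZero)

/-- The natural map from a complex to its image under `φ_* φ^*`. -/
noncomputable def mapPushforwardUnit : 𝟭 (CochainComplex (GrMod 𝒜) ℤ) ⟶
    (QGr.quot 𝒜).mapHomologicalComplex (ComplexShape.up ℤ) ⋙
      (pushforward hf hspan).mapHomologicalComplex (ComplexShape.up ℤ) :=
  (Functor.mapHomologicalComplexIdIso _ _).inv ≫
    (NatTrans.mapHomologicalComplex (pushforwardUnit hf hspan) _ :)

/-- The isomorphism of functors on complexes induced by `φ^* φ_* ≅ 1`. -/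
noncomputable def mapPushforwardCounit :
    (pushforward hf hspan).mapHomologicalComplex (ComplexShape.up ℤ) ⋙
      (QGr.quot 𝒜).mapHomologicalComplex (ComplexShape.up ℤ) ≅ 𝟭 (CochainComplex (QGr 𝒜) ℤ) :=
  (NatIso.mapHomologicalComplex (pushforwardCounit hf hspan) _ :) ≪≫
    Functor.mapHomologicalComplexIdIso _ _

lemma isIso_phiStar_map_Q_map_mapPushforwardUnit (K : CochainComplex (GrMod 𝒜) ℤ) :
    IsIso ((phiStar 𝒜).map (Q.map ((mapPushforwardUnit hf hspan).app K))) := by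
  rw [isIso_mapDerivedCategory_map_Q_map_iff]
  have h (n : ℤ) : IsIso ((((QGr.quot 𝒜).mapHomologicalComplex (ComplexShape.up ℤ)).map
      ((mapPushforwardUnit hf hspan).app K)).f n) := by
    have e : (((QGr.quot 𝒜).mapHomologicalComplex (ComplexShape.up ℤ)).map
        ((mapPushforwardUnit hf hspan).app K)).f n =
        (QGr.quot 𝒜).map ((pushforwardUnit hf hspan).app (K.X n)) :=
      congrArg (QGr.quot 𝒜).map (Category.id_comp _)
    rw [e]
    exact isIso_quot_map_pushforwardUnit hf hspan _
  have := HomologicalComplex.Hom.isIso_of_components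
    (((QGr.quot 𝒜).mapHomologicalComplex (ComplexShape.up ℤ)).map
      ((mapPushforwardUnit hf hspan).app K))
  infer_instance

/-- The functor `K ↦ Č(φ_* K)` on complexes. -/
noncomputable def cechPushforward : CochainComplex (QGr 𝒜) ℤ ⥤ DerivedCategory (GrMod 𝒜) :=
  (pushforward hf hspan).mapHomologicalComplex (ComplexShape.up ℤ) ⋙ Q ⋙ cech hf

/-- No exactness of φ_* is needed: applying φ^* to φ_* g gives back the quasi-isomorphism g through
the counit, and Č inverts whatever φ^* inverts. -/
lemma quasiIso_isInvertedBy_cechPushforward :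
    (HomologicalComplex.quasiIso (QGr 𝒜) (ComplexShape.up ℤ)).IsInvertedBy
      (cechPushforward hf hspan) := by
  intro K L g hg
  refine isIso_cech_map hf hspan _ ?_
  rw [isIso_mapDerivedCategory_map_Q_map_iff, ← isIso_Q_map_iff_quasiIso]
  have h₁ : IsIso (Q.map g) := (isIso_Q_map_iff_quasiIso _ _).2 hg
  exact (NatIso.isIso_map_iff (Functor.isoWhiskerRight (mapPushforwardCounit hf hspan) Q) g).2 h₁

/-- The functor `Rφ_*`, induced by `K ↦ Č(φ_* K)`. -/
noncomputable def derivedPushforward : DerivedCategory (QGr 𝒜) ⥤ DerivedCategory (GrMod 𝒜) :=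
  Localization.lift (cechPushforward hf hspan) (quasiIso_isInvertedBy_cechPushforward hf hspan) Q

lemma rightOrthogonal_derivedPushforward_obj (Y : DerivedCategory (QGr 𝒜)) :
    (kerProp (phiStar 𝒜)).rightOrthogonal ((derivedPushforward hf hspan).obj Y) :=
  ObjectProperty.prop_of_iso _ ((Localization.fac (cechPushforward hf hspan)
      (quasiIso_isInvertedBy_cechPushforward hf hspan) Q).symm.app (Q.objPreimage Y) ≪≫
    (derivedPushforward hf hspan).mapIso (Q.objObjPreimageIso Y))
    (rightOrthogonal_cech_obj hf hspan _)

/-- The natural map `M ⟶ Č(φ_* φ^* M)` for complexes `M`. -/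
noncomputable def toCechPushforward : Q ⟶
    (QGr.quot 𝒜).mapHomologicalComplex (ComplexShape.up ℤ) ⋙ cechPushforward hf hspan :=
  (Functor.leftUnitor _).inv ≫ Functor.whiskerRight (mapPushforwardUnit hf hspan) Q ≫
    Functor.whiskerLeft (((QGr.quot 𝒜).mapHomologicalComplex (ComplexShape.up ℤ) ⋙
      (pushforward hf hspan).mapHomologicalComplex (ComplexShape.up ℤ)) ⋙ Q) (cechUnit hf)

/-- The map is the termwise unit K → φ_* φ^* K followed by the Čech unit, and φ^* inverts both. -/
lemma isIso_phiStar_map_toCechPushforward (K : CochainComplex (GrMod 𝒜) ℤ) :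
    IsIso ((phiStar 𝒜).map ((toCechPushforward hf hspan).app K)) := by
  have h₁ := isIso_phiStar_map_Q_map_mapPushforwardUnit hf hspan K
  have h₂ := isIso_phiStar_map_cechUnit hf hspan
    (Q.obj (((pushforward hf hspan).mapHomologicalComplex (ComplexShape.up ℤ)).obj
      (((QGr.quot 𝒜).mapHomologicalComplex (ComplexShape.up ℤ)).obj K)))
  have e : (toCechPushforward hf hspan).app K = Q.map ((mapPushforwardUnit hf hspan).app K) ≫
      (cechUnit hf).app (Q.obj (((pushforward hf hspan).mapHomologicalComplex
        (ComplexShape.up ℤ)).obj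
      (((QGr.quot 𝒜).mapHomologicalComplex (ComplexShape.up ℤ)).obj K))) := Category.id_comp _
  exact ((congrArg (phiStar 𝒜).map e).trans (Functor.map_comp _ _ _)) ▸ IsIso.comp_isIso' h₁ h₂

noncomputable instance : Localization.Lifting Q
    (HomologicalComplex.quasiIso (GrMod 𝒜) (ComplexShape.up ℤ))
    ((QGr.quot 𝒜).mapHomologicalComplex (ComplexShape.up ℤ) ⋙ cechPushforward hf hspan)
    (phiStar 𝒜 ⋙ derivedPushforward hf hspan) :=
  ⟨(Functor.associator _ _ _).symm ≪≫ Functor.isoWhiskerRight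
    (QGr.quot 𝒜).mapDerivedCategoryFactors _ ≪≫ Functor.associator _ _ _ ≪≫
      Functor.isoWhiskerLeft _ (Localization.fac _ _ _)⟩

/-- The natural map `M ⟶ Rφ_* φ^* M`. -/
noncomputable def derivedPushforwardUnit :
    𝟭 (DerivedCategory (GrMod 𝒜)) ⟶ phiStar 𝒜 ⋙ derivedPushforward hf hspan :=
  Localization.liftNatTrans Q (HomologicalComplex.quasiIso (GrMod 𝒜) (ComplexShape.up ℤ))
    Q ((QGr.quot 𝒜).mapHomologicalComplex (ComplexShape.up ℤ) ⋙ cechPushforward hf hspan) _ _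
    (toCechPushforward hf hspan)

lemma isIso_map_app_of_iso {D D' : Type*} [Category* D] [Category* D'] (F : D ⥤ D')
    {G H : D ⥤ D} (α : G ⟶ H) {X Y : D} (e : X ≅ Y) (h : IsIso (F.map (α.app X))) :
    IsIso (F.map (α.app Y)) :=
  (NatTrans.isIso_app_iff_of_iso (Functor.whiskerRight α F) e).1 h

lemma isIso_phiStar_map_derivedPushforwardUnit (X : DerivedCategory (GrMod 𝒜)) :
    IsIso ((phiStar 𝒜).map ((derivedPushforwardUnit hf hspan).app X)) := by
  refine isIso_map_app_of_iso _ _ (Q.objObjPreimageIso X) ?_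
  rw [derivedPushforwardUnit, Localization.liftNatTrans_app, Functor.map_comp, Functor.map_comp]
  have := isIso_phiStar_map_toCechPushforward hf hspan (Q.objPreimage X)
  infer_instance

/-- The isomorphism `φ^* Rφ_* ≅ 1`. -/
noncomputable def derivedPushforwardCounit :
    derivedPushforward hf hspan ⋙ phiStar 𝒜 ≅ 𝟭 (DerivedCategory (QGr 𝒜)) :=
  letI : Localization.Lifting Q (HomologicalComplex.quasiIso (QGr 𝒜) (ComplexShape.up ℤ))
      (cechPushforward hf hspan ⋙ phiStar 𝒜) (derivedPushforward hf hspan ⋙ phiStar 𝒜) :=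
    ⟨(Functor.associator _ _ _).symm ≪≫ Functor.isoWhiskerRight (Localization.fac _ _ _) _⟩
  haveI : ∀ X, IsIso ((Functor.whiskerRight (cechUnit hf) (phiStar 𝒜)).app X) :=
    isIso_phiStar_map_cechUnit hf hspan
  haveI := NatIso.isIso_of_isIso_app (Functor.whiskerRight (cechUnit hf) (phiStar 𝒜))
  Localization.liftNatIso Q (HomologicalComplex.quasiIso (QGr 𝒜) (ComplexShape.up ℤ))
    (cechPushforward hf hspan ⋙ phiStar 𝒜) Q _ _
    (Functor.isoWhiskerLeft ((pushforward hf hspan).mapHomologicalComplex (ComplexShape.up ℤ) ⋙ Q)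
      ((asIso (Functor.whiskerRight (cechUnit hf) (phiStar 𝒜))).symm ≪≫
        Functor.leftUnitor (phiStar 𝒜)) ≪≫ Functor.associator _ _ _ ≪≫
      Functor.isoWhiskerLeft _ (QGr.quot 𝒜).mapDerivedCategoryFactors ≪≫
      (Functor.associator _ _ _).symm ≪≫
      Functor.isoWhiskerRight (mapPushforwardCounit hf hspan) Q ≪≫ Functor.leftUnitor Q)

include hf hspan in
/-- The functor `φ^*` on derived categories has a right adjoint, and the counit is invertible. -/
lemma exists_phiStar_adjunction :
    ∃ (R : DerivedCategory (QGr 𝒜) ⥤ DerivedCategory (GrMod 𝒜)) (adj : phiStar 𝒜 ⊣ R),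
      IsIso adj.counit :=
  ⟨_, exists_adjunction (derivedPushforward hf hspan) (derivedPushforwardUnit hf hspan)
    (isIso_phiStar_map_derivedPushforwardUnit hf hspan) (derivedPushforwardCounit hf hspan)
    (rightOrthogonal_derivedPushforward_obj hf hspan)⟩

end

/-! ### Boundedness conditions and truncations. -/

section Boundedness

open DerivedCategory

namespace Boundedness

variable (s : Boundedness) (C : Type*) [Category* C] [Abelian C] [HasDerivedCategory C]

instance : (s.subcat C).IsTriangulated := by
  cases s
  · exact inferInstanceAs (TStructure.t.minus (C := DerivedCategory C)).IsTriangulated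
  · exact inferInstanceAs (TStructure.t.bounded (C := DerivedCategory C)).IsTriangulated

instance : (s.subcat C).IsClosedUnderIsomorphisms := by
  cases s
  · exact inferInstanceAs (TStructure.t.minus (C := DerivedCategory C)).IsClosedUnderIsomorphisms
  · exact inferInstanceAs (TStructure.t.bounded (C := DerivedCategory C)).IsClosedUnderIsomorphisms

variable {C}

lemma subcat_le_minus : s.subcat C ≤ minus.subcat C := by
  cases s
  · exact le_rfl
  · exact inf_le_right

lemma minus_subcat_iff (X : DerivedCategory C) :
    minus.subcat C X ↔ ∃ n : ℤ, ∀ i, n < i → IsZero ((homologyFunctor C i).obj X) :=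
  exists_congr fun n => isLE_iff X n

lemma bounded_subcat_iff (X : DerivedCategory C) :
    bounded.subcat C X ↔ (∃ n : ℤ, ∀ i, i < n → IsZero ((homologyFunctor C i).obj X)) ∧
      ∃ n : ℤ, ∀ i, n < i → IsZero ((homologyFunctor C i).obj X) :=
  and_congr (exists_congr fun n => isGE_iff X n) (exists_congr fun n => isLE_iff X n)

variable {s} in
lemma subcat_of_isZero_homology {C' : Type*} [Category* C'] [Abelian C'] [HasDerivedCategory C']
    {X : DerivedCategory C} {Y : DerivedCategory C'}
    (h : ∀ n, IsZero ((homologyFunctor C n).obj X) → IsZero ((homologyFunctor C' n).obj Y))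
    (hX : s.subcat C X) : s.subcat C' Y := by
  cases s
  · rw [minus_subcat_iff] at hX ⊢
    exact hX.imp fun n hn i hi => h i (hn i hi)
  · rw [bounded_subcat_iff] at hX ⊢
    exact hX.imp (Exists.imp fun n hn i hi => h i (hn i hi))
      (Exists.imp fun n hn i hi => h i (hn i hi))

variable {s} in
lemma subcat_mapDerivedCategory_obj {C' : Type*} [Category* C'] [Abelian C']
    [HasDerivedCategory C'] (Φ : C ⥤ C') [Φ.Additive] [PreservesFiniteLimits Φ]
    [PreservesFiniteColimits Φ] {X : DerivedCategory C} (hX : s.subcat C X) :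
    s.subcat C' (Φ.mapDerivedCategory.obj X) :=
  subcat_of_isZero_homology (fun n hn =>
    (Φ.map_isZero hn).of_iso ((mapDerivedCategoryCompHomologyIso Φ n).app X)) hX

end Boundedness

section Truncation

variable {C C' : Type*} [Category* C] [Abelian C] [HasDerivedCategory C]
  [Category* C'] [Abelian C'] [HasDerivedCategory C']

lemma isIso_homologyFunctor_map_Q_map {K L : CochainComplex C ℤ} (f : K ⟶ L) (n : ℤ)
    (hf : QuasiIsoAt f n) : IsIso ((homologyFunctor C n).map (Q.map f)) :=
  (NatIso.isIso_map_iff (homologyFunctorFactors C n) f).2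
    ((quasiIsoAt_iff_isIso_homologyMap f n).1 hf)

lemma exists_truncGE (X : DerivedCategory C) (n : ℤ) : ∃ (Y : DerivedCategory C) (g : X ⟶ Y),
    (∀ i, i < n → IsZero ((homologyFunctor C i).obj Y)) ∧
    ∀ i, n ≤ i → IsIso ((homologyFunctor C i).map g) := by
  let K := Q.objPreimage X
  refine ⟨Q.obj (K.truncGE n), (Q.objObjPreimageIso X).inv ≫ Q.map (K.πTruncGE n),
    (isGE_iff _ n).1 inferInstance, fun i hi => ?_⟩
  have := isIso_homologyFunctor_map_Q_map _ _ (CochainComplex.quasiIsoAt_πTruncGE K n i hi)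
  rw [Functor.map_comp]
  infer_instance

lemma exists_truncLE (X : DerivedCategory C) (n : ℤ) : ∃ (Y : DerivedCategory C) (g : Y ⟶ X),
    (∀ i, n < i → IsZero ((homologyFunctor C i).obj Y)) ∧
    ∀ i, i ≤ n → IsIso ((homologyFunctor C i).map g) := by
  let K := Q.objPreimage X
  refine ⟨Q.obj (K.truncLE n), Q.map (K.ιTruncLE n) ≫ (Q.objObjPreimageIso X).hom,
    (isLE_iff _ n).1 inferInstance, fun i hi => ?_⟩
  have := isIso_homologyFunctor_map_Q_map _ _ (CochainComplex.quasiIsoAt_ιTruncLE K n i hi)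
  rw [Functor.map_comp]
  infer_instance

variable (Φ : C ⥤ C') [Φ.Additive] [PreservesFiniteLimits Φ] [PreservesFiniteColimits Φ]

/-- An exact functor commutes with cohomology, so degrees whose source and target cohomology it
kills impose no condition on `g`. -/
lemma isIso_mapDerivedCategory_map {X Y : DerivedCategory C} (g : X ⟶ Y)
    (h : ∀ n, IsIso ((homologyFunctor C n).map g) ∨
      IsZero (Φ.obj ((homologyFunctor C n).obj X)) ∧
      IsZero (Φ.obj ((homologyFunctor C n).obj Y))) :
    IsIso (Φ.mapDerivedCategory.map g) := by
  rw [isIso_iff]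
  intro n
  refine (NatIso.isIso_map_iff (mapDerivedCategoryCompHomologyIso Φ n) g).2 ?_
  change IsIso (Φ.map ((homologyFunctor C n).map g))
  obtain h | h := h n
  · infer_instance
  · exact h.1.isIso h.2 _

/-- Truncation above degree `n` discards only cohomology killed by `Φ`. -/
lemma exists_zigzag_of_isLE (X : DerivedCategory C) (n : ℤ)
    (hn : ∀ i, n < i → IsZero (Φ.obj ((homologyFunctor C i).obj X))) :
    ∃ (Z : DerivedCategory C) (g : Z ⟶ X), IsIso (Φ.mapDerivedCategory.map g) ∧
      ∀ i, IsZero ((homologyFunctor C i).obj Z) ∨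
        Nonempty ((homologyFunctor C i).obj Z ≅ (homologyFunctor C i).obj X) ∧ i ≤ n := by
  obtain ⟨Z, g, h₁, h₂⟩ := exists_truncLE X n
  refine ⟨Z, g, isIso_mapDerivedCategory_map Φ g fun i => ?_, fun i => ?_⟩
  · rcases le_or_gt i n with hi | hi
    · exact Or.inl (h₂ i hi)
    · exact Or.inr ⟨Φ.map_isZero (h₁ i hi), hn i hi⟩
  · rcases le_or_gt i n with hi | hi
    · have := h₂ i hi
      exact Or.inr ⟨⟨asIso ((homologyFunctor C i).map g)⟩, hi⟩
    · exact Or.inl (h₁ i hi)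

/-- If the image of `X` under an exact functor is bounded (above), then `X` may be replaced by
a truncation. -/
lemma exists_zigzag (s : Boundedness) (X : DerivedCategory C)
    (hX : s.subcat C' (Φ.mapDerivedCategory.obj X)) :
    ∃ (Y Z : DerivedCategory C) (g : X ⟶ Y) (h : Z ⟶ Y), IsIso (Φ.mapDerivedCategory.map g) ∧
      IsIso (Φ.mapDerivedCategory.map h) ∧ s.subcat C Z ∧
      ∀ i, IsZero ((homologyFunctor C i).obj Z) ∨
        Nonempty ((homologyFunctor C i).obj Z ≅ (homologyFunctor C i).obj X) := by
  have key (X : DerivedCategory C) (i : ℤ) :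
      IsZero ((homologyFunctor C' i).obj (Φ.mapDerivedCategory.obj X)) ↔
        IsZero (Φ.obj ((homologyFunctor C i).obj X)) :=
    ((mapDerivedCategoryCompHomologyIso Φ i).app X).isZero_iff
  cases s
  · simp only [Boundedness.minus_subcat_iff, key] at hX ⊢
    obtain ⟨n, hn⟩ := hX
    obtain ⟨Z, g, h₁, h₂⟩ := exists_zigzag_of_isLE Φ X n hn
    refine ⟨X, Z, 𝟙 X, g, inferInstance, h₁, ⟨n, fun i hi => ?_⟩,
      fun i => (h₂ i).imp_right And.left⟩
    exact (h₂ i).resolve_right fun h => by lia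
  · simp only [Boundedness.bounded_subcat_iff, key] at hX ⊢
    obtain ⟨⟨m, hm⟩, ⟨n, hn⟩⟩ := hX
    -- Truncating below gives a map out of `X`, and then truncating above gives a map into the
    -- result; hence the zigzag shape.
    obtain ⟨Y, g, h₁, h₂⟩ := exists_truncGE X m
    have hY (i : ℤ) : IsZero ((homologyFunctor C i).obj Y) ∨
        Nonempty ((homologyFunctor C i).obj Y ≅ (homologyFunctor C i).obj X) ∧ m ≤ i := by
      rcases lt_or_ge i m with hi | hi
      · exact Or.inl (h₁ i hi)
      · have := h₂ i hi
        exact Or.inr ⟨⟨(asIso ((homologyFunctor C i).map g)).symm⟩, hi⟩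
    obtain ⟨Z, g', h₃, h₄⟩ := exists_zigzag_of_isLE Φ Y n fun i hi => by
      obtain h | ⟨⟨e⟩, -⟩ := hY i
      · exact Φ.map_isZero h
      · exact (hn i hi).of_iso (Φ.mapIso e)
    have hZ (i : ℤ) : IsZero ((homologyFunctor C i).obj Z) ∨
        Nonempty ((homologyFunctor C i).obj Z ≅ (homologyFunctor C i).obj X) ∧ m ≤ i ∧ i ≤ n := by
      obtain h | ⟨⟨e⟩, h⟩ := h₄ i
      · exact Or.inl h
      · exact (hY i).imp (fun h' => h'.of_iso e) fun h' => ⟨⟨e ≪≫ h'.1.some⟩, h'.2, h⟩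
    refine ⟨Y, Z, g, g', isIso_mapDerivedCategory_map Φ g fun i => ?_, h₃, ⟨⟨m, fun i hi => ?_⟩,
      ⟨n, fun i hi => ?_⟩⟩, fun i => (hZ i).imp_right And.left⟩
    · rcases lt_or_ge i m with hi | hi
      · exact Or.inr ⟨hm i hi, Φ.map_isZero (h₁ i hi)⟩
      · exact Or.inl (h₂ i hi)
    · exact (hZ i).resolve_right fun h => by lia
    · exact (hZ i).resolve_right fun h => by lia

end Truncation

end Boundedness

/-! ### The RΓ-acyclic objects as orthogonal objects with bounded image. -/

section

open GrMod DerivedCategory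

variable {A : Type u} [CommRing A] {𝒜 : ℤ → AddSubgroup A}
  [HasDerivedCategory (GrMod 𝒜)] [HasDerivedCategory (QGr 𝒜)]
  [GradedRing 𝒜] {r : ℕ} {f : Fin r → A} {d : Fin r → ℤ} (hf : ∀ i, f i ∈ 𝒜 (d i))
  (hspan : Ideal.span (Set.range f) = idealPos 𝒜)

/-- Localizations are exact and so preserve boundedness, and Č is a shift of a finite iterated
extension of shifts of them. -/
lemma Boundedness.subcat_cech_obj (s : Boundedness) (X : DerivedCategory (GrMod 𝒜))
    (hX : s.subcat _ X) : s.subcat _ ((cech hf).obj X) := by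
  have h := CechTotal.prop_Q_cplx (locSystem hf) (s.subcat (GrMod 𝒜)) (Q.objPreimage X)
    (Finset.univ.filter Finset.Nonempty) CechTotal.ordConnected_nonempty fun S _ =>
      ObjectProperty.prop_of_iso (s.subcat (GrMod 𝒜))
        ((loc (prod_mem hf S)).mapDerivedCategory.mapIso (Q.objObjPreimageIso X).symm ≪≫
          (loc (prod_mem hf S)).mapDerivedCategoryFactors.app (Q.objPreimage X))
        (subcat_mapDerivedCategory_obj _ hX)
  exact ObjectProperty.prop_of_iso (s.subcat (GrMod 𝒜)) (((cechFac hf).app _).symm ≪≫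
    (cech hf).mapIso (Q.objObjPreimageIso X))
    (ObjectProperty.le_shift (s.subcat (GrMod 𝒜)) (1 : ℤ) _ h)

include hspan in
/-- Two objects which become isomorphic in the quotient by means of a zigzag have the same Čech
complex. -/
lemma nonempty_cech_obj_iso {X Y Z : DerivedCategory (GrMod 𝒜)} (g : X ⟶ Y) (h : Z ⟶ Y)
    (hg : IsIso ((phiStar 𝒜).map g)) (hh : IsIso ((phiStar 𝒜).map h)) :
    Nonempty ((cech hf).obj X ≅ (cech hf).obj Z) :=
  have := isIso_cech_map hf hspan g hg
  have := isIso_cech_map hf hspan h hh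
  ⟨asIso ((cech hf).map g) ≪≫ (asIso ((cech hf).map h)).symm⟩

include hspan in
lemma nonempty_iso_cech_obj {X : DerivedCategory (GrMod 𝒜)}
    (hX : (kerProp (phiStar 𝒜)).rightOrthogonal X) : Nonempty (X ≅ (cech hf).obj X) :=
  have := (isIso_cechUnit_app_iff hf hspan X).2 hX
  ⟨asIso ((cechUnit hf).app X)⟩

include hspan in
-- The point is that an orthogonal `X` inherits boundedness from φ^* X. A bounded truncation `Z` has
-- the same image under φ^*, so X ≅ Č(X) ≅ Č(Z), which is bounded.
lemma Boundedness.trivialSubcat_eq (s : Boundedness) : s.trivialSubcat hf =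
    (kerProp (phiStar 𝒜)).rightOrthogonal ⊓ (s.subcat (QGr 𝒜)).inverseImage (phiStar 𝒜) := by
  ext X
  change _ ∧ IsZero ((RGamma hf).obj X) ↔ _ ∧ _
  rw [isZero_RGamma_obj_iff, isIso_cechUnit_app_iff hf hspan]
  constructor
  · exact fun h => ⟨h.2, subcat_mapDerivedCategory_obj _ h.1⟩
  · rintro ⟨h₁, h₂⟩
    refine ⟨?_, h₁⟩
    obtain ⟨Y, Z, g, h, hg, hh, hZ, -⟩ := exists_zigzag (QGr.quot 𝒜) s X h₂
    obtain ⟨e⟩ := nonempty_iso_cech_obj hf hspan h₁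
    obtain ⟨e'⟩ := nonempty_cech_obj_iso hf hspan g h hg hh
    exact ObjectProperty.prop_of_iso _ (e ≪≫ e').symm (s.subcat_cech_obj hf Z hZ)

end

/-! ### Modules finitely generated up to torsion. -/

section AlmostFinite

variable {A : Type*} [CommRing A]

/-- A module which is finitely generated up to torsion with respect to an ideal: some finitely
generated submodule contains a multiple of each element by some power of each element of `I`. -/
def IsAlmostFinite (I : Ideal A) (M : Type*) [AddCommGroup M] [Module A M] : Prop :=
  ∃ S : Submodule A M, S.FG ∧ ∀ x : M, ∀ a ∈ I, ∃ k : ℕ, a ^ k • x ∈ S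

variable {I : Ideal A} {M N P : Type*} [AddCommGroup M] [Module A M] [AddCommGroup N] [Module A N]
  [AddCommGroup P] [Module A P]

lemma Submodule.FG.exists_fg_map_eq {f : M →ₗ[A] N} {S : Submodule A N} (hS : S.FG)
    (h : S ≤ LinearMap.range f) : ∃ T : Submodule A M, T.FG ∧ T.map f = S := by
  classical
  obtain ⟨t, rfl⟩ := hS
  have h' : ∀ y : t, ∃ x, f x = y := fun y => h (Submodule.subset_span y.2)
  choose g hg using h'
  refine ⟨Submodule.span A (Set.range g), Submodule.fg_span (Set.finite_range g), ?_⟩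
  rw [Submodule.map_span, ← Set.range_comp]
  congr 1
  ext y
  constructor
  · rintro ⟨z, rfl⟩
    exact (congrArg (· ∈ (t : Set N)) (hg z)).mpr z.2
  · exact fun hy => ⟨⟨y, hy⟩, hg _⟩

lemma IsAlmostFinite.of_surjective (f : M →ₗ[A] N) (hf : Function.Surjective f)
    (h : IsAlmostFinite I M) : IsAlmostFinite I N := by
  obtain ⟨S, hS, h⟩ := h
  refine ⟨S.map f, hS.map f, fun y a ha => ?_⟩
  obtain ⟨x, rfl⟩ := hf y
  obtain ⟨k, hk⟩ := h x a ha
  exact ⟨k, a ^ k • x, hk, map_smul _ _ _⟩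

/-- The preimage of the finitely generated `S` embeds in `S`, hence is finitely generated over a
Noetherian ring. -/
lemma IsAlmostFinite.of_injective [IsNoetherianRing A] (f : M →ₗ[A] N)
    (hf : Function.Injective f) (h : IsAlmostFinite I N) : IsAlmostFinite I M := by
  obtain ⟨S, hS, h⟩ := h
  refine ⟨S.comap f, Submodule.fg_of_fg_map_injective f hf (hS.of_le (Submodule.map_comap_le f S)),
    fun x a ha => ?_⟩
  obtain ⟨k, hk⟩ := h (f x) a ha
  exact ⟨k, by rwa [Submodule.mem_comap, map_smul]⟩

lemma IsAlmostFinite.of_exact (f : M →ₗ[A] N) (g : N →ₗ[A] P) (hg : Function.Surjective g)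
    (hfg : ∀ x, g x = 0 → x ∈ LinearMap.range f) (hM : IsAlmostFinite I M)
    (hP : IsAlmostFinite I P) : IsAlmostFinite I N := by
  obtain ⟨S, hS, h⟩ := hM
  obtain ⟨T, hT, h'⟩ := hP
  obtain ⟨T, hT', rfl⟩ := hT.exists_fg_map_eq (f := g) (by
    rw [LinearMap.range_eq_top.2 hg]; exact le_top)
  refine ⟨S.map f ⊔ T, (hS.map f).sup hT', fun x a ha => ?_⟩
  obtain ⟨k, y, hy, hk⟩ := h' (g x) a ha
  obtain ⟨z, hz⟩ := hfg (a ^ k • x - y) (by rw [map_sub, map_smul, hk, sub_self])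
  obtain ⟨l, hl⟩ := h z a ha
  -- The power `k` moves `x` into `T` modulo the image of `f`, and a further power `l` moves the
  -- correction into the image of `S`.
  refine ⟨l + k, ?_⟩
  have : a ^ (l + k) • x = f (a ^ l • z) + a ^ l • y := by
    rw [map_smul, hz, pow_add, mul_smul, smul_sub, sub_add_cancel]
  rw [this]
  exact Submodule.add_mem_sup ⟨_, hl, rfl⟩ (T.smul_mem _ hy)

lemma IsAlmostFinite.of_torsion (h : ∀ x : M, ∀ a ∈ I, ∃ n : ℕ, 0 < n ∧ a ^ n • x = 0) :
    IsAlmostFinite I M :=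
  ⟨⊥, Submodule.fg_bot, fun x a ha => (h x a ha).imp fun _ hn => hn.2⟩

lemma IsAlmostFinite.of_finite [Module.Finite A M] : IsAlmostFinite I M :=
  ⟨⊤, Module.Finite.fg_top, fun _ _ _ => ⟨0, trivial⟩⟩

end AlmostFinite

/-! ### Homogeneous submodules and the description of q⁺gr A. -/

namespace GrMod

variable {A : Type u} [CommRing A] {𝒜 : ℤ → AddSubgroup A}

section Homogeneous

/-- A submodule of a graded module which contains the homogeneous components of its elements. -/
def IsHomogeneous {M : GrMod 𝒜} (V : Submodule A M) : Prop :=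
  ∀ y : ℤ →₀ M, IsHomFamily M.deg y → (y.sum fun _ x => x) ∈ V → ∀ n, y n ∈ V

variable {M N : GrMod 𝒜}

lemma isHomogeneous_top : IsHomogeneous (⊤ : Submodule A M) := fun _ _ _ _ => trivial

lemma isHomogeneous_bot : IsHomogeneous (⊥ : Submodule A M) := fun y hy h n => by
  rw [family_eq_zero M.isInternal y hy h]
  exact zero_mem _

lemma IsHomogeneous.comap {V : Submodule A N} (hV : IsHomogeneous V) (f : M ⟶ N) :
    IsHomogeneous (V.comap f.lin) := fun y hy h n => by
  have := hV _ (family_map f hy) (by rw [sum_mapRange]; exact h) n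
  simpa using this

/-- A homogeneous submodule as a graded module. -/
def subObj (M : GrMod 𝒜) (V : Submodule A M) (hV : IsHomogeneous V) : GrMod 𝒜 where
  carrier := V
  deg n := (M.deg n).comap V.subtype.toAddMonoidHom
  isInternal := isInternal_of
    (fun x => by
      obtain ⟨y, hy, hy'⟩ := exists_family M.isInternal x.1
      let z : ℤ →₀ V := Finsupp.onFinset y.support
        (fun n => ⟨y n, hV y hy (hy' ▸ x.2) n⟩) (by
          intro n hn
          simpa [Subtype.ext_iff] using hn)
      refine ⟨z, fun n => hy n, ?_⟩
      apply Subtype.ext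
      have h1 := sum_mapRange V.subtype z
      rw [Submodule.subtype_apply] at h1
      rw [← h1, ← hy']
      congr 1
      ext n
      rfl)
    (fun y hy hs => by
      have h₁ := family_eq_zero M.isInternal (y.mapRange V.subtype (map_zero _))
        (fun n => hy n) (by rw [sum_mapRange, hs]; simp)
      ext n
      simpa using DFunLike.congr_fun h₁ n)
  smul_mem ha hx := M.smul_mem ha hx

/-- The inclusion of a homogeneous submodule. -/
def subι (M : GrMod 𝒜) (V : Submodule A M) (hV : IsHomogeneous V) : subObj M V hV ⟶ M :=
  ⟨V.subtype, fun _ _ h => h⟩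

lemma subι_injective (M : GrMod 𝒜) (V : Submodule A M) (hV : IsHomogeneous V) :
    Function.Injective (subι M V hV).lin := Subtype.val_injective

lemma range_subι (M : GrMod 𝒜) (V : Submodule A M) (hV : IsHomogeneous V) :
    LinearMap.range (subι M V hV).lin = V := Submodule.range_subtype V

variable [GradedRing 𝒜]

lemma isHomogeneous_span (t : Set M) (ht : ∀ x ∈ t, ∃ n, x ∈ M.deg n) :
    IsHomogeneous (Submodule.span A t) := by
  classical
  -- By uniqueness of homogeneous components it suffices that each element of the span has some
  -- decomposition with components in the span.
  let Q (x : M) : Prop := ∃ y : ℤ →₀ M, IsHomFamily M.deg y ∧ (y.sum fun _ x => x) = x ∧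
    ∀ n, y n ∈ Submodule.span A t
  have h_zero : Q 0 := ⟨0, fun n => zero_mem _, rfl, fun n => zero_mem _⟩
  have h_add (x x' : M) : Q x → Q x' → Q (x + x') := by
    rintro ⟨y, hy, rfl, h⟩ ⟨y', hy', rfl, h'⟩
    exact ⟨y + y', fun n => add_mem (hy n) (hy' n), Finsupp.sum_add_index (by simp) (by simp),
      fun n => add_mem (h n) (h' n)⟩
  have h_smul (a : A) (x : M) (hx : Q x) : Q (a • x) := by
    obtain ⟨y, hy, rfl, h⟩ := hx
    rw [← DirectSum.sum_support_decompose 𝒜 a, Finset.sum_smul]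
    refine Finset.sum_induction _ Q h_add h_zero fun i _ => ?_
    -- Multiplication by the degree `i` component of `a` shifts the family by `i`.
    refine ⟨Finsupp.embDomain (Equiv.addLeft i).toEmbedding (y.mapRange
      (DistribSMul.toAddMonoidHom M (DirectSum.decompose 𝒜 a i : A)) (map_zero _)),
      fun n => ?_, ?_, fun n => ?_⟩
    · obtain ⟨n, rfl⟩ := (Equiv.addLeft i).surjective n
      rw [← Equiv.coe_toEmbedding, Finsupp.embDomain_apply_self]
      exact M.smul_mem (SetLike.coe_mem _) (hy n)
    · rw [Finsupp.sum_embDomain, sum_mapRange]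
      rfl
    · obtain ⟨n, rfl⟩ := (Equiv.addLeft i).surjective n
      have := Submodule.smul_mem _ (DirectSum.decompose 𝒜 a i : A) (h n)
      exact (congrArg (· ∈ Submodule.span A t)
        (Finsupp.embDomain_apply_self (Equiv.addLeft i).toEmbedding _ n)).mpr this
  have key (x : M) (hx : x ∈ Submodule.span A t) : Q x := by
    induction hx using Submodule.span_induction with
    | mem x hx =>
      obtain ⟨n, hn⟩ := ht x hx
      refine ⟨Finsupp.single n x, IsHomFamily.single hn, by simp, fun m => ?_⟩
      rw [Finsupp.single_apply]
      split_ifs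
      · exact Submodule.subset_span hx
      · exact zero_mem _
    | zero => exact h_zero
    | add x x' _ _ h h' => exact h_add x x' h h'
    | smul a x _ h => exact h_smul a x h
  intro y hy hs n
  obtain ⟨y', hy', h, h'⟩ := key _ hs
  rw [family_eq M.isInternal hy hy' h.symm]
  exact h' n

/-- A finitely generated submodule of a homogeneous submodule `V` is contained in a homogeneous
finitely generated submodule of `V`. -/
lemma IsHomogeneous.exists_fg {V : Submodule A M} (hV : IsHomogeneous V) {S : Submodule A M}
    (hS : S.FG) (hSV : S ≤ V) : ∃ W : Submodule A M, W.FG ∧ IsHomogeneous W ∧ S ≤ W ∧ W ≤ V := by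
  classical
  obtain ⟨s, rfl⟩ := hS
  choose y hy hs using fun x : M => exists_family M.isInternal x
  refine ⟨Submodule.span A (s.biUnion fun x => (y x).support.image (y x) : Finset M),
    ⟨_, rfl⟩, isHomogeneous_span _ fun x hx => ?_, Submodule.span_le.2 fun x hx => ?_,
    Submodule.span_le.2 fun x hx => ?_⟩
  · simp only [Finset.coe_biUnion, Finset.coe_image, Set.mem_iUnion, Set.mem_image] at hx
    obtain ⟨z, -, n, -, rfl⟩ := hx
    exact ⟨n, hy z n⟩
  · rw [← hs x]
    refine Submodule.sum_mem _ fun n hn => Submodule.subset_span ?_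
    simp only [Finset.coe_biUnion, Finset.coe_image, Set.mem_iUnion, Set.mem_image]
    exact ⟨x, hx, n, hn, rfl⟩
  · simp only [Finset.coe_biUnion, Finset.coe_image, Set.mem_iUnion, Set.mem_image] at hx
    obtain ⟨z, hz, n, -, rfl⟩ := hx
    exact hV _ (hy z) ((hs z).symm ▸ hSV (Submodule.subset_span hz) :) n

end Homogeneous

variable (𝒜) in
/-- The graded modules which are finitely generated up to `I⁺`-torsion. -/
def isAlmostFG : ObjectProperty (GrMod 𝒜) := fun M => IsAlmostFinite (idealPos 𝒜) M

lemma isPosTorsion_le_isAlmostFG : isPosTorsion 𝒜 ≤ isAlmostFG 𝒜 :=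
  fun _ h => IsAlmostFinite.of_torsion h

lemma isFG_le_isAlmostFG : isFG 𝒜 ≤ isAlmostFG 𝒜 :=
  fun _ (_ : Module.Finite A _) => IsAlmostFinite.of_finite

instance [IsNoetherianRing A] : (isAlmostFG 𝒜).IsSerreClass where
  exists_zero := ⟨zeroObj 𝒜, isZero_zeroObj, IsAlmostFinite.of_torsion fun _ _ _ =>
    ⟨1, one_pos, rfl⟩⟩
  prop_of_mono f _ hN := IsAlmostFinite.of_injective f.lin (injective_of_mono f) hN
  prop_of_epi f _ hM := IsAlmostFinite.of_surjective f.lin (surjective_of_epi f) hM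
  prop_X₂_of_shortExact hS h₁ h₃ := by
    obtain ⟨-, hg, h⟩ := (shortExact_iff _).1 hS
    exact IsAlmostFinite.of_exact (Hom.lin _) (Hom.lin _) hg h h₁ h₃

/-- The kernel and cokernel of `f` are torsion and so belong to the Serre class of almost finitely
generated modules. -/
lemma isAlmostFG_iff_of_isoModSerre [IsNoetherianRing A] {M N : GrMod 𝒜} (f : M ⟶ N)
    (hf : (isPosTorsion 𝒜).isoModSerre f) : isAlmostFG 𝒜 M ↔ isAlmostFG 𝒜 N := by
  constructor
  · intro h
    exact ObjectProperty.prop_X₂_of_exact (isAlmostFG 𝒜)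
      (ShortComplex.exact_cokernel f) h (isPosTorsion_le_isAlmostFG _ hf.2)
  · intro h
    exact ObjectProperty.prop_X₂_of_exact (isAlmostFG 𝒜)
      (ShortComplex.exact_kernel f) (isPosTorsion_le_isAlmostFG _ hf.1) h

lemma isPosTorsion_cokernel_of {M N : GrMod 𝒜} (f : M ⟶ N)
    (h : ∀ x : N, ∀ a ∈ idealPos 𝒜, ∃ k : ℕ, a ^ k • x ∈ LinearMap.range f.lin) :
    isPosTorsion 𝒜 (cokernel f) := fun x a ha => by
  obtain ⟨x, rfl⟩ := surjective_of_epi (cokernel.π f) x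
  obtain ⟨k, y, hy⟩ := h x a ha
  refine ⟨k + 1, by omega, ?_⟩
  have : (cokernel.π f).lin (f.lin y) = 0 :=
    LinearMap.congr_fun (congrArg Hom.lin (cokernel.condition f)) y
  rw [pow_succ', mul_smul, ← map_smul, ← hy, this, smul_zero]

/-- An isomorphism in the quotient is a fraction of isomorphisms modulo torsion, and these preserve
almost finite generation. Conversely, the finitely generated submodule is enlarged to a homogeneous
one, whose inclusion has torsion cokernel. -/
lemma isFG_quot_obj_iff [IsNoetherianRing A] [GradedRing 𝒜] (M : GrMod 𝒜) :
    QGr.isFG 𝒜 ((QGr.quot 𝒜).obj M) ↔ isAlmostFG 𝒜 M := by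
  constructor
  · rintro ⟨N, hN, ⟨e⟩⟩
    obtain ⟨φ, hφ⟩ := Localization.exists_rightFraction (QGr.quot 𝒜)
      (isPosTorsion 𝒜).isoModSerre e.hom
    have h₁ : IsIso ((QGr.quot 𝒜).map φ.s) := Localization.inverts _ _ _ φ.hs
    have h₂ : IsIso ((QGr.quot 𝒜).map φ.f) := by
      have : (QGr.quot 𝒜).map φ.f = (QGr.quot 𝒜).map φ.s ≫ e.hom := by
        rw [hφ, MorphismProperty.RightFraction.map_s_comp_map]
      rw [this]
      infer_instance
    rw [ObjectProperty.SerreClassLocalization.isIso_map_iff (QGr.quot 𝒜) (isPosTorsion 𝒜)] at h₂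
    rw [← isAlmostFG_iff_of_isoModSerre _ h₂, isAlmostFG_iff_of_isoModSerre _ φ.hs]
    exact isFG_le_isAlmostFG _ hN
  · rintro ⟨S, hS, h⟩
    obtain ⟨W, hW, hW', hSW, -⟩ := isHomogeneous_top.exists_fg hS le_top
    have := mono_of_injective (subι M W hW') (subι_injective M W hW')
    have h' : IsIso ((QGr.quot 𝒜).map (subι M W hW')) :=
      Localization.inverts _ (isPosTorsion 𝒜).isoModSerre _
        ((isPosTorsion 𝒜).isoModSerre_of_mono (subι M W hW') (isPosTorsion_cokernel_of _ fun x a ha => by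
          rw [range_subι]
          exact (h x a ha).imp fun _ hk => hSW hk))
    exact ⟨subObj M W hW', Module.Finite.of_fg hW, ⟨asIso ((QGr.quot 𝒜).map (subι M W hW'))⟩⟩

/-! ### Cohomology of graded modules in terms of elements. -/

section Homology

/-- The homology of a short complex of graded modules is the quotient of the kernel by the range. -/
lemma exists_homology_surjection (S : ShortComplex (GrMod 𝒜)) :
    ∃ φ : LinearMap.ker S.g.lin →ₗ[A] S.homology, Function.Surjective φ ∧
      ∀ x, φ x = 0 ↔ (x : S.X₂) ∈ LinearMap.range S.f.lin := by
  have hi := isKernelOf (kerι S.g) S.g (kerι_comp S.g) Subtype.val_injective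
    fun x hx => ⟨⟨x, hx⟩, rfl⟩
  let f' := hi.lift (KernelFork.ofι _ S.zero)
  have hf' : f' ≫ kerι S.g = S.f := hi.fac _ WalkingParallelPair.zero
  let h : S.LeftHomologyData :=
    { K := kerObj S.g
      H := cokerObj f'
      i := kerι S.g
      π := cokerπ f'
      wi := kerι_comp S.g
      hi := hi
      wπ := comp_cokerπ f'
      hπ := isCokernelOf f' (cokerπ f') (comp_cokerπ f') (Submodule.mkQ_surjective _)
        fun _ hx => (Submodule.Quotient.mk_eq_zero _).1 hx }
  have he := bijective_of_isIso h.homologyIso.inv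
  refine ⟨h.homologyIso.inv.lin.comp (cokerπ f').lin,
    he.2.comp (Submodule.mkQ_surjective _), fun x => ?_⟩
  have h₁ : h.homologyIso.inv.lin.comp (cokerπ f').lin x = 0 ↔ (cokerπ f').lin x = 0 :=
    map_eq_zero_iff h.homologyIso.inv.lin he.1
  refine h₁.trans ((Submodule.Quotient.mk_eq_zero _).trans ?_)
  constructor
  · rintro ⟨y, rfl⟩
    exact ⟨y, LinearMap.congr_fun (congrArg Hom.lin hf'.symm) y⟩
  · rintro ⟨y, hy⟩
    exact ⟨y, Subtype.ext ((LinearMap.congr_fun (congrArg Hom.lin hf') y).trans hy)⟩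

lemma isPosTorsion_homology (S : ShortComplex (GrMod 𝒜))
    (h : ∀ x, S.g.lin x = 0 → ∀ a ∈ idealPos 𝒜, ∃ k : ℕ, a ^ k • x ∈ LinearMap.range S.f.lin) :
    isPosTorsion 𝒜 S.homology := fun y a ha => by
  obtain ⟨φ, hφ, hφ'⟩ := exists_homology_surjection S
  obtain ⟨x, rfl⟩ := hφ y
  obtain ⟨k, hk⟩ := h x.1 x.2 a ha
  refine ⟨k + 1, by omega, ?_⟩
  rw [pow_succ', mul_smul, ← map_smul, (hφ' (a ^ k • x)).2 hk, smul_zero]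

lemma isFG_homology [IsNoetherianRing A] (S : ShortComplex (GrMod 𝒜)) (h : isFG 𝒜 S.X₂) :
    isFG 𝒜 S.homology := by
  obtain ⟨φ, hφ, -⟩ := exists_homology_surjection S
  have : Module.Finite A S.X₂ := h
  exact Module.Finite.of_surjective φ hφ

lemma exists_fg_of_isAlmostFG_homology (S : ShortComplex (GrMod 𝒜))
    (h : isAlmostFG 𝒜 S.homology) : ∃ T : Submodule A S.X₂, T.FG ∧ T ≤ LinearMap.ker S.g.lin ∧
      ∀ x, S.g.lin x = 0 → ∀ a ∈ idealPos 𝒜, ∃ k : ℕ,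
        a ^ k • x ∈ T ⊔ LinearMap.range S.f.lin := by
  obtain ⟨φ, hφ, hφ'⟩ := exists_homology_surjection S
  obtain ⟨T, hT, h⟩ := h
  obtain ⟨T, hT', rfl⟩ := hT.exists_fg_map_eq (f := φ) (by
    rw [LinearMap.range_eq_top.2 hφ]; exact le_top)
  refine ⟨T.map (LinearMap.ker S.g.lin).subtype, hT'.map _, ?_, fun x hx a ha => ?_⟩
  · rintro _ ⟨x, -, rfl⟩
    exact x.2
  · obtain ⟨k, y, hy, hk⟩ := h (φ ⟨x, hx⟩) a ha
    refine ⟨k, ?_⟩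
    have := (hφ' (a ^ k • ⟨x, hx⟩ - y)).1 (by rw [map_sub, map_smul, hk, sub_self])
    rw [← sub_add_cancel (a ^ k • x) y.1, add_comm]
    exact Submodule.add_mem_sup ⟨y, hy, rfl⟩ this

end Homology

end GrMod

/-! ### Finitely generated subcomplexes with the same image in the quotient. -/

namespace GrMod

variable {A : Type u} [CommRing A] {𝒜 : ℤ → AddSubgroup A}

section Subcomplex

open DerivedCategory

variable (K : CochainComplex (GrMod 𝒜) ℤ)

/-- A homogeneous submodule of `K^n` maps to a homogeneous submodule `V` of `K^{n+1}`, and generates,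
modulo boundaries and torsion, the elements mapping to `V`. -/
structure IsLift (n : ℤ) (V : Submodule A (K.X (n + 1))) (W : Submodule A (K.X n)) : Prop where
  le_comap : W ≤ V.comap (K.d n (n + 1)).lin
  exists_smul_mem : ∀ x, (K.d n (n + 1)).lin x ∈ V → ∀ a ∈ idealPos 𝒜, ∃ k : ℕ,
    a ^ k • x ∈ W ⊔ LinearMap.range (K.d (n - 1) n).lin

variable {K}

lemma exists_fg_cycles [IsNoetherianRing A] (n : ℤ) (hK : isAlmostFG 𝒜 (K.homology n)) :
    ∃ T : Submodule A (K.X n), T.FG ∧ T ≤ LinearMap.ker (K.d n (n + 1)).lin ∧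
      ∀ x : K.X n, (K.d n (n + 1)).lin x = 0 → ∀ a ∈ idealPos 𝒜, ∃ k : ℕ,
        a ^ k • x ∈ T ⊔ LinearMap.range (K.d (n - 1) n).lin :=
  exists_fg_of_isAlmostFG_homology (K.sc' (n - 1) n (n + 1))
    (ObjectProperty.prop_of_iso _ (K.homologyIsoSc' (n - 1) n (n + 1) (by simp) (by simp)) hK)

/-- Two kinds of generators suffice: cycles `T` generating the cohomology up to torsion, and
preimages `T'` of generators of the boundaries in `V`, finitely many by Noetherianity. An `x` with
boundary in `V` differs by an element of `T'` from a cycle. `W` contains the homogeneous components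
of these generators. -/
lemma exists_isLift [IsNoetherianRing A] [GradedRing 𝒜] (n : ℤ)
    (hK : isAlmostFG 𝒜 (K.homology n)) (V : Submodule A (K.X (n + 1))) (hV : V.FG)
    (hV' : IsHomogeneous V) :
    ∃ W : Submodule A (K.X n), W.FG ∧ IsHomogeneous W ∧ IsLift K n V W := by
  obtain ⟨T, hT, hTle, h⟩ := exists_fg_cycles n hK
  have hV₂ : (V ⊓ LinearMap.range (K.d n (n + 1)).lin).FG := hV.of_le inf_le_left
  obtain ⟨T', hT', hT'V⟩ := hV₂.exists_fg_map_eq inf_le_right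
  have hle : T ⊔ T' ≤ V.comap (K.d n (n + 1)).lin := by
    refine sup_le (fun x hx => ?_) (fun x hx => ?_)
    · have : (K.d n (n + 1)).lin x = 0 := hTle hx
      rw [Submodule.mem_comap, this]
      exact zero_mem _
    · exact ((hT'V.le ⟨x, hx, rfl⟩ :) : _ ∈ V ⊓ _).1
  obtain ⟨W, hW, hW', hTW, hWV⟩ := (hV'.comap (K.d n (n + 1))).exists_fg (hT.sup hT') hle
  refine ⟨W, hW, hW', hWV, fun x hx a ha => ?_⟩
  obtain ⟨y, hy, hyx⟩ := hT'V.ge ⟨hx, x, rfl⟩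
  obtain ⟨k, hk⟩ := h (x - y) ((map_sub (K.d n (n + 1)).lin x y).trans
    (sub_eq_zero.2 hyx.symm)) a ha
  refine ⟨k, ?_⟩
  rw [← sub_add_cancel x y, smul_add]
  exact add_mem (sup_le_sup_right (le_sup_left.trans hTW) _ hk)
    (Submodule.mem_sup_left (hTW (Submodule.mem_sup_right (Submodule.smul_mem _ _ hy))))

/-- Families indexed by the integers defined by descending recursion. -/
def descend {α : ℤ → Type*} (N : ℤ) (x₀ : ∀ n, α n) (step : ∀ n, α (n + 1) → α n) (n : ℤ) : α n :=
  if N < n then x₀ n else step n (descend N x₀ step (n + 1))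
termination_by (N + 1 - n).toNat
decreasing_by lia

lemma exists_family_isLift [IsNoetherianRing A] [GradedRing 𝒜] (N : ℤ)
    (hN : ∀ n, N < n → IsZero (K.X n)) (hK : ∀ n, isAlmostFG 𝒜 (K.homology n)) :
    ∃ V : ∀ n, Submodule A (K.X n), ∀ n, (V n).FG ∧ IsHomogeneous (V n) ∧
      IsLift K n (V (n + 1)) (V n) := by
  -- The hypotheses on `V` go inside the existential so that the choice is a total function, as the
  -- recursion requires.
  have h (n : ℤ) (V : Submodule A (K.X (n + 1))) : ∃ W : Submodule A (K.X n),
      V.FG ∧ IsHomogeneous V → W.FG ∧ IsHomogeneous W ∧ IsLift K n V W := by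
    by_cases hV : V.FG ∧ IsHomogeneous V
    · obtain ⟨W, hW⟩ := exists_isLift n (hK n) V hV.1 hV.2
      exact ⟨W, fun _ => hW⟩
    · exact ⟨⊥, fun h => (hV h).elim⟩
  choose step hstep using h
  let V := descend (α := fun n => Submodule A (K.X n)) N (fun _ => ⊥) step
  have hV₁ (n : ℤ) (hn : N < n) : V n = ⊥ := by
    rw [show V n = _ from descend.eq_1 ..]
    exact if_pos hn
  have hV₂ (n : ℤ) (hn : ¬ N < n) : V n = step n (V (n + 1)) := by
    rw [show V n = _ from descend.eq_1 ..]
    exact if_neg hn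
  -- Descending induction, with `k` bounding the distance to the range above `N`, where the complex
  -- is zero and `⊥` works.
  have key (k : ℕ) : ∀ n, N < n + k → (V n).FG ∧ IsHomogeneous (V n) ∧
      IsLift K n (V (n + 1)) (V n) := by
    induction k with
    | zero =>
      intro n hn
      have hn' : N < n := by simpa using hn
      rw [hV₁ n hn']
      refine ⟨Submodule.fg_bot, isHomogeneous_bot, bot_le, fun x _ a _ => ⟨0, ?_⟩⟩
      rw [(isZero_iff _).1 (hN n hn') x, smul_zero]
      exact zero_mem _
    | succ k ih =>
      intro n hn
      by_cases hn' : N < n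
      · exact ih n (by lia)
      · have := ih (n + 1) (by push_cast at hn; lia)
        rw [hV₂ n hn']
        exact hstep n _ ⟨this.1, this.2.1⟩
  exact ⟨V, fun n => key (N + 1 - n).toNat n (by lia)⟩

variable (K) in
/-- The subcomplex given by homogeneous submodules compatible with the differential. -/
noncomputable def subcomplex (V : ∀ n, Submodule A (K.X n)) (hV : ∀ n, IsHomogeneous (V n))
    (h : ∀ i j, V i ≤ (V j).comap (K.d i j).lin) : CochainComplex (GrMod 𝒜) ℤ where
  X n := subObj (K.X n) (V n) (hV n)
  d i j := liftInj (subι _ _ (hV j)) (subι_injective _ _ _) (subι _ _ (hV i) ≫ K.d i j)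
    fun x => by
      rw [range_subι]
      exact h i j x.2
  shape i j hij := by
    have := mono_of_injective _ (subι_injective _ _ (hV j))
    rw [← cancel_mono (subι _ _ (hV j)), liftInj_comp, K.shape i j hij, comp_zero, zero_comp]
  d_comp_d' i j k _ _ := by
    have := mono_of_injective _ (subι_injective _ _ (hV k))
    rw [← cancel_mono (subι _ _ (hV k)), Category.assoc, liftInj_comp, ← Category.assoc,
      liftInj_comp, Category.assoc, K.d_comp_d, comp_zero, zero_comp]

variable (K) in
/-- The inclusion of a subcomplex. -/
noncomputable def subcomplexι (V : ∀ n, Submodule A (K.X n)) (hV : ∀ n, IsHomogeneous (V n))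
    (h : ∀ i j, V i ≤ (V j).comap (K.d i j).lin) : subcomplex K V hV h ⟶ K where
  f n := subι _ _ (hV n)
  comm' _ _ _ := (liftInj_comp _ _ _ _).symm

variable [HasDerivedCategory (GrMod 𝒜)]

/-- The cohomology of `Q(K)`. -/
noncomputable def homologyQIso (K : CochainComplex (GrMod 𝒜) ℤ) (n : ℤ) :
    (homologyFunctor _ n).obj (Q.obj K) ≅ (K.sc' (n - 1) n (n + 1)).homology :=
  (homologyFunctorFactors _ n).app K ≪≫ K.homologyIsoSc' (n - 1) n (n + 1) (by simp) (by simp)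

variable [HasDerivedCategory (QGr 𝒜)]

lemma isZero_phiStar_obj_Q_obj (h : ∀ n x, (K.d n (n + 1)).lin x = 0 → ∀ a ∈ idealPos 𝒜,
    ∃ k : ℕ, a ^ k • x ∈ LinearMap.range (K.d (n - 1) n).lin) :
    IsZero ((phiStar 𝒜).obj (Q.obj K)) := by
  rw [isZero_phiStar_obj_iff]
  exact fun n => ObjectProperty.prop_of_iso _ (homologyQIso K n).symm
    (isPosTorsion_homology _ (h n))

open Pretriangulated in
-- The lifting condition says that the cohomology of K/P is torsion: a cycle of the quotient is
-- represented by `x` with boundary in `P`, and some multiple `a ^ k • x` lies in `P` plus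
-- boundaries. So φ^* kills the cone of `φ`.
lemma isIso_phiStar_map_Q_map_of_isLift {P : CochainComplex (GrMod 𝒜) ℤ} (φ : P ⟶ K)
    (hφ : ∀ n, Function.Injective (φ.f n).lin)
    (h : ∀ n, IsLift K n (LinearMap.range (φ.f (n + 1)).lin) (LinearMap.range (φ.f n).lin)) :
    IsIso ((phiStar 𝒜).map (Q.map φ)) := by
  have : ∀ n, Mono (φ.f n) := fun n => mono_of_injective _ (hφ n)
  have : Mono φ := HomologicalComplex.mono_of_mono_f φ inferInstance
  let S : ShortComplex (CochainComplex (GrMod 𝒜) ℤ) :=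
    ShortComplex.mk φ (cokernel.π φ) (cokernel.condition φ)
  have hS : S.ShortExact := ⟨ShortComplex.exact_cokernel φ⟩
  have hS' (n : ℤ) := (shortExact_iff _).1
    ((HomologicalComplex.shortExact_iff_degreewise_shortExact S).1 hS n)
  have hd (i j : ℤ) (x : K.X i) : (S.X₃.d i j).lin ((S.g.f i).lin x) =
      (S.g.f j).lin ((K.d i j).lin x) :=
    LinearMap.congr_fun (congrArg Hom.lin (S.g.comm i j)) x
  have hT := (phiStar 𝒜).map_distinguished _ (triangleOfSES_distinguished hS)
  refine (Triangle.isZero₃_iff_isIso₁ _ hT).1 (isZero_phiStar_obj_Q_obj fun n y hy a ha => ?_)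
  obtain ⟨(x : K.X n), rfl⟩ := (hS' n).2.1 y
  obtain ⟨k, hk⟩ := (h n).exists_smul_mem x ((hS' (n + 1)).2.2 _ ((hd _ _ x).symm.trans hy)) a ha
  obtain ⟨_, ⟨p, rfl⟩, _, ⟨z, rfl⟩, hpz⟩ := Submodule.mem_sup.1 hk
  refine ⟨k, (S.g.f (n - 1)).lin z, (hd _ _ z).trans ?_⟩
  have h₀ : (S.g.f n).lin ((φ.f n).lin p) = 0 :=
    LinearMap.congr_fun (congrArg Hom.lin
      (HomologicalComplex.congr_hom (cokernel.condition φ) n)) p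
  have h₁ := congrArg (S.g.f n).lin hpz
  rw [map_add, h₀, zero_add] at h₁
  exact h₁.trans (map_smul (S.g.f n).lin (a ^ k) x)

/-- A bounded above complex whose cohomologies are finitely generated up to torsion contains a
subcomplex of finitely generated modules with the same image in the quotient category. -/
lemma exists_isFG_subcomplex [IsNoetherianRing A] [GradedRing 𝒜] (N : ℤ)
    (hN : ∀ n, N < n → IsZero (K.X n)) (hK : ∀ n, isAlmostFG 𝒜 (K.homology n)) :
    ∃ (P : CochainComplex (GrMod 𝒜) ℤ) (φ : P ⟶ K), (∀ n, isFG 𝒜 (P.X n)) ∧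
      IsIso ((phiStar 𝒜).map (Q.map φ)) := by
  obtain ⟨V, hV⟩ := exists_family_isLift N hN hK
  have h (i j : ℤ) : V i ≤ (V j).comap (K.d i j).lin := by
    by_cases hij : i + 1 = j
    · subst hij
      exact (hV i).2.2.le_comap
    · intro x _
      have : (K.d i j).lin x = 0 := by
        rw [K.shape i j hij]
        rfl
      rw [Submodule.mem_comap, this]
      exact zero_mem _
  refine ⟨subcomplex K V (fun n => (hV n).2.1) h, subcomplexι K V _ h,
    fun n => Module.Finite.of_fg (hV n).1,
    isIso_phiStar_map_Q_map_of_isLift _ (fun n => subι_injective _ _ _) fun n => ?_⟩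
  have e (n : ℤ) : LinearMap.range ((subcomplexι K V (fun n => (hV n).2.1) h).f n).lin = V n :=
    range_subι _ _ _
  rw [e, e]
  exact (hV n).2.2

end Subcomplex

end GrMod

/-! ### Triangulated subcategories defined by a Serre class. -/

section Homology

open DerivedCategory Pretriangulated

variable {C : Type*} [Category* C] [Abelian C] [HasDerivedCategory C]

/-- The objects of the derived category with cohomologies in a given Serre class. -/
def homologyProp (P : ObjectProperty C) : ObjectProperty (DerivedCategory C) :=
  fun X => ∀ n, P ((homologyFunctor C n).obj X)

instance (P : ObjectProperty C) [P.IsClosedUnderIsomorphisms] :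
    (homologyProp P).IsClosedUnderIsomorphisms :=
  ⟨fun e h n => P.prop_of_iso ((homologyFunctor C n).mapIso e) (h n)⟩

instance (P : ObjectProperty C) [P.IsSerreClass] : (homologyProp P).IsTriangulated where
  exists_zero := ⟨_, Limits.isZero_zero _, fun n =>
    P.prop_of_isZero ((homologyFunctor C n).map_isZero (Limits.isZero_zero _))⟩
  isStableUnderShiftBy n := ⟨fun X hX m => P.prop_of_iso
    (((homologyFunctor C 0).shiftIso n m (n + m) rfl).app X).symm (hX (n + m))⟩
  toIsTriangulatedClosed₂ := .mk' fun T hT h₁ h₃ n =>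
    P.prop_X₂_of_exact (HomologySequence.exact₂ T hT n) (h₁ n) (h₃ n)

end Homology

/-! ### Coherent objects and the conclusion. -/

section

open GrMod DerivedCategory

variable {A : Type u} [CommRing A] [IsNoetherianRing A] {𝒜 : ℤ → AddSubgroup A} [GradedRing 𝒜]
  [HasDerivedCategory (GrMod 𝒜)] [HasDerivedCategory (QGr 𝒜)]

instance : (QGr.isFG 𝒜).IsClosedUnderIsomorphisms :=
  inferInstanceAs ((GrMod.isFG 𝒜).map (QGr.quot 𝒜)).IsClosedUnderIsomorphisms

lemma isFG_homology_phiStar_obj_iff (X : DerivedCategory (GrMod 𝒜)) (n : ℤ) :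
    QGr.isFG 𝒜 ((homologyFunctor _ n).obj ((phiStar 𝒜).obj X)) ↔
      isAlmostFG 𝒜 ((homologyFunctor _ n).obj X) :=
  ((QGr.isFG 𝒜).prop_iff_of_iso
    ((mapDerivedCategoryCompHomologyIso (QGr.quot 𝒜) n).app X)).trans (isFG_quot_obj_iff _)

instance (s : Boundedness) : (s.subcatOf (QGr.isFG 𝒜)).IsClosedUnderIsomorphisms :=
  inferInstanceAs (s.subcat _ ⊓ homologyProp (QGr.isFG 𝒜)).IsClosedUnderIsomorphisms

/-- Since Y ≅ φ^* R Y, coherence of `Y` is almost finite generation of the cohomology of `R.obj Y`.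
The latter is a Serre condition on graded modules, so pulling it back along the triangulated functor
`R` avoids proving that q⁺gr A is a Serre class. -/
lemma Boundedness.isTriangulated_subcatOf_isFG (s : Boundedness)
    {R : DerivedCategory (QGr 𝒜) ⥤ DerivedCategory (GrMod 𝒜)} (adj : phiStar 𝒜 ⊣ R)
    [R.CommShift ℤ] [R.IsTriangulated] [IsIso adj.counit] :
    (s.subcatOf (QGr.isFG 𝒜)).IsTriangulated := by
  have h : s.subcatOf (QGr.isFG 𝒜) = s.subcat _ ⊓ (homologyProp (isAlmostFG 𝒜)).inverseImage R := by
    ext Y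
    refine and_congr_right fun _ => forall_congr' fun n => ?_
    rw [← isFG_homology_phiStar_obj_iff]
    exact (QGr.isFG 𝒜).prop_iff_of_iso
      ((homologyFunctor _ n).mapIso (asIso (adj.counit.app Y)).symm)
  rw [h]
  infer_instance

variable {r : ℕ} {f : Fin r → A} {d : Fin r → ℤ} (hf : ∀ i, f i ∈ 𝒜 (d i))
  (hspan : Ideal.span (Set.range f) = idealPos 𝒜)

instance : (GrMod.isFG 𝒜).IsClosedUnderIsomorphisms where
  of_iso e h :=
    have : Module.Finite A _ := h
    Module.Finite.of_surjective _ (surjective_of_epi e.hom)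

lemma isFG_homology_Q_obj {P : CochainComplex (GrMod 𝒜) ℤ} (hP : ∀ n, isFG 𝒜 (P.X n)) (n : ℤ) :
    isFG 𝒜 ((homologyFunctor _ n).obj (Q.obj P)) :=
  ObjectProperty.prop_of_iso _ (homologyQIso P n).symm (isFG_homology _ (hP n))

include hspan in
-- Images of coherent objects qualify because φ^* inverts the Čech unit. Conversely, an orthogonal
-- `X` with coherent image is Č of a coherent object with the same image under φ^*, namely a
-- truncation of a finitely generated subcomplex of a model of `X`.
lemma Boundedness.cohTrivialSubcat_eq (s : Boundedness) : s.cohTrivialSubcat hf =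
    (kerProp (phiStar 𝒜)).rightOrthogonal ⊓
      (s.subcatOf (QGr.isFG 𝒜)).inverseImage (phiStar 𝒜) := by
  ext X
  constructor
  · rintro ⟨M, hM, ⟨e⟩⟩
    refine ObjectProperty.prop_of_iso _ e ⟨rightOrthogonal_cech_obj hf hspan M, ?_⟩
    have := isIso_phiStar_map_cechUnit hf hspan M
    refine ObjectProperty.prop_of_iso (s.subcatOf (QGr.isFG 𝒜))
      (asIso ((phiStar 𝒜).map ((cechUnit hf).app M)))
      ⟨subcat_mapDerivedCategory_obj _ hM.1, fun n => ?_⟩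
    rw [isFG_homology_phiStar_obj_iff]
    exact isFG_le_isAlmostFG _ (hM.2 n)
  · rintro ⟨hX, hFX⟩
    have hX' : s.trivialSubcat hf X := by
      rw [s.trivialSubcat_eq hf hspan]
      exact ⟨hX, hFX.1⟩
    -- `X` itself, and not only its image, is bounded above, so it has a strictly bounded above
    -- model on which the descending recursion can start.
    obtain ⟨N, hN⟩ := s.subcat_le_minus _ hX'.1
    obtain ⟨K, hK, ⟨e⟩⟩ := exists_iso_Q_obj_of_isLE X N
    obtain ⟨P, φ, hP, hφ⟩ := exists_isFG_subcomplex (K := K) N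
      (fun n hn => K.isZero_of_isStrictlyLE N n hn) fun n => ObjectProperty.prop_of_iso _
        ((homologyFunctor _ n).mapIso e ≪≫ (homologyFunctorFactors _ n).app K)
        ((isFG_homology_phiStar_obj_iff X n).1 (hFX.2 n))
    -- Boundedness is known only for the image of `P`: `P` may have torsion cohomology in infinitely
    -- many negative degrees, which the truncation `Z` removes when `s` is `bounded`.
    obtain ⟨Y, Z, g, h, hg, hh, hZ, hZ'⟩ := exists_zigzag (QGr.quot 𝒜) s (Q.obj P)
      (ObjectProperty.prop_of_iso (s.subcat _)
        ((phiStar 𝒜).mapIso e ≪≫ (asIso ((phiStar 𝒜).map (Q.map φ))).symm) hFX.1)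
    obtain ⟨e₁⟩ := nonempty_iso_cech_obj hf hspan hX
    obtain ⟨e₂⟩ := nonempty_cech_obj_iso hf hspan g h hg hh
    have := isIso_cech_map hf hspan (Q.map φ) hφ
    refine ⟨Z, ⟨hZ, fun n => ?_⟩, ⟨e₂.symm ≪≫ asIso ((cech hf).map (Q.map φ)) ≪≫
      (cech hf).mapIso e.symm ≪≫ e₁.symm⟩⟩
    obtain h₀ | ⟨⟨e'⟩⟩ := hZ' n
    · have : Subsingleton ((homologyFunctor (GrMod 𝒜) n).obj Z).carrier :=
        subsingleton_of_forall_eq 0 ((isZero_iff _).1 h₀)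
      exact Module.Finite.of_finite
    · exact ObjectProperty.prop_of_iso (GrMod.isFG 𝒜) e'.symm (isFG_homology_Q_obj hP n)

end

theorem mainTheorem8 {A : Type u} [CommRing A] [IsNoetherianRing A] (𝒜 : ℤ → AddSubgroup A)
    [GradedRing 𝒜] [HasDerivedCategory (GrMod 𝒜)] [HasDerivedCategory (QGr 𝒜)]
    {r : ℕ} (f : Fin r → A) (d : Fin r → ℤ) (hf : ∀ i, f i ∈ 𝒜 (d i))
    (hspan : Ideal.span (Set.range f) = GrMod.idealPos 𝒜) :
    ∃ (R : DerivedCategory (QGr 𝒜) ⥤ DerivedCategory (GrMod 𝒜)) (adj : phiStar 𝒜 ⊣ R)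
      (_ : R.CommShift ℤ) (_ : adj.CommShift ℤ),
      R.IsTriangulated ∧ IsIso adj.counit ∧
      ∀ s : Boundedness,
        (s.trivialSubcat hf).IsTriangulated ∧
        (s.cohTrivialSubcat hf).IsTriangulated ∧
        (s.subcatOf (QGr.isFG 𝒜)).IsTriangulated ∧
        s.cohTrivialSubcat hf ≤ s.trivialSubcat hf ∧
        RestrictsToEquivalence adj (s.trivialSubcat hf) (s.subcat (QGr 𝒜)) ∧
        RestrictsToEquivalence adj (s.cohTrivialSubcat hf) (s.subcatOf (QGr.isFG 𝒜)) := by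
  obtain ⟨R, adj, hadj⟩ := exists_phiStar_adjunction hf hspan
  -- The right adjoint of a triangulated functor is triangulated for the shift structure transported
  -- along the adjunction.
  let := adj.rightAdjointCommShift ℤ
  have := adj.commShift_of_leftAdjoint ℤ
  have hR := adj.isTriangulated_rightAdjoint
  refine ⟨R, adj, inferInstance, inferInstance, hR, hadj, fun s => ?_⟩
  have := s.isTriangulated_subcatOf_isFG adj
  -- Both subcategories are now intersections of the right orthogonal with preimages under φ^*, so
  -- they are triangulated and the general equivalence applies to each.
  rw [s.trivialSubcat_eq hf hspan, s.cohTrivialSubcat_eq hf hspan]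
  exact ⟨inferInstance, inferInstance, this, fun X hX => ⟨hX.1, hX.2.1⟩,
    restrictsToEquivalence_inverseImage adj _, restrictsToEquivalence_inverseImage adj _⟩
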